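/- Let $(X_1,Y_1),(X_2,Y_2),\dots$ be i.i.d. pairs of real random variables whose joint distribution function $F_{X,Y}$ does not depend on $n$, is continuous, and satisfies $F_{X,Y}(x,y)=F_X(x)F_Y(y)$ for all $x,y$. For real data $(x_1,y_1),\dots,(x_n,y_n)$ and a rearrangement $[1],\dots,[n]$ of $1,\dots,n$ with $x_{[1]}\le\dots\le x_{[n]}$ (ties broken in an arbitrary way), put $R_i=\#\{j:y_j\le y_i\}$, $L_i=\#\{j:y_j\ge y_i\}$, and define Chatterjee's rank correlation $$1-\frac{n}{2\sum_{i=1}^n L_i(n-L_i)}\sum_{i=1}^{n-1}\bigl|R_{[i+1]}-R_{[i]}\bigr|$$ (read as $1$ if all $y_i$ are equal). Let $\xi_n$ be its value on the original sample $(\mathbf X,\mathbf Y)=\{(X_i,Y_i)\}_{i=1}^n$, and $\tilde\xi_b$ its value on a bootstrap sample of size $n$ drawn uniformly with replacement from the original sample. These statistics are square integrable, and the following holds. (i) (Variance inconsistency) Neither $n\,E[(\tilde\xi_b-\xi_n)^2\mid\mathbf X,\mathbf Y]$ nor $n\,\mathrm{Var}[\tilde\xi_b\mid\mathbf X,\mathbf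 Y]$ converges to $2/5$ in probability. (ii) (Distribution inconsistency) There are Borel sets $\mathcal E_n\subseteq(\mathbb R^2)^n$ with $\liminf_{n\to\infty}P((X_1,Y_1,\dots,X_n,Y_n)\in\mathcal E_n)>0$ such that, both for $T_n=\sqrt n(\tilde\xi_b-\xi_n)$ and for $T_n=\sqrt n(\tilde\xi_b-E[\tilde\xi_b\mid\mathbf X,\mathbf Y])$, the law of $T_n$ conditional on the event $(X_1,Y_1,\dots,X_n,Y_n)\in\mathcal E_n$ does not converge weakly to $N(0,2/5)$; moreover, for every sequence of samples $z_n$ with $z_n\in\mathcal E_n$ for all large $n$, the (regular) conditional law of $T_n$ given $(X_1,Y_1,\dots,X_n,Y_n)=z_n$ does not converge weakly to $N(0,2/5)$. (iii) $\lim_{n\to\infty}E[\tilde\xi_b]=1/e$, and $\limsup_{n\to\infty}n\,E\bigl[\mathrm{Var}[\tilde\xi_b\mid\mathbf X,\mathbf Y]\bigr]\le\frac35-\frac{8}{5e^2}<\frac25$. -/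

import Mathlib

open MeasureTheory ProbabilityTheory Filter Topology
open scoped ENNReal NNReal BoundedContinuousFunction

noncomputable section

/-- The rank `R_i = #{j : y_j ≤ y_i}`, as a real number. -/
def upRank {n : ℕ} (y : Fin n → ℝ) (i : Fin n) : ℝ :=
  ∑ j : Fin n, if y j ≤ y i then 1 else 0

/-- The reversed rank `L_i = #{j : y_j ≥ y_i}`, as a real number. -/
def downRank {n : ℕ} (y : Fin n → ℝ) (i : Fin n) : ℝ :=
  ∑ j : Fin n, if y i ≤ y j then 1 else 0

/-- `π` is a rearrangement of the indices that puts `x` in nondecreasing order,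
`x_{π(0)} ≤ x_{π(1)} ≤ …`; ties in `x` may be ordered in any way. -/
def IsArrangement {n : ℕ} (x : Fin n → ℝ) (π : Equiv.Perm (Fin n)) : Prop :=
  Monotone fun i => x (π i)

/-- Chatterjee's rank correlation, in the form that allows for ties, of a sample with second
coordinates `y` whose first coordinates are put in nondecreasing order by `π`:
`1 - n / (2 ∑ᵢ Lᵢ (n - Lᵢ)) * ∑ᵢ |R_{π(i+1)} - R_{π(i)}|`. (The denominator vanishes only if all
`y_i` are equal; then the sum in the numerator vanishes too, and the value is `1`.) -/
def chatterjeeXi {n : ℕ} (y : Fin n → ℝ) (π : Equiv.Perm (Fin n)) : ℝ :=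
  1 - (n : ℝ) / (2 * ∑ i : Fin n, downRank y i * ((n : ℝ) - downRank y i)) *
    ∑ i : Fin n, if h : (i : ℕ) + 1 < n then
      |upRank y (π ⟨(i : ℕ) + 1, h⟩) - upRank y (π i)| else 0

section Bootstrap

variable {Ω : Type*} [MeasurableSpace Ω]

/-- The original sample of size `n`. -/
def sample (X Y : ℕ → Ω → ℝ) (n : ℕ) (ω : Ω) : Fin n → ℝ × ℝ :=
  fun i => (X i ω, Y i ω)

/-- The σ-algebra generated by the original sample of size `n`. -/
abbrev sampleSigma (X Y : ℕ → Ω → ℝ) (n : ℕ) : MeasurableSpace Ω :=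
  MeasurableSpace.comap (sample X Y n) inferInstance

/-- `J n 0, …, J n (n-1)` are, for each `n`, the indices of `n` draws with replacement from the
original sample of size `n`: independent, uniform on the `n` indices, and jointly independent of
the original sample. Nothing is assumed on the relation between different `n`. -/
structure IsResampling (P : Measure Ω) (X Y : ℕ → Ω → ℝ) (J : (n : ℕ) → Fin n → Ω → Fin n) :
    Prop where
  measurable : ∀ n j, Measurable (J n j)
  uniform : ∀ n (j k : Fin n), P {ω | J n j ω = k} = (n : ℝ≥0∞)⁻¹
  indep : ∀ n, iIndepFun (J n) P
  indep_sample : ∀ n, IndepFun (sample X Y n) (fun ω j => J n j ω) P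

/-- The rank correlation `ξ_n` of the original sample. -/
def sampleXi (Y : ℕ → Ω → ℝ) (π : (n : ℕ) → Ω → Equiv.Perm (Fin n)) (n : ℕ) (ω : Ω) : ℝ :=
  chatterjeeXi (fun i : Fin n => Y i ω) (π n ω)

/-- The rank correlation of the bootstrap sample, whose `j`-th member is the member of the
original sample with index `J n j`. -/
def bootXi (Y : ℕ → Ω → ℝ) (J : (n : ℕ) → Fin n → Ω → Fin n)
    (τ : (n : ℕ) → Ω → Equiv.Perm (Fin n)) (n : ℕ) (ω : Ω) : ℝ :=
  chatterjeeXi (fun j : Fin n => Y (J n j ω) ω) (τ n ω)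

end Bootstrap

/-- Weak convergence of a sequence of measures on the real line. -/
def WeaklyConverges (μ : ℕ → Measure ℝ) (ν : Measure ℝ) : Prop :=
  ∀ f : ℝ →ᵇ ℝ, Tendsto (fun n => ∫ x, f x ∂(μ n)) atTop (𝓝 (∫ x, f x ∂ν))

/-- Given that the original sample of size `n` lies in `E n`, the law of `T n` does not converge
weakly to `ν`: neither the law of `T n` under the probability conditioned on this event, nor,
for any sequence of samples `z n` that lie in `E n` for all large `n`, the conditional law of
`T n` given that the original sample equals `z n`. -/
def ConditionallyNotConverging {Ω : Type*} [MeasurableSpace Ω] (P : Measure Ω) [IsFiniteMeasure P]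
    (X Y : ℕ → Ω → ℝ) (E : (n : ℕ) → Set (Fin n → ℝ × ℝ)) (T : ℕ → Ω → ℝ)
    (ν : Measure ℝ) : Prop :=
  (¬ WeaklyConverges
    (fun n => (ProbabilityTheory.cond P {ω | sample X Y n ω ∈ E n}).map (T n)) ν) ∧
  ∀ z : (n : ℕ) → Fin n → ℝ × ℝ, (∀ᶠ n in atTop, z n ∈ E n) →
    ¬ WeaklyConverges (fun n => condDistrib (T n) (sample X Y n) P (z n)) ν

end

/-!
The core of the argument is one mean square estimate. Because of the repeats in a bootstrap sample
of size `n`, about `n (1 - 1/e)` distinct members survive; consecutive repeats contribute nothing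
to the sum of rank increments, so the bootstrapped coefficient `ξ̃` concentrates near `missProb n
= (1 - 1/n)ⁿ → 1/e` instead of `0`, and `n E (ξ̃ - missProb n)²` is bounded by `meanSquareBound
n`, which tends to `3/5 - 8/(5e²) < 2/5` (`mul_integral_sq_bootXi_sub_le`,
`tendsto_meanSquareBound`).

For this estimate, fix the first coordinates and the indices `J` of the draws, and integrate over
the independent second coordinates, which have an atomless law `ν`. In the order of the first
coordinates the bootstrap sample traces a path through the distinct members drawn, and `∑ |ΔR|` is
a sum over the steps of this path and over all levels of indicators `crossInd`. Their Hoeffding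
decomposition has a constant, first-order terms `gapProj`, second-order terms `gapRes` of the
single steps, and remainders. The former are orthogonal, with moments computed from the
probability integral transform (`integral_sq_hoeffding_main`); the remainders are negligible since
they are mostly uncorrelated (`integral_sq_sum_stepRes_le`), and the denominator is deterministic
up to the number of ties (`abs_chatterjeeXi_sub_le`). This gives a bound for each `J` in terms of
the numbers of distinct indices and of coincidences (`integral_sq_chatterjeeXi_sub_le`), and
`mul_integral_error_le` averages it over `J`. The choice `J = id` shows that the coefficient of
the original sample tends to `0` in mean square (`integral_sq_sampleXi_le`).

The rest is soft. The conditional variance has mean at most the mean square about a constant, so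
by Markov's inequality `n` times it exceeds a number just below `2/5` with probability bounded
away from `1`. The difference `ξ̃ - ξ` tends to `1/e` in mean square, so `n` times its conditional
second moment explodes. For the laws, the event `E n` collects the samples given which the
uncentered error exceeds `1` with probability at least `3/4` and the centered one has second
moment at most some `c < 2/5`; a Gaussian limit with variance `2/5` would contradict the first
property through its mass on the negative half-line, and the second through its truncated second
moments (`exists_events_conditionallyNotConverging`).
-/

noncomputable section

/-! ### Resampling one coordinate of a product measure -/

theorem integral_pi_eval {ι α : Type*} [Fintype ι] [MeasurableSpace α] {ν : Measure α}
    [IsProbabilityMeasure ν] (j : ι) {f : α → ℝ} (hf : AEStronglyMeasurable f ν) :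
    ∫ x, f (x j) ∂(Measure.pi fun _ : ι => ν) = ∫ t, f t ∂ν := by
  have h := measurePreserving_eval (fun _ : ι => ν) j
  have h1 := integral_map (f := f) h.measurable.aemeasurable (by rwa [h.map_eq])
  rw [h.map_eq] at h1
  exact h1.symm

section Update

variable {ι : Type*} [Fintype ι] [DecidableEq ι] {α : Type*} [MeasurableSpace α]
  {ν : Measure α} [IsProbabilityMeasure ν]

/-- Replacing one coordinate by an independent copy preserves a product law. -/
theorem measurePreserving_update_pi (j : ι) :
    MeasurePreserving (fun p : (ι → α) × α => Function.update p.1 j p.2)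
      ((Measure.pi fun _ : ι => ν).prod ν) (Measure.pi fun _ : ι => ν) := by
  have hm : Measurable (fun p : (ι → α) × α => Function.update p.1 j p.2) := by
    refine measurable_pi_lambda _ fun i => ?_
    by_cases h : i = j
    · subst h; simpa using measurable_snd
    · simp only [Function.update_of_ne h]
      exact (measurable_pi_apply i).comp measurable_fst
  refine ⟨hm, ?_⟩
  refine (Measure.pi_eq fun s hs => ?_).symm
  rw [Measure.map_apply hm (MeasurableSet.univ_pi hs)]
  have hpre : (fun p : (ι → α) × α => Function.update p.1 j p.2) ⁻¹' Set.univ.pi s =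
      (Set.univ.pi (Function.update s j Set.univ)) ×ˢ s j := by
    ext ⟨x, t⟩
    simp only [Set.mem_preimage, Set.mem_pi, Set.mem_univ, true_implies, Set.mem_prod]
    constructor
    · intro h
      refine ⟨fun i => ?_, by simpa using h j⟩
      by_cases hi : i = j
      · subst hi; simp
      · simpa [Function.update_of_ne hi] using h i
    · rintro ⟨h, ht⟩ i
      by_cases hi : i = j
      · subst hi; simpa using ht
      · simpa [Function.update_of_ne hi] using h i
  rw [hpre, Measure.prod_prod, Measure.pi_pi, ← Finset.prod_erase_mul _ _ (Finset.mem_univ j),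
    ← Finset.prod_erase_mul (Finset.univ) (fun i => ν (s i)) (Finset.mem_univ j)]
  simp only [Function.update_self, measure_univ, mul_one]
  congr 1
  refine Finset.prod_congr rfl fun i hi => ?_
  rw [Function.update_of_ne (Finset.ne_of_mem_erase hi)]

theorem integral_pi_update {F : (ι → α) → ℝ} (j : ι)
    (hF : Integrable F (Measure.pi fun _ : ι => ν)) :
    ∫ x, F x ∂(Measure.pi fun _ : ι => ν) =
      ∫ x, ∫ t, F (Function.update x j t) ∂ν ∂(Measure.pi fun _ : ι => ν) := by
  have h := measurePreserving_update_pi (ν := ν) j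
  have h1 : ∫ x, F x ∂(Measure.pi fun _ : ι => ν) =
      ∫ p : (ι → α) × α, F (Function.update p.1 j p.2) ∂((Measure.pi fun _ : ι => ν).prod ν) := by
    rw [← integral_map h.measurable.aemeasurable (by rw [h.map_eq]; exact hF.aestronglyMeasurable),
      h.map_eq]
  rw [h1, integral_prod]
  exact (h.integrable_comp hF.aestronglyMeasurable).2 hF

/-- A function on a product space has mean zero if its average over one of the coordinates
vanishes identically. -/
theorem integral_pi_eq_zero_of_update {F : (ι → α) → ℝ} (j : ι)
    (hF : Integrable F (Measure.pi fun _ : ι => ν))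
    (h : ∀ x, ∫ t, F (Function.update x j t) ∂ν = 0) :
    ∫ x, F x ∂(Measure.pi fun _ : ι => ν) = 0 := by
  rw [integral_pi_update j hF]; simp [h]

theorem integral_pi_eval₂ {i j : ι} (hij : i ≠ j) {f : α → α → ℝ}
    (hf : Measurable f.uncurry) (C : ℝ) (hC : ∀ a b, |f a b| ≤ C) :
    ∫ x, f (x i) (x j) ∂(Measure.pi fun _ : ι => ν) = ∫ a, ∫ b, f a b ∂ν ∂ν := by
  have hm : Measurable fun x : ι → α => f (x i) (x j) :=
    hf.comp (f := fun x : ι → α => (x i, x j))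
      ((measurable_pi_apply i).prodMk (measurable_pi_apply j))
  rw [integral_pi_update j
    (Integrable.of_bound hm.aestronglyMeasurable C (ae_of_all _ fun x => hC _ _))]
  simp only [Function.update_self, Function.update_of_ne hij]
  exact integral_pi_eval i (f := fun a => ∫ b, f a b ∂ν)
    hf.stronglyMeasurable.integral_prod_right.aestronglyMeasurable

theorem ae_pi_ne_of_atomless [MeasurableSingletonClass α] [MeasurableEq α]
    [NullSingletonClass ν] {i j : ι} (hij : i ≠ j) :
    ∀ᵐ x ∂(Measure.pi fun _ : ι => ν), x i ≠ x j := by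
  have hms : MeasurableSet {x : ι → α | x i = x j} :=
    measurableSet_eq_fun (measurable_pi_apply i) (measurable_pi_apply j)
  have h := measurePreserving_update_pi (ν := ν) j
  rw [ae_iff]
  simp only [ne_eq, not_not]
  rw [← h.measure_preimage hms.nullMeasurableSet, Measure.measure_prod_null (h.measurable hms)]
  refine ae_of_all _ fun x => ?_
  have : Prod.mk x ⁻¹' ((fun p : (ι → α) × α => Function.update p.1 j p.2) ⁻¹'
      {x : ι → α | x i = x j}) = {x i} := by
    ext t
    simp [Function.update_of_ne hij, eq_comm]
  exact (congrArg ν this).trans (measure_singleton _)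

theorem ae_pi_injective_of_atomless [MeasurableSingletonClass α] [MeasurableEq α]
    [NullSingletonClass ν] :
    ∀ᵐ x ∂(Measure.pi fun _ : ι => ν), Function.Injective x := by
  have : ∀ᵐ x ∂(Measure.pi fun _ : ι => ν), ∀ i j : ι, i ≠ j → x i ≠ x j := by
    rw [ae_all_iff]; intro i
    rw [ae_all_iff]; intro j
    by_cases hij : i = j
    · simp [hij]
    · filter_upwards [ae_pi_ne_of_atomless (ν := ν) hij] with x hx _ using hx
  filter_upwards [this] with x hx i j hij
  by_contra hne
  exact hx i j hne hij

end Update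

/-! ### The probability integral transform and its moments -/

section Transform

variable {ν : Measure ℝ} [IsProbabilityMeasure ν] [NullSingletonClass ν]

theorem continuous_cdf_of_atomless : Continuous (cdf ν) := by
  rw [continuous_iff_continuousAt]
  intro x
  rw [(monotone_cdf ν).continuousAt_iff_leftLim_eq_rightLim, StieltjesFunction.rightLim_eq]
  have h := (cdf ν).measure_singleton x
  rw [measure_cdf, measure_singleton] at h
  have h1 := ENNReal.ofReal_eq_zero.1 h.symm
  exact le_antisymm ((monotone_cdf ν).leftLim_le le_rfl) (by linarith)

/-- The distribution function of an atomless law maps this law to the uniform law. -/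
theorem map_cdf_eq_uniform : ν.map (cdf ν) = volume.restrict (Set.Icc (0 : ℝ) 1) := by
  have hc : Continuous (cdf ν) := continuous_cdf_of_atomless
  have hp : IsProbabilityMeasure (ν.map (cdf ν)) :=
    Measure.isProbabilityMeasure_map hc.measurable.aemeasurable
  refine Measure.ext_of_Iic _ _ fun t => ?_
  rw [Measure.map_apply hc.measurable measurableSet_Iic, Measure.restrict_apply measurableSet_Iic]
  have hex : ∀ s : ℝ, 0 < s → s < 1 → ∃ y, cdf ν y = s := fun s h0 h1 => by
    have := mem_range_of_exists_le_of_exists_ge hc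
      (((tendsto_cdf_atBot ν).eventually (eventually_lt_nhds h0)).exists.imp fun _ h => h.le)
      (((tendsto_cdf_atTop ν).eventually (eventually_gt_nhds h1)).exists.imp fun _ h => h.le)
    exact this
  rcases lt_or_ge t 0 with ht | ht
  · have h1 : cdf ν ⁻¹' Set.Iic t = ∅ := by
      ext x; simp only [Set.mem_preimage, Set.mem_Iic, Set.mem_empty_iff_false, iff_false, not_le]
      exact ht.trans_le (cdf_nonneg ν x)
    have h2 : Set.Iic t ∩ Set.Icc (0 : ℝ) 1 = ∅ := by
      ext x; simp only [Set.mem_inter_iff, Set.mem_Iic, Set.mem_Icc, Set.mem_empty_iff_false,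
        iff_false]; rintro ⟨h, h', _⟩; linarith
    simp [h1, h2]
  rcases le_or_gt 1 t with ht1 | ht1
  · have h1 : cdf ν ⁻¹' Set.Iic t = Set.univ := by
      ext x; simp only [Set.mem_preimage, Set.mem_Iic, Set.mem_univ, iff_true]
      exact (cdf_le_one ν x).trans ht1
    have h2 : Set.Iic t ∩ Set.Icc (0 : ℝ) 1 = Set.Icc 0 1 := by
      ext x; simp only [Set.mem_inter_iff, Set.mem_Iic, Set.mem_Icc, and_iff_right_iff_imp]
      intro h; exact h.2.trans ht1
    simp [h1, h2]
  have h2 : Set.Iic t ∩ Set.Icc (0 : ℝ) 1 = Set.Icc 0 t := by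
    ext x; simp only [Set.mem_inter_iff, Set.mem_Iic, Set.mem_Icc]
    constructor
    · rintro ⟨h, h', _⟩; exact ⟨h', h⟩
    · rintro ⟨h, h'⟩; exact ⟨h', h, h'.trans ht1.le⟩
  rw [h2, Real.volume_Icc, sub_zero]
  apply le_antisymm
  · refine ENNReal.le_of_forall_pos_le_add fun ε hε _ => ?_
    have hε' : (0 : ℝ) < ε := hε
    obtain ⟨s, hs1, hs2⟩ := exists_between (lt_min ht1 (lt_add_of_pos_right t hε'))
    obtain ⟨y, hy⟩ := hex s (ht.trans_lt hs1) (hs2.trans_le (min_le_left _ _))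
    calc ν (cdf ν ⁻¹' Set.Iic t) ≤ ν (Set.Iic y) := by
          refine measure_mono fun x hx => ?_
          by_contra hxy
          have := monotone_cdf ν (not_le.1 hxy).le
          have hx' : cdf ν x ≤ t := hx
          linarith
      _ = ENNReal.ofReal s := by rw [← ofReal_cdf, hy]
      _ ≤ ENNReal.ofReal (t + ε) :=
          ENNReal.ofReal_le_ofReal (hs2.le.trans (min_le_right _ _))
      _ = ENNReal.ofReal t + ε := by rw [ENNReal.ofReal_add ht hε'.le, ENNReal.ofReal_coe_nnreal]
  · rcases ht.eq_or_lt with rfl | ht0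
    · simp
    obtain ⟨y, hy⟩ := hex t ht0 ht1
    rw [← hy, ofReal_cdf]
    refine measure_mono fun x hx => ?_
    exact monotone_cdf ν hx

theorem integral_comp_cdf {f : ℝ → ℝ} (hf : Measurable f) :
    ∫ y, f (cdf ν y) ∂ν = ∫ t in (0 : ℝ)..1, f t := by
  rw [intervalIntegral.integral_of_le zero_le_one, ← integral_Icc_eq_integral_Ioc,
    ← map_cdf_eq_uniform (ν := ν),
    integral_map continuous_cdf_of_atomless.measurable.aemeasurable hf.aestronglyMeasurable]

/-- The polynomials that arise as powers of the kernels in the uniform variable have degree at most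
six. -/
theorem integral_poly_six (u v c0 c1 c2 c3 c4 c5 c6 : ℝ) :
    ∫ t in u..v, (c0 + c1 * t + c2 * t ^ 2 + c3 * t ^ 3 + c4 * t ^ 4 + c5 * t ^ 5 + c6 * t ^ 6) =
      c0 * (v - u) + c1 * (v ^ 2 - u ^ 2) / 2 + c2 * (v ^ 3 - u ^ 3) / 3 + c3 * (v ^ 4 - u ^ 4) / 4
        + c4 * (v ^ 5 - u ^ 5) / 5 + c5 * (v ^ 6 - u ^ 6) / 6 + c6 * (v ^ 7 - u ^ 7) / 7 := by
  have h : ∀ x ∈ Set.uIcc u v, HasDerivAt (fun t : ℝ => c0 * t + c1 * t ^ 2 / 2 + c2 * t ^ 3 / 3 +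
      c3 * t ^ 4 / 4 + c4 * t ^ 5 / 5 + c5 * t ^ 6 / 6 + c6 * t ^ 7 / 7)
      (c0 + c1 * x + c2 * x ^ 2 + c3 * x ^ 3 + c4 * x ^ 4 + c5 * x ^ 5 + c6 * x ^ 6) x := by
    intro x _
    have hp : ∀ (c : ℝ) (k : ℕ), HasDerivAt (fun t : ℝ => c * t ^ k) (c * (k * x ^ (k - 1))) x :=
      fun c k => (hasDerivAt_pow k x).const_mul c
    convert! ((((((((hasDerivAt_id x).const_mul c0).add ((hp c1 2).div_const 2)).add
      ((hp c2 3).div_const 3)).add ((hp c3 4).div_const 4)).add ((hp c4 5).div_const 5)).add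
      ((hp c5 6).div_const 6)).add ((hp c6 7).div_const 7)) using 1
    push_cast; ring
  rw [intervalIntegral.integral_eq_sub_of_hasDerivAt h
    (Continuous.intervalIntegrable (by fun_prop) _ _)]
  ring

end Transform

/-! ### The kernels of the Hoeffding decomposition -/

/-- The indicator that exactly one of `a`, `b` is at least `c`, that is, that the level `c` is
crossed between `a` and `b`. -/
def crossInd (a b c : ℝ) : ℝ := |(if c ≤ b then 1 else 0) - (if c ≤ a then 1 else 0)|

/-- The probability `|F b - F a|` that a level drawn from `ν` is crossed between `a` and `b`. -/
def gap (ν : Measure ℝ) (a b : ℝ) : ℝ := |cdf ν b - cdf ν a|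

/-- The centred mean of `gap ν a ·`, as a function of `a`: the first-order Hoeffding projection
of `gap ν`. -/
def gapProj (ν : Measure ℝ) (a : ℝ) : ℝ := cdf ν a ^ 2 - cdf ν a + 1 / 6

/-- The second-order Hoeffding component of `gap ν`. -/
def gapRes (ν : Measure ℝ) (a b : ℝ) : ℝ := gap ν a b - 1 / 3 - gapProj ν a - gapProj ν b

/-- What remains of `crossInd` after removal of its projections on `(a, b)` and on `c`. -/
def crossRes (ν : Measure ℝ) (a b c : ℝ) : ℝ := crossInd a b c - gap ν a b + 2 * gapProj ν c

theorem crossInd_eq (a b c : ℝ) : crossInd a b c = (if c ≤ b then 1 else 0) +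
    (if c ≤ a then 1 else 0) - 2 * ((if c ≤ a then 1 else 0) * (if c ≤ b then 1 else 0)) := by
  unfold crossInd; split_ifs <;> norm_num

theorem crossInd_nonneg (a b c : ℝ) : 0 ≤ crossInd a b c := abs_nonneg _

theorem crossInd_le_one (a b c : ℝ) : crossInd a b c ≤ 1 := by
  unfold crossInd; split_ifs <;> norm_num

theorem gap_comm (ν : Measure ℝ) (a b : ℝ) : gap ν a b = gap ν b a := abs_sub_comm _ _

theorem gapRes_comm (ν : Measure ℝ) (a b : ℝ) : gapRes ν a b = gapRes ν b a := by
  unfold gapRes; rw [gap_comm]; ring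

section Kernels

variable {ν : Measure ℝ}

theorem gap_mem (a b : ℝ) : gap ν a b ∈ Set.Icc (0 : ℝ) 1 := by
  refine ⟨abs_nonneg _, abs_le.2 ⟨?_, ?_⟩⟩ <;>
  linarith [cdf_nonneg ν a, cdf_nonneg ν b, cdf_le_one ν a, cdf_le_one ν b]

theorem gapProj_mem (a : ℝ) : gapProj ν a ∈ Set.Icc (-(1 / 12) : ℝ) (1 / 6) := by
  have h0 := cdf_nonneg ν a
  have h1 := cdf_le_one ν a
  unfold gapProj
  constructor <;> nlinarith [sq_nonneg (cdf ν a - 1 / 2)]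

theorem abs_gapProj_le (a : ℝ) : |gapProj ν a| ≤ 1 / 6 := by
  have := gapProj_mem (ν := ν) a
  exact abs_le.2 ⟨by linarith [this.1], this.2⟩

theorem abs_gapRes_le (a b : ℝ) : |gapRes ν a b| ≤ 1 := by
  have h1 := gapProj_mem (ν := ν) a
  have h2 := gapProj_mem (ν := ν) b
  have h3 := gap_mem (ν := ν) a b
  unfold gapRes
  exact abs_le.2 ⟨by linarith [h1.2, h2.2, h3.1], by linarith [h1.1, h2.1, h3.2]⟩

theorem abs_crossRes_le (a b c : ℝ) : |crossRes ν a b c| ≤ 2 := by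
  have h1 := gapProj_mem (ν := ν) c
  have h3 := gap_mem (ν := ν) a b
  have h4 := crossInd_nonneg a b c
  have h5 := crossInd_le_one a b c
  unfold crossRes
  exact abs_le.2 ⟨by linarith [h1.1, h3.2], by linarith [h1.2, h3.1]⟩

@[fun_prop]
theorem measurable_cdf : Measurable (cdf ν) := (monotone_cdf ν).measurable

@[fun_prop]
theorem measurable_gapProj : Measurable (gapProj ν) := by unfold gapProj; fun_prop

theorem measurable_levelInd {α : Type*} [MeasurableSpace α] {f g : α → ℝ} (hf : Measurable f)
    (hg : Measurable g) : Measurable fun x => (if f x ≤ g x then 1 else 0 : ℝ) :=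
  Measurable.ite (measurableSet_le hf hg) measurable_const measurable_const

theorem measurable_crossInd {α : Type*} [MeasurableSpace α] {f g h : α → ℝ} (hf : Measurable f)
    (hg : Measurable g) (hh : Measurable h) : Measurable fun x => crossInd (f x) (g x) (h x) :=
  ((measurable_levelInd hh hg).sub (measurable_levelInd hh hf)).abs

theorem measurable_gap {α : Type*} [MeasurableSpace α] {f g : α → ℝ} (hf : Measurable f)
    (hg : Measurable g) : Measurable fun x => gap ν (f x) (g x) :=
  ((measurable_cdf.comp hg).sub (measurable_cdf.comp hf)).abs

theorem measurable_gapRes {α : Type*} [MeasurableSpace α] {f g : α → ℝ} (hf : Measurable f)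
    (hg : Measurable g) : Measurable fun x => gapRes ν (f x) (g x) :=
  (((measurable_gap hf hg).sub measurable_const).sub (measurable_gapProj.comp hf)).sub
    (measurable_gapProj.comp hg)

theorem measurable_crossRes {α : Type*} [MeasurableSpace α] {f g h : α → ℝ} (hf : Measurable f)
    (hg : Measurable g) (hh : Measurable h) : Measurable fun x => crossRes ν (f x) (g x) (h x) :=
  ((measurable_crossInd hf hg hh).sub (measurable_gap hf hg)).add
    ((measurable_gapProj.comp hh).const_mul 2)

variable [IsProbabilityMeasure ν]

theorem integrable_of_abs_le {α : Type*} [MeasurableSpace α] {μ : Measure α} [IsFiniteMeasure μ]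
    {f : α → ℝ} (hf : Measurable f) (C : ℝ) (h : ∀ x, |f x| ≤ C) : Integrable f μ :=
  Integrable.of_bound hf.aestronglyMeasurable C (ae_of_all _ h)

theorem integrable_levelInd_left (b : ℝ) :
    Integrable (fun c => (if c ≤ b then 1 else 0 : ℝ)) ν :=
  integrable_of_abs_le (measurable_levelInd measurable_id measurable_const) 1
    fun x => by split_ifs <;> simp

theorem integrable_levelInd_right (c : ℝ) :
    Integrable (fun b => (if c ≤ b then 1 else 0 : ℝ)) ν :=
  integrable_of_abs_le (measurable_levelInd measurable_const measurable_id) 1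
    fun x => by split_ifs <;> simp

theorem integrable_gap_right (a : ℝ) : Integrable (fun b => gap ν a b) ν :=
  integrable_of_abs_le (measurable_gap measurable_const measurable_id) 1 fun b => by
    have := gap_mem (ν := ν) a b
    rw [abs_of_nonneg this.1]; exact this.2

theorem integrable_gapProj : Integrable (gapProj ν) ν :=
  integrable_of_abs_le measurable_gapProj _ abs_gapProj_le

theorem integrable_crossInd_third (a b : ℝ) : Integrable (fun c => crossInd a b c) ν :=
  integrable_of_abs_le (measurable_crossInd measurable_const measurable_const measurable_id) 1
    fun c => by rw [abs_of_nonneg (crossInd_nonneg _ _ _)]; exact crossInd_le_one _ _ _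

theorem integral_levelInd_left (b : ℝ) :
    ∫ c, (if c ≤ b then 1 else 0 : ℝ) ∂ν = cdf ν b := by
  rw [cdf_eq_real, ← integral_indicator_one measurableSet_Iic]
  rfl

theorem integral_crossInd_third (a b : ℝ) : ∫ c, crossInd a b c ∂ν = gap ν a b := by
  wlog hab : a ≤ b generalizing a b
  · rw [gap_comm, ← this b a (not_le.1 hab).le]
    exact integral_congr_ae (ae_of_all _ fun c => abs_sub_comm _ _)
  have h : ∀ c, crossInd a b c = (if c ≤ b then 1 else 0) - (if c ≤ a then 1 else 0) := by
    intro c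
    refine abs_of_nonneg ?_
    split_ifs with h1 h2 h2 <;> norm_num
    linarith
  simp only [h]
  rw [integral_sub (integrable_levelInd_left b) (integrable_levelInd_left a),
    integral_levelInd_left, integral_levelInd_left, gap,
    abs_of_nonneg (sub_nonneg.2 (monotone_cdf ν hab))]

variable [NullSingletonClass ν]

theorem integral_levelInd_right (c : ℝ) :
    ∫ b, (if c ≤ b then 1 else 0 : ℝ) ∂ν = 1 - cdf ν c := by
  have h1 : ∫ b, (if c ≤ b then 1 else 0 : ℝ) ∂ν = ν.real (Set.Ici c) := by
    rw [← integral_indicator_one measurableSet_Ici]; rfl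
  have h2 : ν.real (Set.Ici c) = ν.real (Set.Ioi c) := measureReal_congr Ioi_ae_eq_Ici.symm
  rw [h1, h2, cdf_eq_real, ← Set.compl_Iic, probReal_compl_eq_one_sub measurableSet_Iic]

theorem integral_gapProj : ∫ a, gapProj ν a ∂ν = 0 := by
  have h := integral_comp_cdf (ν := ν) (f := fun t => t ^ 2 - t + 1 / 6) (by fun_prop)
  have h2 := integral_poly_six 0 1 (1 / 6) (-1) 1 0 0 0 0
  simp only [gapProj]
  rw [h, show (fun t : ℝ => t ^ 2 - t + 1 / 6) = fun t => 1 / 6 + -1 * t + 1 * t ^ 2 + 0 * t ^ 3 +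
    0 * t ^ 4 + 0 * t ^ 5 + 0 * t ^ 6 by ext t; ring, h2]
  norm_num

theorem integral_gapProj_sq : ∫ a, gapProj ν a ^ 2 ∂ν = 1 / 180 := by
  have h := integral_comp_cdf (ν := ν) (f := fun t => (t ^ 2 - t + 1 / 6) ^ 2) (by fun_prop)
  have h2 := integral_poly_six 0 1 (1 / 36) (-(1 / 3)) (4 / 3) (-2) 1 0 0
  simp only [gapProj]
  rw [h, show (fun t : ℝ => (t ^ 2 - t + 1 / 6) ^ 2) = fun t => 1 / 36 + -(1 / 3) * t +
    4 / 3 * t ^ 2 + -2 * t ^ 3 + 1 * t ^ 4 + 0 * t ^ 5 + 0 * t ^ 6 by ext t; ring, h2]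
  norm_num

theorem integral_gap_right (a : ℝ) : ∫ b, gap ν a b ∂ν = cdf ν a ^ 2 - cdf ν a + 1 / 2 := by
  set x := cdf ν a with hx
  have hx0 : 0 ≤ x := cdf_nonneg ν a
  have hx1 : x ≤ 1 := cdf_le_one ν a
  have h := integral_comp_cdf (ν := ν) (f := fun t => |t - x|) (by fun_prop)
  have e1 : ∫ t in (0 : ℝ)..x, |t - x| = ∫ t in (0 : ℝ)..x, (x + -1 * t + 0 * t ^ 2 + 0 * t ^ 3 +
      0 * t ^ 4 + 0 * t ^ 5 + 0 * t ^ 6) := by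
    refine intervalIntegral.integral_congr fun t ht => ?_
    rw [Set.uIcc_of_le hx0] at ht
    rw [abs_of_nonpos (by linarith [ht.2])]; ring
  have e2 : ∫ t in x..(1 : ℝ), |t - x| = ∫ t in x..(1 : ℝ), (-x + 1 * t + 0 * t ^ 2 + 0 * t ^ 3 +
      0 * t ^ 4 + 0 * t ^ 5 + 0 * t ^ 6) := by
    refine intervalIntegral.integral_congr fun t ht => ?_
    rw [Set.uIcc_of_le hx1] at ht
    rw [abs_of_nonneg (by linarith [ht.1])]; ring
  have hi : ∀ u v : ℝ, IntervalIntegrable (fun t => |t - x|) volume u v := fun u v =>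
    Continuous.intervalIntegrable (by fun_prop) _ _
  simp only [gap, ← hx]
  rw [h, ← intervalIntegral.integral_add_adjacent_intervals (hi 0 x) (hi x 1), e1, e2,
    integral_poly_six, integral_poly_six]
  ring

theorem integral_gapRes_right (a : ℝ) : ∫ b, gapRes ν a b ∂ν = 0 := by
  simp only [gapRes]
  rw [integral_sub _ integrable_gapProj, integral_sub _ (integrable_const _),
    integral_sub (integrable_gap_right a) (integrable_const _), integral_gap_right,
    integral_gapProj]
  · simp [gapProj]; ring
  · exact (integrable_gap_right a).sub (integrable_const _)
  · exact ((integrable_gap_right a).sub (integrable_const _)).sub (integrable_const _)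

theorem integral_gapRes_left (b : ℝ) : ∫ a, gapRes ν a b ∂ν = 0 := by
  rw [← integral_gapRes_right (ν := ν) b]
  exact integral_congr_ae (ae_of_all _ fun a => gapRes_comm _ _ _)

theorem integral_gapRes_sq_right (a : ℝ) : ∫ b, gapRes ν a b ^ 2 ∂ν =
    4 / 45 - 4 / 3 * cdf ν a ^ 2 + 8 / 3 * cdf ν a ^ 3 - 4 / 3 * cdf ν a ^ 4 := by
  set x := cdf ν a with hx
  have hx0 : 0 ≤ x := cdf_nonneg ν a
  have hx1 : x ≤ 1 := cdf_le_one ν a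
  let f : ℝ → ℝ := fun t => (|t - x| - 1 / 3 - (x ^ 2 - x + 1 / 6) - (t ^ 2 - t + 1 / 6)) ^ 2
  have hf : Continuous f := by fun_prop
  have h := integral_comp_cdf (ν := ν) (f := f) hf.measurable
  have e1 : ∫ t in (0 : ℝ)..x, f t = ∫ t in (0 : ℝ)..x, ((2 * x - x ^ 2 - 2 / 3) ^ 2 + 0 * t +
      (-2 * (2 * x - x ^ 2 - 2 / 3)) * t ^ 2 + 0 * t ^ 3 + 1 * t ^ 4 + 0 * t ^ 5 + 0 * t ^ 6) := by
    refine intervalIntegral.integral_congr fun t ht => ?_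
    rw [Set.uIcc_of_le hx0] at ht
    simp only [f]
    rw [abs_of_nonpos (by linarith [ht.2])]; ring
  have e2 : ∫ t in x..(1 : ℝ), f t = ∫ t in x..(1 : ℝ), ((x ^ 2 + 2 / 3) ^ 2 +
      (-4 * (x ^ 2 + 2 / 3)) * t + (4 + 2 * (x ^ 2 + 2 / 3)) * t ^ 2 + -4 * t ^ 3 +
      1 * t ^ 4 + 0 * t ^ 5 + 0 * t ^ 6) := by
    refine intervalIntegral.integral_congr fun t ht => ?_
    rw [Set.uIcc_of_le hx1] at ht
    simp only [f]
    rw [abs_of_nonneg (by linarith [ht.1])]; ring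
  have hi : ∀ u v : ℝ, IntervalIntegrable f volume u v := fun u v => hf.intervalIntegrable _ _
  have h0 : ∫ b, gapRes ν a b ^ 2 ∂ν = ∫ b, f (cdf ν b) ∂ν := rfl
  rw [h0, h, ← intervalIntegral.integral_add_adjacent_intervals (hi 0 x) (hi x 1), e1, e2,
    integral_poly_six, integral_poly_six]
  ring

theorem integral_integral_gapRes_sq : ∫ a, ∫ b, gapRes ν a b ^ 2 ∂ν ∂ν = 2 / 45 := by
  simp only [integral_gapRes_sq_right]
  have h := integral_comp_cdf (ν := ν)
    (f := fun t => 4 / 45 - 4 / 3 * t ^ 2 + 8 / 3 * t ^ 3 - 4 / 3 * t ^ 4) (by fun_prop)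
  rw [h, show (fun t : ℝ => 4 / 45 - 4 / 3 * t ^ 2 + 8 / 3 * t ^ 3 - 4 / 3 * t ^ 4) =
    fun t => 4 / 45 + 0 * t + -(4 / 3) * t ^ 2 + 8 / 3 * t ^ 3 + -(4 / 3) * t ^ 4 + 0 * t ^ 5 +
      0 * t ^ 6 by ext t; ring, integral_poly_six]
  norm_num

theorem integral_crossRes_third (a b : ℝ) : ∫ c, crossRes ν a b c ∂ν = 0 := by
  simp only [crossRes]
  have i1 : Integrable (fun c => crossInd a b c - gap ν a b) ν :=
    (integrable_crossInd_third a b).sub (integrable_const _)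
  have i2 : Integrable (fun c => 2 * gapProj ν c) ν := integrable_gapProj.const_mul 2
  rw [integral_add i1 i2, integral_sub (integrable_crossInd_third a b)
    (integrable_const _), integral_crossInd_third, integral_const_mul, integral_gapProj]
  simp

theorem integral_crossRes_snd (a c : ℝ) : ∫ b, crossRes ν a b c ∂ν = (1 - cdf ν c) +
    (2 * cdf ν c - 1) * (if c ≤ a then 1 else 0) - (gapProj ν a + 1 / 3) + 2 * gapProj ν c := by
  have h : ∀ b, crossRes ν a b c = (1 - 2 * (if c ≤ a then 1 else 0)) * (if c ≤ b then 1 else 0) +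
      (if c ≤ a then 1 else 0) - gap ν a b + 2 * gapProj ν c := fun b => by
    rw [crossRes, crossInd_eq]; ring
  simp only [h]
  have i1 : Integrable (fun b => (1 - 2 * (if c ≤ a then 1 else 0 : ℝ)) *
      (if c ≤ b then 1 else 0)) ν := (integrable_levelInd_right c).const_mul _
  have i2 : Integrable (fun b => (1 - 2 * (if c ≤ a then 1 else 0 : ℝ)) *
      (if c ≤ b then 1 else 0) + (if c ≤ a then 1 else 0)) ν := i1.add (integrable_const _)
  have i3 : Integrable (fun b => (1 - 2 * (if c ≤ a then 1 else 0 : ℝ)) *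
      (if c ≤ b then 1 else 0) + (if c ≤ a then 1 else 0) - gap ν a b) ν :=
    i2.sub (integrable_gap_right a)
  rw [integral_add i3 (integrable_const _), integral_sub i2 (integrable_gap_right a),
    integral_add i1 (integrable_const _), integral_const_mul, integral_levelInd_right,
    integral_gap_right]
  simp only [integral_const, probReal_univ, one_smul, gapProj]
  ring

theorem integral_integral_crossRes (c : ℝ) : ∫ a, ∫ b, crossRes ν a b c ∂ν ∂ν = 0 := by
  simp only [integral_crossRes_snd]
  have i1 : Integrable (fun a => (2 * cdf ν c - 1) * (if c ≤ a then 1 else 0 : ℝ)) ν :=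
    (integrable_levelInd_right c).const_mul _
  have i2 : Integrable (fun a => gapProj ν a + 1 / 3) ν :=
    integrable_gapProj.add (integrable_const _)
  have i3 : Integrable (fun a => 1 - cdf ν c + (2 * cdf ν c - 1) *
      (if c ≤ a then 1 else 0 : ℝ)) ν := (integrable_const _).add i1
  have i4 : Integrable (fun a => 1 - cdf ν c + (2 * cdf ν c - 1) *
      (if c ≤ a then 1 else 0 : ℝ) - (gapProj ν a + 1 / 3)) ν := i3.sub i2
  rw [integral_add i4 (integrable_const _), integral_sub i3 i2,
    integral_add (integrable_const _) i1, integral_const_mul, integral_levelInd_right,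
    integral_add integrable_gapProj (integrable_const _), integral_gapProj]
  simp only [integral_const, probReal_univ, one_smul, gapProj]
  ring

end Kernels

/-! ### Second moments of the Hoeffding components -/

theorem integral_sq_add_sum_of_orthogonal {Ω T : Type*} [MeasurableSpace Ω] {μ : Measure Ω}
    [IsProbabilityMeasure μ] (s : Finset T) (φ : T → Ω → ℝ) (hm : ∀ t, Measurable (φ t))
    (C : ℝ) (hC : ∀ t x, |φ t x| ≤ C) (c : ℝ) (h0 : ∀ t ∈ s, ∫ x, φ t x ∂μ = 0)
    (horth : ∀ t ∈ s, ∀ t' ∈ s, t ≠ t' → ∫ x, φ t x * φ t' x ∂μ = 0) :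
    ∫ x, (c + ∑ t ∈ s, φ t x) ^ 2 ∂μ = c ^ 2 + ∑ t ∈ s, ∫ x, φ t x ^ 2 ∂μ := by
  classical
  have hi : ∀ t, Integrable (φ t) μ := fun t => integrable_of_abs_le (hm t) C (hC t)
  have hij : ∀ t t', Integrable (fun x => φ t x * φ t' x) μ := fun t t' =>
    integrable_of_abs_le ((hm t).mul (hm t')) (C * C) fun x => by
      rw [abs_mul]
      exact mul_le_mul (hC _ _) (hC _ _) (abs_nonneg _) ((abs_nonneg _).trans (hC t x))
  have hexp : ∀ x, (c + ∑ t ∈ s, φ t x) ^ 2 =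
      (c ^ 2 + ∑ t ∈ s, 2 * c * φ t x) + ∑ t ∈ s, ∑ t' ∈ s, φ t x * φ t' x := fun x => by
    rw [← Finset.sum_mul_sum, ← Finset.mul_sum]; ring
  have i1 : Integrable (fun x => ∑ t ∈ s, 2 * c * φ t x) μ :=
    integrable_finsetSum _ fun t _ => (hi t).const_mul _
  have i2 : Integrable (fun x => ∑ t ∈ s, ∑ t' ∈ s, φ t x * φ t' x) μ :=
    integrable_finsetSum _ fun t _ => integrable_finsetSum _ fun t' _ => hij t t'
  have i3 : Integrable (fun x => c ^ 2 + ∑ t ∈ s, 2 * c * φ t x) μ := (integrable_const _).add i1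
  simp only [hexp]
  rw [integral_add i3 i2, integral_add (integrable_const _) i1,
    integral_finsetSum _ fun t _ => (hi t).const_mul _,
    integral_finsetSum _ fun t _ => integrable_finsetSum _ fun t' _ => hij t t']
  have e1 : ∑ t ∈ s, ∫ x, 2 * c * φ t x ∂μ = 0 := Finset.sum_eq_zero fun t ht => by
    rw [integral_const_mul, h0 t ht, mul_zero]
  rw [e1]
  simp only [integral_const, probReal_univ, one_smul, add_zero]
  congr 1
  refine Finset.sum_congr rfl fun t ht => ?_
  rw [integral_finsetSum _ fun t' _ => hij t t', Finset.sum_eq_single t]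
  · exact integral_congr_ae (ae_of_all _ fun x => (sq _).symm)
  · intro t' ht' hne
    exact horth t ht t' ht' hne.symm
  · exact fun h => absurd ht h

theorem integrable_crossRes_mul {ν : Measure ℝ} [IsProbabilityMeasure ν] {ι : Type*} [Fintype ι]
    {a b k : ι} {G : (ι → ℝ) → ℝ} (hGm : Measurable G) {C : ℝ}
    (hGC : ∀ x, |G x| ≤ C) : Integrable (fun x : ι → ℝ => crossRes ν (x a) (x b) (x k) * G x)
      (Measure.pi fun _ : ι => ν) :=
  integrable_of_abs_le ((measurable_crossRes (measurable_pi_apply a) (measurable_pi_apply b)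
    (measurable_pi_apply k)).mul hGm) (2 * C) fun x => by
      rw [abs_mul]
      exact mul_le_mul (abs_crossRes_le _ _ _) (hGC _) (abs_nonneg _) (by norm_num)

section Moments

variable {ν : Measure ℝ} [IsProbabilityMeasure ν] [NullSingletonClass ν]
  {ι : Type*} [Fintype ι] [DecidableEq ι]

theorem integral_gapProj_mul_eq_zero {j : ι} {G : (ι → ℝ) → ℝ} (hGm : Measurable G) {C : ℝ}
    (hGC : ∀ x, |G x| ≤ C) (hG : ∀ x t, G (Function.update x j t) = G x) :
    ∫ x, gapProj ν (x j) * G x ∂(Measure.pi fun _ : ι => ν) = 0 := by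
  refine integral_pi_eq_zero_of_update j (integrable_of_abs_le
    ((measurable_gapProj.comp (measurable_pi_apply j)).mul hGm) (1 / 6 * C) fun x => ?_) fun x => ?_
  · rw [abs_mul]
    exact mul_le_mul (abs_gapProj_le _) (hGC _) (abs_nonneg _) (by norm_num)
  · simp only [Function.update_self, hG]
    rw [integral_mul_const, integral_gapProj, zero_mul]

theorem integral_gapRes_mul_eq_zero {a b j : ι} (hab : a ≠ b) (hj : j = a ∨ j = b)
    {G : (ι → ℝ) → ℝ} (hGm : Measurable G) {C : ℝ}
    (hGC : ∀ x, |G x| ≤ C) (hG : ∀ x t, G (Function.update x j t) = G x) :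
    ∫ x, gapRes ν (x a) (x b) * G x ∂(Measure.pi fun _ : ι => ν) = 0 := by
  refine integral_pi_eq_zero_of_update j (integrable_of_abs_le
    ((measurable_gapRes (measurable_pi_apply a) (measurable_pi_apply b)).mul hGm) (1 * C)
      fun x => ?_) fun x => ?_
  · rw [abs_mul]
    exact mul_le_mul (abs_gapRes_le _ _) (hGC _) (abs_nonneg _) (by norm_num)
  · simp only [hG]
    rw [integral_mul_const]
    rcases hj with rfl | rfl
    · simp only [Function.update_self, Function.update_of_ne hab.symm]
      rw [integral_gapRes_left, zero_mul]
    · simp only [Function.update_self, Function.update_of_ne hab]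
      rw [integral_gapRes_right, zero_mul]

/-- `crossRes` is orthogonal to every bounded function that does not depend on the level `x k`. -/
theorem integral_crossRes_mul_eq_zero_of_third {a b k : ι} (ha : a ≠ k) (hb : b ≠ k)
    {G : (ι → ℝ) → ℝ} (hGm : Measurable G) {C : ℝ}
    (hGC : ∀ x, |G x| ≤ C) (hG : ∀ x t, G (Function.update x k t) = G x) :
    ∫ x, crossRes ν (x a) (x b) (x k) * G x ∂(Measure.pi fun _ : ι => ν) = 0 := by
  refine integral_pi_eq_zero_of_update k (integrable_crossRes_mul hGm hGC) fun x => ?_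
  simp only [Function.update_self, hG, Function.update_of_ne ha, Function.update_of_ne hb]
  rw [integral_mul_const, integral_crossRes_third, zero_mul]

/-- `crossRes` is orthogonal to every bounded function that does not depend on the two ends of
the step. -/
theorem integral_crossRes_mul_eq_zero_of_pair {a b k : ι} (hab : a ≠ b) (ha : k ≠ a) (hb : k ≠ b)
    {G : (ι → ℝ) → ℝ} (hGm : Measurable G) {C : ℝ}
    (hGC : ∀ x, |G x| ≤ C) (hGa : ∀ x t, G (Function.update x a t) = G x)
    (hGb : ∀ x t, G (Function.update x b t) = G x) :
    ∫ x, crossRes ν (x a) (x b) (x k) * G x ∂(Measure.pi fun _ : ι => ν) = 0 := by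
  rw [integral_pi_update b (integrable_crossRes_mul hGm hGC)]
  simp only [Function.update_self, hGb, Function.update_of_ne hab, Function.update_of_ne hb,
    integral_mul_const]
  have hm : Measurable fun x : ι → ℝ => ∫ t, crossRes ν (x a) t (x k) ∂ν := by
    simp only [integral_crossRes_snd]
    have h1 : Measurable fun x : ι → ℝ => cdf ν (x k) :=
      measurable_cdf.comp (measurable_pi_apply k)
    have h2 : Measurable fun x : ι → ℝ => gapProj ν (x k) :=
      measurable_gapProj.comp (measurable_pi_apply k)
    have h3 : Measurable fun x : ι → ℝ => gapProj ν (x a) :=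
      measurable_gapProj.comp (measurable_pi_apply a)
    have h4 : Measurable fun x : ι → ℝ => (if x k ≤ x a then 1 else 0 : ℝ) :=
      measurable_levelInd (measurable_pi_apply k) (measurable_pi_apply a)
    fun_prop
  have hbd : ∀ x : ι → ℝ, |∫ t, crossRes ν (x a) t (x k) ∂ν| ≤ 2 := fun x => by
    have := norm_integral_le_of_norm_le_const (μ := ν)
      (f := fun t => crossRes ν (x a) t (x k)) (C := 2)
      (ae_of_all _ fun t => abs_crossRes_le (x a) t (x k))
    simpa using this
  refine integral_pi_eq_zero_of_update a (integrable_of_abs_le (hm.mul hGm) (2 * C)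
    fun x => ?_) fun x => ?_
  · rw [abs_mul]
    exact mul_le_mul (hbd _) (hGC _) (abs_nonneg _) (by norm_num)
  · simp only [Function.update_self, hGa, Function.update_of_ne ha]
    rw [integral_mul_const, integral_integral_crossRes, zero_mul]

end Moments

/-! ### Paths through the distinct members of a resample -/

/-- `l i → r i`, for `i ∈ I`, are the steps of a path that visits each point of `S` once. -/
structure IsPath {ι κ : Type*} [DecidableEq ι] (I : Finset κ) (l r : κ → ι) (S : Finset ι) :
    Prop where
  left_injOn : Set.InjOn l I
  right_injOn : Set.InjOn r I
  ne : ∀ i ∈ I, l i ≠ r i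
  asymm : ∀ i ∈ I, ∀ i' ∈ I, l i = r i' → r i ≠ l i'
  image_left : ∃ a ∈ S, I.image l = S.erase a
  image_right : ∃ a ∈ S, I.image r = S.erase a

namespace IsPath

variable {ι κ : Type*} [DecidableEq ι] {I : Finset κ} {l r : κ → ι} {S : Finset ι}

theorem card_add_one (h : IsPath I l r S) : I.card + 1 = S.card := by
  obtain ⟨a, ha, hI⟩ := h.image_left
  have := Finset.card_erase_add_one ha
  rwa [← hI, Finset.card_image_of_injOn h.left_injOn] at this

theorem exists_sum_left (h : IsPath I l r S) (f : ι → ℝ) :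
    ∃ a ∈ S, ∑ i ∈ I, f (l i) = ∑ k ∈ S, f k - f a := by
  obtain ⟨a, ha, hI⟩ := h.image_left
  refine ⟨a, ha, ?_⟩
  rw [← Finset.sum_image (f := f) h.left_injOn, hI, ← Finset.sum_erase_add _ _ ha]
  ring

theorem exists_sum_right (h : IsPath I l r S) (f : ι → ℝ) :
    ∃ a ∈ S, ∑ i ∈ I, f (r i) = ∑ k ∈ S, f k - f a := by
  obtain ⟨a, ha, hI⟩ := h.image_right
  refine ⟨a, ha, ?_⟩
  rw [← Finset.sum_image (f := f) h.right_injOn, hI, ← Finset.sum_erase_add _ _ ha]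
  ring

/-- Two different steps of a path do not join the same two points. -/
theorem exists_endpoint_notMem (h : IsPath I l r S) {i i' : κ} (hi : i ∈ I) (hi' : i' ∈ I)
    (hne : i ≠ i') : ∃ j, (j = l i ∨ j = r i) ∧ j ≠ l i' ∧ j ≠ r i' := by
  have h1 : l i ≠ l i' := fun e => hne (h.left_injOn hi hi' e)
  have h2 : r i ≠ r i' := fun e => hne (h.right_injOn hi hi' e)
  by_cases h3 : l i = r i'
  · exact ⟨r i, Or.inr rfl, h.asymm i hi i' hi' h3, h2⟩
  · exact ⟨l i, Or.inl rfl, h1, h3⟩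

end IsPath

theorem sum_ite_eq_le_one {ι κ : Type*} [DecidableEq ι] {I : Finset κ} {f : κ → ι}
    (hf : Set.InjOn f I) (a : ι) : ∑ i ∈ I, (if a = f i then 1 else 0 : ℝ) ≤ 1 := by
  rw [Finset.sum_boole]
  have : (I.filter fun i => a = f i).card ≤ 1 := Finset.card_le_one.2 fun i hi j hj => by
    rw [Finset.mem_filter] at hi hj
    exact hf hi.1 hj.1 (hi.2.symm.trans hj.2)
  exact_mod_cast this

section StepRes

variable {ι : Type*} [DecidableEq ι] {ν : Measure ℝ}

/-- The remainder term of the step from `a` to `b` at the level of `k`; it is put to `0` when `k`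
is an endpoint of the step, where the level and the step are dependent. -/
def stepRes (ν : Measure ℝ) (a b k : ι) (x : ι → ℝ) : ℝ :=
  if k = a ∨ k = b then 0 else crossRes ν (x a) (x b) (x k)

theorem measurable_stepRes (a b k : ι) : Measurable (stepRes ν a b k) := by
  unfold stepRes
  split_ifs
  · exact measurable_const
  · exact measurable_crossRes (measurable_pi_apply a) (measurable_pi_apply b)
      (measurable_pi_apply k)

theorem abs_stepRes_le (a b k : ι) (x : ι → ℝ) : |stepRes ν a b k x| ≤ 2 := by
  unfold stepRes
  split_ifs
  · simp
  · exact abs_crossRes_le _ _ _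

theorem stepRes_update {a b k j : ι} (ha : a ≠ j) (hb : b ≠ j) (hk : k ≠ j)
    (x : ι → ℝ) (t : ℝ) : stepRes ν a b k (Function.update x j t) = stepRes ν a b k x := by
  simp only [stepRes, Function.update_of_ne ha, Function.update_of_ne hb, Function.update_of_ne hk]

end StepRes

section PathMoments

variable {ν : Measure ℝ} [IsProbabilityMeasure ν] [NullSingletonClass ν]
  {ι : Type*} [Fintype ι] [DecidableEq ι] {κ : Type*} {I : Finset κ} {l r : κ → ι} {S : Finset ι}

/-- The exact second moment of the dominating terms of the Hoeffding decomposition of the sum of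
rank increments along a path. -/
theorem integral_sq_hoeffding_main (h : IsPath I l r S) (c β : ℝ) (α : ι → ℝ) :
    ∫ x, (c + ∑ k, α k * gapProj ν (x k) + β * ∑ i ∈ I, gapRes ν (x (l i)) (x (r i))) ^ 2
        ∂(Measure.pi fun _ : ι => ν) =
      c ^ 2 + (1 / 180) * ∑ k, α k ^ 2 + 2 / 45 * β ^ 2 * I.card := by
  let φ : ι ⊕ κ → (ι → ℝ) → ℝ :=
    Sum.elim (fun k x => α k * gapProj ν (x k)) (fun i x => β * gapRes ν (x (l i)) (x (r i)))
  have hmp : ∀ k, Measurable fun x : ι → ℝ => gapProj ν (x k) := fun k =>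
    measurable_gapProj.comp (measurable_pi_apply k)
  have hmr : ∀ a b, Measurable fun x : ι → ℝ => gapRes ν (x a) (x b) := fun a b =>
    measurable_gapRes (measurable_pi_apply a) (measurable_pi_apply b)
  have hm : ∀ t, Measurable (φ t) := by
    rintro (k | i)
    · exact (hmp k).const_mul _
    · exact (hmr _ _).const_mul _
  have hC : ∀ t x, |φ t x| ≤ (∑ k, |α k|) + |β| := by
    rintro (k | i) x
    · have h1 : |α k| ≤ ∑ k, |α k| :=
        Finset.single_le_sum (fun k _ => abs_nonneg (α k)) (Finset.mem_univ k)
      have h2 := abs_gapProj_le (ν := ν) (x k)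
      change |α k * gapProj ν (x k)| ≤ _
      rw [abs_mul]
      nlinarith [abs_nonneg (α k), abs_nonneg β]
    · have h1 : 0 ≤ ∑ k, |α k| := Finset.sum_nonneg fun k _ => abs_nonneg _
      have h2 := abs_gapRes_le (ν := ν) (x (l i)) (x (r i))
      change |β * gapRes ν (x (l i)) (x (r i))| ≤ _
      rw [abs_mul]
      nlinarith [abs_nonneg β]
  have hLR : ∀ k, ∀ i ∈ I,
      ∫ x, gapRes ν (x (l i)) (x (r i)) * gapProj ν (x k) ∂(Measure.pi fun _ : ι => ν) = 0 := by
    intro k i hi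
    have hj : ∃ j, (j = l i ∨ j = r i) ∧ k ≠ j := by
      by_cases hk : k = l i
      · exact ⟨r i, Or.inr rfl, hk ▸ h.ne i hi⟩
      · exact ⟨l i, Or.inl rfl, hk⟩
    obtain ⟨j, hj, hkj⟩ := hj
    exact integral_gapRes_mul_eq_zero (h.ne i hi) hj (hmp k) (fun x => abs_gapProj_le _)
      fun x t => by rw [Function.update_of_ne hkj]
  have key := integral_sq_add_sum_of_orthogonal (μ := Measure.pi fun _ : ι => ν)
    (Finset.univ.disjSum I) φ hm _ hC c ?_ ?_
  · have e1 : ∀ x, c + ∑ t ∈ Finset.univ.disjSum I, φ t x = c + ∑ k, α k * gapProj ν (x k) +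
        β * ∑ i ∈ I, gapRes ν (x (l i)) (x (r i)) := fun x => by
      rw [Finset.sum_disjSum, Finset.mul_sum, add_assoc]; rfl
    simp only [e1] at key
    rw [key, Finset.sum_disjSum, ← add_assoc]
    congr 1
    · congr 1
      rw [Finset.mul_sum]
      refine Finset.sum_congr rfl fun k _ => ?_
      simp only [φ, Sum.elim_inl, mul_pow]
      rw [integral_const_mul, integral_pi_eval k (f := fun t => gapProj ν t ^ 2)
        (measurable_gapProj.pow_const 2).aestronglyMeasurable, integral_gapProj_sq]
      ring
    · have : ∀ i ∈ I, ∫ x, φ (Sum.inr i) x ^ 2 ∂(Measure.pi fun _ : ι => ν) =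
          2 / 45 * β ^ 2 := by
        intro i hi
        simp only [φ, Sum.elim_inr, mul_pow]
        rw [integral_const_mul, integral_pi_eval₂ (h.ne i hi)
          (f := fun a b => gapRes ν a b ^ 2)
          ((measurable_gapRes measurable_fst measurable_snd).pow_const 2) 1
          (fun a b => by
            rw [abs_pow]; exact pow_le_one₀ (abs_nonneg _) (abs_gapRes_le _ _)),
          integral_integral_gapRes_sq]
        ring
      rw [Finset.sum_congr rfl this, Finset.sum_const, nsmul_eq_mul]
      ring
  · rintro (k | i) ht
    · simp only [φ, Sum.elim_inl]
      rw [integral_const_mul, integral_pi_eval k (f := gapProj ν)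
        measurable_gapProj.aestronglyMeasurable, integral_gapProj, mul_zero]
    · have hi : i ∈ I := by simpa using ht
      simp only [φ, Sum.elim_inr]
      have := integral_gapRes_mul_eq_zero (ν := ν) (h.ne i hi) (Or.inl rfl)
        (G := fun _ => 1) measurable_const (C := 1) (fun x => by simp) (fun x t => rfl)
      simp only [mul_one] at this
      rw [integral_const_mul, this, mul_zero]
  · rintro (k | i) ht (k' | i') ht' hne
    · have hkk : k' ≠ k := fun e => hne (by rw [e])
      have := integral_gapProj_mul_eq_zero (ν := ν) (j := k) (hmp k')
        (fun x => abs_gapProj_le _) fun x t => by rw [Function.update_of_ne hkk]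
      simp only [φ, Sum.elim_inl]
      rw [← mul_zero (α k * α k'), ← this, ← integral_const_mul]
      exact integral_congr_ae (ae_of_all _ fun x => by ring)
    · have := hLR k i' (by simpa using ht')
      simp only [φ, Sum.elim_inl, Sum.elim_inr]
      rw [← mul_zero (α k * β), ← this, ← integral_const_mul]
      exact integral_congr_ae (ae_of_all _ fun x => by ring)
    · have := hLR k' i (by simpa using ht)
      simp only [φ, Sum.elim_inl, Sum.elim_inr]
      rw [← mul_zero (β * α k'), ← this, ← integral_const_mul]
      exact integral_congr_ae (ae_of_all _ fun x => by ring)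
    · have hi : i ∈ I := by simpa using ht
      have hi' : i' ∈ I := by simpa using ht'
      obtain ⟨j, hj, hj1, hj2⟩ := h.exists_endpoint_notMem hi hi' fun e => hne (by rw [e])
      have := integral_gapRes_mul_eq_zero (ν := ν) (h.ne i hi) hj (hmr (l i') (r i'))
        (fun x => abs_gapRes_le _ _) fun x t => by
          rw [Function.update_of_ne hj1.symm, Function.update_of_ne hj2.symm]
      simp only [φ, Sum.elim_inr]
      rw [← mul_zero (β * β), ← this, ← integral_const_mul]
      exact integral_congr_ae (ae_of_all _ fun x => by ring)

/-- Remainders of two step-level pairs are orthogonal if the level of the first does not occur in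
the second, or if they share the level and the steps are disjoint. -/
theorem integral_stepRes_mul_eq_zero {a b k a' b' k' : ι} (hab : a ≠ b)
    (h : (k ≠ a' ∧ k ≠ b' ∧ k ≠ k') ∨
      (k = k' ∧ a ≠ a' ∧ a ≠ b' ∧ b ≠ a' ∧ b ≠ b')) :
    ∫ x, stepRes ν a b k x * stepRes ν a' b' k' x ∂(Measure.pi fun _ : ι => ν) = 0 := by
  by_cases hk : k = a ∨ k = b
  · simp [stepRes, hk]
  have hk' := not_or.1 hk
  have e : ∀ x, stepRes ν a b k x = crossRes ν (x a) (x b) (x k) := fun x => if_neg hk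
  simp only [e]
  rcases h with ⟨h1, h2, h3⟩ | ⟨rfl, h1, h2, h3, h4⟩
  · exact integral_crossRes_mul_eq_zero_of_third (Ne.symm hk'.1) (Ne.symm hk'.2)
      (measurable_stepRes _ _ _) (abs_stepRes_le _ _ _)
      (stepRes_update h1.symm h2.symm h3.symm)
  · exact integral_crossRes_mul_eq_zero_of_pair hab hk'.1 hk'.2
      (measurable_stepRes _ _ _) (abs_stepRes_le _ _ _)
      (stepRes_update h1.symm h2.symm hk'.1) (stepRes_update h3.symm h4.symm hk'.2)

/-- The remainders of two step-level pairs are correlated only if they share the level and the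
steps meet, or if each level is an end of the other step. -/
theorem abs_integral_stepRes_mul_le {a b k a' b' k' : ι} (hab : a ≠ b) (hab' : a' ≠ b') :
    |∫ x, stepRes ν a b k x * stepRes ν a' b' k' x ∂(Measure.pi fun _ : ι => ν)| ≤
      4 * ((if k = k' then 1 else 0) * ((if a = a' then 1 else 0) + (if a = b' then 1 else 0) +
        (if b = a' then 1 else 0) + (if b = b' then 1 else 0)) +
        ((if k = a' then 1 else 0) + (if k = b' then 1 else 0)) *
        ((if k' = a then 1 else 0) + (if k' = b then 1 else 0))) := by
  have hb : |∫ x, stepRes ν a b k x * stepRes ν a' b' k' x ∂(Measure.pi fun _ : ι => ν)| ≤ 4 := by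
    have := norm_integral_le_of_norm_le_const (μ := Measure.pi fun _ : ι => ν)
      (f := fun x => stepRes ν a b k x * stepRes ν a' b' k' x) (C := 2 * 2)
      (ae_of_all _ fun x => by
        rw [norm_mul]
        exact mul_le_mul (abs_stepRes_le _ _ _ _) (abs_stepRes_le _ _ _ _) (norm_nonneg _)
          (by norm_num))
    rw [Real.norm_eq_abs] at this
    refine this.trans ?_
    simp; norm_num
  have hz1 : (k ≠ a' ∧ k ≠ b' ∧ k ≠ k') ∨
      (k = k' ∧ a ≠ a' ∧ a ≠ b' ∧ b ≠ a' ∧ b ≠ b') →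
      ∫ x, stepRes ν a b k x * stepRes ν a' b' k' x ∂(Measure.pi fun _ : ι => ν) = 0 :=
    integral_stepRes_mul_eq_zero hab
  have hz2 : (k' ≠ a ∧ k' ≠ b ∧ k' ≠ k) →
      ∫ x, stepRes ν a b k x * stepRes ν a' b' k' x ∂(Measure.pi fun _ : ι => ν) = 0 :=
    fun h => by
      rw [← integral_stepRes_mul_eq_zero (ν := ν) hab' (Or.inl h)]
      exact integral_congr_ae (ae_of_all _ fun x => mul_comm _ _)
  set W : ℝ := ∫ x, stepRes ν a b k x * stepRes ν a' b' k' x ∂(Measure.pi fun _ : ι => ν)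
  have nn : ∀ p : Prop, ∀ [Decidable p], (0 : ℝ) ≤ if p then 1 else 0 := fun p _ => by
    split_ifs <;> norm_num
  by_cases hW : W = 0
  · rw [hW, abs_zero]
    have := nn (a = a'); have := nn (a = b'); have := nn (b = a'); have := nn (b = b')
    have := nn (k = k'); have := nn (k = a'); have := nn (k = b'); have := nn (k' = a)
    have := nn (k' = b)
    positivity
  · refine hb.trans ?_
    have h1 := mt hz1 hW
    have h2 := mt hz2 hW
    push Not at h1 h2
    obtain ⟨h1, h1'⟩ := h1
    suffices (1 : ℝ) ≤ (if k = k' then 1 else 0) * ((if a = a' then 1 else 0) +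
        (if a = b' then 1 else 0) +
        (if b = a' then 1 else 0) + (if b = b' then 1 else 0)) +
        ((if k = a' then 1 else 0) + (if k = b' then 1 else 0)) *
        ((if k' = a then 1 else 0) + (if k' = b then 1 else 0)) by linarith
    have two : ∀ p q : Prop, ∀ [Decidable p] [Decidable q], (p ∨ q) →
        (1 : ℝ) ≤ (if p then 1 else 0) + (if q then 1 else 0) := fun p q _ _ hpq => by
      have := nn p; have := nn q
      rcases hpq with hp | hq
      · rw [if_pos hp]; linarith
      · rw [if_pos hq]; linarith
    by_cases hkk : k = k'
    · rw [if_pos hkk, one_mul]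
      have hpos : (0 : ℝ) ≤ ((if k = a' then 1 else 0) + (if k = b' then 1 else 0)) *
        ((if k' = a then 1 else 0) + (if k' = b then 1 else 0)) :=
        mul_nonneg (add_nonneg (nn _) (nn _)) (add_nonneg (nn _) (nn _))
      have := nn (a = a'); have := nn (a = b'); have := nn (b = a'); have := nn (b = b')
      have h3 := h1' hkk
      by_cases c1 : a = a' ∨ a = b'
      · linarith [two _ _ c1]
      · have c1' := not_or.1 c1
        have c2 : b = a' ∨ b = b' := by
          by_cases c3 : b = a'
          · exact Or.inl c3
          · exact Or.inr (h3 c1'.1 c1'.2 c3)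
        linarith [two _ _ c2]
    · have c1 : k = a' ∨ k = b' := by
        by_contra hc
        have hc' := not_or.1 hc
        exact hkk (h1 hc'.1 hc'.2)
      have c2 : k' = a ∨ k' = b := by
        by_contra hc
        have hc' := not_or.1 hc
        exact hkk (h2 hc'.1 hc'.2).symm
      rw [if_neg hkk, zero_mul, zero_add]
      nlinarith [two _ _ c1, two _ _ c2]

end PathMoments

section PathRemainder

variable {ι : Type*} [DecidableEq ι] {κ : Type*} {I : Finset κ} {l r : κ → ι} {S : Finset ι}

theorem IsPath.sum_overlap_le (h : IsPath I l r S) :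
    ∑ i ∈ I, ∑ i' ∈ I, ((if l i = l i' then 1 else 0) + (if l i = r i' then 1 else 0) +
        (if r i = l i' then 1 else 0) + (if r i = r i' then 1 else 0) : ℝ) ≤ 4 * I.card := by
  have : ∀ i ∈ I, ∑ i' ∈ I, ((if l i = l i' then 1 else 0) + (if l i = r i' then 1 else 0) +
        (if r i = l i' then 1 else 0) + (if r i = r i' then 1 else 0) : ℝ) ≤ 4 := fun i _ => by
    simp only [Finset.sum_add_distrib]
    linarith [sum_ite_eq_le_one h.left_injOn (l i), sum_ite_eq_le_one h.left_injOn (r i),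
      sum_ite_eq_le_one h.right_injOn (l i), sum_ite_eq_le_one h.right_injOn (r i)]
  refine (Finset.sum_le_sum this).trans ?_
  rw [Finset.sum_const, nsmul_eq_mul, mul_comm]

theorem IsPath.sum_weights_le [Fintype ι] (h : IsPath I l r S) {M : ι → ℝ} (hM : ∀ k, 0 ≤ M k) :
    ∑ i ∈ I, (M (l i) + M (r i)) ≤ 2 * ∑ k, M k := by
  have hS : ∑ k ∈ S, M k ≤ ∑ k, M k :=
    Finset.sum_le_sum_of_subset_of_nonneg (Finset.subset_univ _) fun k _ _ => hM k
  obtain ⟨a, -, ha⟩ := h.exists_sum_left M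
  obtain ⟨b, -, hb⟩ := h.exists_sum_right M
  rw [Finset.sum_add_distrib, ha, hb]
  linarith [hM a, hM b]

variable {ν : Measure ℝ} [IsProbabilityMeasure ν] [NullSingletonClass ν] [Fintype ι]

/-- Since few pairs of remainders are correlated, the second moment of their weighted sum is of
lower order than the square of the number of terms. -/
theorem integral_sq_sum_stepRes_le (h : IsPath I l r S) {M : ι → ℝ} (hM : ∀ k, 0 ≤ M k) :
    ∫ x, (∑ i ∈ I, ∑ k, M k * stepRes ν (l i) (r i) k x) ^ 2 ∂(Measure.pi fun _ : ι => ν) ≤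
      16 * (I.card * ∑ k, M k ^ 2 + (∑ k, M k) ^ 2) := by
  have hint : ∀ i k i' k', Integrable (fun x => M k * M k' *
      (stepRes ν (l i) (r i) k x * stepRes ν (l i') (r i') k' x)) (Measure.pi fun _ : ι => ν) :=
    fun i k i' k' => Integrable.const_mul (integrable_of_abs_le
      ((measurable_stepRes _ _ _).mul (measurable_stepRes _ _ _)) (2 * 2) fun x => by
        rw [Pi.mul_apply, abs_mul]
        exact mul_le_mul (abs_stepRes_le _ _ _ _) (abs_stepRes_le _ _ _ _) (abs_nonneg _)
          (by norm_num)) _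
  have hexp : ∀ x, (∑ i ∈ I, ∑ k, M k * stepRes ν (l i) (r i) k x) ^ 2 =
      ∑ i ∈ I, ∑ i' ∈ I, ∑ k, ∑ k', M k * M k' *
        (stepRes ν (l i) (r i) k x * stepRes ν (l i') (r i') k' x) := fun x => by
    rw [sq, Finset.sum_mul_sum]
    refine Finset.sum_congr rfl fun i _ => Finset.sum_congr rfl fun i' _ => ?_
    rw [Finset.sum_mul_sum]
    refine Finset.sum_congr rfl fun k _ => Finset.sum_congr rfl fun k' _ => ?_
    ring
  simp only [hexp]
  rw [integral_finsetSum _ fun i _ => integrable_finsetSum _ fun i' _ => integrable_finsetSum _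
    fun k _ => integrable_finsetSum _ fun k' _ => hint i k i' k']
  have h1 : ∀ i ∈ I, ∫ x, ∑ i' ∈ I, ∑ k, ∑ k', M k * M k' *
        (stepRes ν (l i) (r i) k x * stepRes ν (l i') (r i') k' x) ∂(Measure.pi fun _ : ι => ν) ≤
      ∑ i' ∈ I, ∑ k, ∑ k', M k * M k' *
        (4 * ((if k = k' then 1 else 0) * ((if l i = l i' then 1 else 0) +
          (if l i = r i' then 1 else 0) + (if r i = l i' then 1 else 0) +
          (if r i = r i' then 1 else 0)) +
        ((if k = l i' then 1 else 0) + (if k = r i' then 1 else 0)) *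
        ((if k' = l i then 1 else 0) + (if k' = r i then 1 else 0)))) := by
    intro i hi
    rw [integral_finsetSum _ fun i' _ => integrable_finsetSum _
      fun k _ => integrable_finsetSum _ fun k' _ => hint i k i' k']
    refine Finset.sum_le_sum fun i' hi' => ?_
    rw [integral_finsetSum _ fun k _ => integrable_finsetSum _ fun k' _ => hint i k i' k']
    refine Finset.sum_le_sum fun k _ => ?_
    rw [integral_finsetSum _ fun k' _ => hint i k i' k']
    refine Finset.sum_le_sum fun k' _ => ?_
    rw [integral_const_mul]
    exact mul_le_mul_of_nonneg_left ((le_abs_self _).trans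
      (abs_integral_stepRes_mul_le (h.ne i hi) (h.ne i' hi'))) (mul_nonneg (hM k) (hM k'))
  refine (Finset.sum_le_sum h1).trans ?_
  have e1 : ∀ i i', ∑ k, ∑ k', M k * M k' *
        (4 * ((if k = k' then 1 else 0) * ((if l i = l i' then 1 else 0) +
          (if l i = r i' then 1 else 0) + (if r i = l i' then 1 else 0) +
          (if r i = r i' then 1 else 0)) +
        ((if k = l i' then 1 else 0) + (if k = r i' then 1 else 0)) *
        ((if k' = l i then 1 else 0) + (if k' = r i then 1 else 0)))) =
      4 * (∑ k, M k ^ 2) * ((if l i = l i' then 1 else 0) +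
          (if l i = r i' then 1 else 0) + (if r i = l i' then 1 else 0) +
          (if r i = r i' then 1 else 0)) + 4 * ((M (l i) + M (r i)) * (M (l i') + M (r i'))) := by
    intro i i'
    set w : ℝ := (if l i = l i' then 1 else 0) + (if l i = r i' then 1 else 0) +
      (if r i = l i' then 1 else 0) + (if r i = r i' then 1 else 0)
    have s1 : ∀ k, ∑ k', M k * M k' * (if k = k' then (1 : ℝ) else 0) = M k ^ 2 := fun k => by
      simp [sq]
    have s2 : ∀ a b, ∑ k', M k' * ((if k' = a then (1 : ℝ) else 0) + (if k' = b then 1 else 0)) =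
        M a + M b := fun a b => by
      simp [mul_add, Finset.sum_add_distrib]
    have s3 : ∀ k k', M k * M k' * (4 * ((if k = k' then 1 else 0) * w +
        ((if k = l i' then 1 else 0) + (if k = r i' then 1 else 0)) *
        ((if k' = l i then 1 else 0) + (if k' = r i then 1 else 0)))) =
        4 * w * (M k * M k' * (if k = k' then (1 : ℝ) else 0)) +
        4 * ((M k * ((if k = l i' then 1 else 0) + (if k = r i' then 1 else 0))) *
        (M k' * ((if k' = l i then 1 else 0) + (if k' = r i then 1 else 0)))) := fun k k' => by ring
    simp only [s3, Finset.sum_add_distrib, ← Finset.mul_sum, s1, s2, ← Finset.sum_mul]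
    ring
  simp only [e1, Finset.sum_add_distrib]
  simp only [← Finset.mul_sum, ← Finset.sum_mul]
  have h2 := h.sum_overlap_le
  have h3 := h.sum_weights_le hM
  have h4 : 0 ≤ ∑ i ∈ I, (M (l i) + M (r i)) :=
    Finset.sum_nonneg fun i _ => add_nonneg (hM _) (hM _)
  have h5 : 0 ≤ ∑ k, M k ^ 2 := Finset.sum_nonneg fun k _ => sq_nonneg _
  have h6 : (∑ i ∈ I, (M (l i) + M (r i))) * (∑ i ∈ I, (M (l i) + M (r i))) ≤
      (2 * ∑ k, M k) * (2 * ∑ k, M k) := mul_self_le_mul_self h4 h3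
  have h7 := mul_le_mul_of_nonneg_left h2 h5
  simp only [Finset.sum_add_distrib] at h6 h7 ⊢
  nlinarith [h6, h7]

/-- The sum of the increments of the weighted ranks `∑ k, M k * 1(x k ≤ x a)` along a path is,
up to a bounded multiple of the total weight, the sum of its Hoeffding components. -/
theorem abs_sum_cross_sub_main_le {ν : Measure ℝ} (h : IsPath I l r S) {M : ι → ℝ}
    (hM : ∀ k, 0 ≤ M k) (x : ι → ℝ) :
    |∑ i ∈ I, ∑ k, M k * crossInd (x (l i)) (x (r i)) (x k) -
      ((∑ k, M k) * S.card / 3 +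
        ∑ k, 2 * ((∑ k, M k) * (if k ∈ S then 1 else 0) - S.card * M k) * gapProj ν (x k) +
        (∑ k, M k) * ∑ i ∈ I, gapRes ν (x (l i)) (x (r i))) -
      ∑ i ∈ I, ∑ k, M k * stepRes ν (l i) (r i) k x| ≤ 6 * ∑ k, M k := by
  set N := ∑ k, M k with hN
  have hN0 : 0 ≤ N := Finset.sum_nonneg fun k _ => hM k
  obtain ⟨a, -, ha⟩ := h.exists_sum_left fun k => gapProj ν (x k)
  obtain ⟨b, -, hb⟩ := h.exists_sum_right fun k => gapProj ν (x k)
  have hcard : (S.card : ℝ) = I.card + 1 := by rw [← h.card_add_one]; push_cast; ring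
  -- the levels at the endpoints of a step, left out of `stepRes`
  set E := ∑ i ∈ I, ∑ k, M k * (if k = l i ∨ k = r i then crossRes ν (x (l i)) (x (r i)) (x k)
    else 0) with hE
  have hEle : |E| ≤ 4 * N := by
    have h1 : ∀ i ∈ I, |∑ k, M k * (if k = l i ∨ k = r i then
        crossRes ν (x (l i)) (x (r i)) (x k) else 0)| ≤ 2 * (M (l i) + M (r i)) := fun i _ => by
      refine (Finset.abs_sum_le_sum_abs _ _).trans ?_
      have h2 : ∀ k ∈ (Finset.univ : Finset ι), |M k * (if k = l i ∨ k = r i then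
          crossRes ν (x (l i)) (x (r i)) (x k) else 0)| ≤
          2 * (M k * (if k = l i then 1 else 0) + M k * (if k = r i then 1 else 0)) :=
        fun k _ => by
          have h3 := abs_crossRes_le (ν := ν) (x (l i)) (x (r i)) (x k)
          have h4 := hM k
          rw [abs_mul, abs_of_nonneg h4]
          have h5 : |if k = l i ∨ k = r i then crossRes ν (x (l i)) (x (r i)) (x k) else 0| ≤
              2 * ((if k = l i then 1 else 0) + (if k = r i then 1 else 0)) := by
            split_ifs <;> first | (exfalso; tauto) | (rw [abs_zero]; norm_num) | linarith
          nlinarith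
      refine (Finset.sum_le_sum h2).trans (le_of_eq ?_)
      rw [← Finset.mul_sum, Finset.sum_add_distrib]
      simp
    refine (Finset.abs_sum_le_sum_abs _ _).trans ((Finset.sum_le_sum h1).trans ?_)
    rw [← Finset.mul_sum]
    linarith [h.sum_weights_le hM]
  have hG : |∑ k, M k * gapProj ν (x k)| ≤ N * (1 / 6) := by
    refine (Finset.abs_sum_le_sum_abs _ _).trans ?_
    rw [hN, Finset.sum_mul]
    refine Finset.sum_le_sum fun k _ => ?_
    rw [abs_mul, abs_of_nonneg (hM k)]
    exact mul_le_mul_of_nonneg_left (abs_gapProj_le _) (hM k)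
  set G := ∑ k, M k * gapProj ν (x k) with hGdef
  have d1 : ∀ i k, M k * crossInd (x (l i)) (x (r i)) (x k) = M k * (1 / 3 + gapProj ν (x (l i)) +
      gapProj ν (x (r i)) + gapRes ν (x (l i)) (x (r i))) - 2 * (M k * gapProj ν (x k)) +
      M k * stepRes ν (l i) (r i) k x + M k * (if k = l i ∨ k = r i then
        crossRes ν (x (l i)) (x (r i)) (x k) else 0) := fun i k => by
    have : stepRes ν (l i) (r i) k x + (if k = l i ∨ k = r i then
        crossRes ν (x (l i)) (x (r i)) (x k) else 0) = crossRes ν (x (l i)) (x (r i)) (x k) := by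
      unfold stepRes; split_ifs <;> simp
    rw [add_assoc, ← mul_add, this, crossRes, gapRes]
    ring
  have d2 : ∑ k, 2 * (N * (if k ∈ S then 1 else 0) - S.card * M k) * gapProj ν (x k) =
      2 * N * ∑ k ∈ S, gapProj ν (x k) - 2 * S.card * G := by
    have : ∀ k, 2 * (N * (if k ∈ S then 1 else 0) - S.card * M k) * gapProj ν (x k) =
        2 * N * (if k ∈ S then gapProj ν (x k) else 0) - 2 * S.card * (M k * gapProj ν (x k)) :=
      fun k => by split_ifs <;> ring
    simp only [this, Finset.sum_sub_distrib, ← Finset.mul_sum]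
    congr 2
    simp
  have d3 : ∑ i ∈ I, ∑ k, M k * crossInd (x (l i)) (x (r i)) (x k) =
      N * (I.card / 3 + ∑ i ∈ I, gapProj ν (x (l i)) + ∑ i ∈ I, gapProj ν (x (r i)) +
        ∑ i ∈ I, gapRes ν (x (l i)) (x (r i))) - I.card * (2 * G) +
      ∑ i ∈ I, ∑ k, M k * stepRes ν (l i) (r i) k x + E := by
    simp only [d1, Finset.sum_add_distrib, Finset.sum_sub_distrib, ← Finset.mul_sum,
      ← Finset.sum_mul, Finset.sum_const, nsmul_eq_mul, ← hN, ← hGdef, hE]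
    ring
  rw [d3, d2, ha, hb, hcard]
  have ga := abs_le.1 (abs_gapProj_le (ν := ν) (x a))
  have gb := abs_le.1 (abs_gapProj_le (ν := ν) (x b))
  have hG' := abs_le.1 hG
  have hE' := abs_le.1 hEle
  rw [show N * (I.card / 3 + (∑ k ∈ S, gapProj ν (x k) - gapProj ν (x a)) +
      (∑ k ∈ S, gapProj ν (x k) - gapProj ν (x b)) + ∑ i ∈ I, gapRes ν (x (l i)) (x (r i))) -
      I.card * (2 * G) + ∑ i ∈ I, ∑ k, M k * stepRes ν (l i) (r i) k x + E -
      (N * (I.card + 1) / 3 + (2 * N * ∑ k ∈ S, gapProj ν (x k) - 2 * (I.card + 1) * G) +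
        N * ∑ i ∈ I, gapRes ν (x (l i)) (x (r i))) -
      ∑ i ∈ I, ∑ k, M k * stepRes ν (l i) (r i) k x =
      E + 2 * G - N * (1 / 3 + gapProj ν (x a) + gapProj ν (x b)) by ring]
  rw [abs_le]
  constructor <;> nlinarith [mul_nonneg hN0 (sub_nonneg.2 ga.1), mul_nonneg hN0
    (sub_nonneg.2 ga.2), mul_nonneg hN0 (sub_nonneg.2 gb.1), mul_nonneg hN0 (sub_nonneg.2 gb.2)]

end PathRemainder

/-! ### Deterministic bounds for the rank correlation -/

section Deterministic

variable {n : ℕ}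

/-- The sum of the absolute increments of the ranks of `y` in the order given by `π`. -/
def rankVariation (y : Fin n → ℝ) (π : Equiv.Perm (Fin n)) : ℝ :=
  ∑ i : Fin n, if h : (i : ℕ) + 1 < n then
    |upRank y (π ⟨(i : ℕ) + 1, h⟩) - upRank y (π i)| else 0

/-- The number of ordered pairs of equal entries of a tuple, the pairs `(i, i)` included. -/
def tieCount {α : Type*} [DecidableEq α] (y : Fin n → α) : ℝ :=
  ∑ i, ∑ j, if y i = y j then 1 else 0

theorem chatterjeeXi_eq (y : Fin n → ℝ) (π : Equiv.Perm (Fin n)) : chatterjeeXi y π =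
    1 - (n : ℝ) / (2 * ∑ i : Fin n, downRank y i * ((n : ℝ) - downRank y i)) *
      rankVariation y π := rfl

theorem abs_upRank_sub (y : Fin n → ℝ) (i j : Fin n) :
    |upRank y j - upRank y i| = ∑ m, crossInd (y i) (y j) (y m) := by
  wlog h : y i ≤ y j generalizing i j
  · rw [abs_sub_comm, this j i (not_le.1 h).le]
    exact Finset.sum_congr rfl fun m _ => abs_sub_comm _ _
  have hm : ∀ m, crossInd (y i) (y j) (y m) =
      (if y m ≤ y j then 1 else 0) - (if y m ≤ y i then 1 else 0) := fun m => by
    refine abs_of_nonneg ?_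
    split_ifs with h1 h2 h2 <;> norm_num
    linarith
  have e : upRank y j - upRank y i = ∑ m, crossInd (y i) (y j) (y m) := by
    simp only [hm, Finset.sum_sub_distrib]; rfl
  rw [e, abs_of_nonneg (Finset.sum_nonneg fun m _ => crossInd_nonneg _ _ _)]

theorem sum_shift_le {f : Fin n → ℝ} (hf : ∀ i, 0 ≤ f i) :
    ∑ i : Fin n, (if h : (i : ℕ) + 1 < n then f ⟨(i : ℕ) + 1, h⟩ else 0) ≤ ∑ i, f i := by
  cases n with
  | zero => simp
  | succ n =>
    rw [Fin.sum_univ_castSucc, Fin.sum_univ_succ f]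
    have : ∀ i : Fin n, (if h : ((i.castSucc : Fin (n + 1)) : ℕ) + 1 < n + 1 then
        f ⟨((i.castSucc : Fin (n + 1)) : ℕ) + 1, h⟩ else 0) = f i.succ := fun i => by
      rw [dif_pos (by simp)]; rfl
    simp only [this]
    simp [hf 0]

theorem sum_truncate_le {f : Fin n → ℝ} (hf : ∀ i, 0 ≤ f i) :
    ∑ i : Fin n, (if (i : ℕ) + 1 < n then f i else 0) ≤ ∑ i, f i :=
  Finset.sum_le_sum fun i _ => by split_ifs; exacts [le_rfl, hf i]

/-- A level is crossed at most twice per point above it, and at most twice per point below it. -/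
theorem sum_cross_le (y : Fin n → ℝ) (π : Equiv.Perm (Fin n)) (c : ℝ) :
    (n : ℝ) * ∑ i : Fin n, (if h : (i : ℕ) + 1 < n then
      crossInd (y (π i)) (y (π ⟨(i : ℕ) + 1, h⟩)) c else 0) ≤
      4 * ((∑ j, if c ≤ y j then 1 else 0) * (n - ∑ j, if c ≤ y j then 1 else 0)) := by
  set L : ℝ := ∑ j, if c ≤ y j then 1 else 0 with hL
  have key : ∀ e : Fin n → ℝ, (∀ j, 0 ≤ e j) →
      (∀ i j, crossInd (y i) (y j) c ≤ e i + e j) →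
      ∑ i : Fin n, (if h : (i : ℕ) + 1 < n then
        crossInd (y (π i)) (y (π ⟨(i : ℕ) + 1, h⟩)) c else 0) ≤ 2 * ∑ j, e j := by
    intro e he hc
    have h1 := sum_shift_le (f := fun i => e (π i)) fun i => he _
    have h2 := sum_truncate_le (f := fun i => e (π i)) fun i => he _
    rw [Equiv.sum_comp π e] at h1 h2
    have h3 : ∑ i : Fin n, (if h : (i : ℕ) + 1 < n then
        crossInd (y (π i)) (y (π ⟨(i : ℕ) + 1, h⟩)) c else 0) ≤
        ∑ i : Fin n, (if (i : ℕ) + 1 < n then e (π i) else 0) +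
        ∑ i : Fin n, (if h : (i : ℕ) + 1 < n then e (π ⟨(i : ℕ) + 1, h⟩) else 0) := by
      rw [← Finset.sum_add_distrib]
      refine Finset.sum_le_sum fun i _ => ?_
      split_ifs with h
      · exact hc _ _
      · simp
    linarith
  have k1 := key (fun j => if c ≤ y j then 1 else 0) (fun j => by split_ifs <;> norm_num)
    fun i j => by unfold crossInd; split_ifs <;> norm_num
  have k2 := key (fun j => 1 - if c ≤ y j then 1 else 0) (fun j => by split_ifs <;> norm_num)
    fun i j => by unfold crossInd; split_ifs <;> norm_num
  rw [Finset.sum_sub_distrib, ← hL] at k2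
  simp only [Finset.sum_const, Finset.card_univ, Fintype.card_fin, nsmul_eq_mul, mul_one] at k2
  rw [← hL] at k1
  have hL0 : 0 ≤ L := Finset.sum_nonneg fun j _ => by split_ifs <;> norm_num
  have hLn : L ≤ n := by
    have : L ≤ ∑ j : Fin n, (1 : ℝ) := Finset.sum_le_sum fun j _ => by split_ifs <;> norm_num
    simpa using this
  nlinarith [mul_le_mul_of_nonneg_left k2 hL0, mul_le_mul_of_nonneg_left k1 (sub_nonneg.2 hLn)]

theorem rankVariation_nonneg (y : Fin n → ℝ) (π : Equiv.Perm (Fin n)) : 0 ≤ rankVariation y π :=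
  Finset.sum_nonneg fun i _ => by split_ifs; exacts [abs_nonneg _, le_rfl]

theorem mul_rankVariation_le (y : Fin n → ℝ) (π : Equiv.Perm (Fin n)) :
    (n : ℝ) * rankVariation y π ≤ 4 * ∑ i, downRank y i * ((n : ℝ) - downRank y i) := by
  have h1 : rankVariation y π = ∑ m, ∑ i : Fin n, (if h : (i : ℕ) + 1 < n then
      crossInd (y (π i)) (y (π ⟨(i : ℕ) + 1, h⟩)) (y m) else 0) := by
    rw [Finset.sum_comm]
    refine Finset.sum_congr rfl fun i _ => ?_
    split_ifs with h
    · exact abs_upRank_sub y _ _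
    · simp
  rw [h1, Finset.mul_sum, Finset.mul_sum]
  exact Finset.sum_le_sum fun m _ => sum_cross_le y π (y m)

theorem abs_chatterjeeXi_le_one (y : Fin n → ℝ) (π : Equiv.Perm (Fin n)) :
    |chatterjeeXi y π| ≤ 1 := by
  have h := mul_rankVariation_le y π
  have h0 := rankVariation_nonneg y π
  rw [chatterjeeXi_eq]
  set D := ∑ i, downRank y i * ((n : ℝ) - downRank y i)
  have hn : (0 : ℝ) ≤ n := Nat.cast_nonneg n
  have hD : 0 ≤ D := by nlinarith [mul_nonneg hn h0]
  have h1 : (n : ℝ) / (2 * D) * rankVariation y π ≤ 2 := by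
    rw [div_mul_eq_mul_div]
    exact div_le_of_le_mul₀ (by linarith) (by norm_num) (by linarith)
  have h2 : 0 ≤ (n : ℝ) / (2 * D) * rankVariation y π := by positivity
  exact abs_le.2 ⟨by linarith, by linarith⟩

theorem sum_downRank (y : Fin n → ℝ) :
    2 * ∑ i, downRank y i = (n : ℝ) ^ 2 + tieCount y := by
  have h1 : ∑ i, downRank y i = ∑ i, ∑ j, (if y j ≤ y i then 1 else 0 : ℝ) := by
    rw [Finset.sum_comm]; rfl
  have h2 : 2 * ∑ i, downRank y i =
      ∑ i, ∑ j, ((if y i ≤ y j then 1 else 0) + (if y j ≤ y i then 1 else 0) : ℝ) := by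
    simp only [Finset.sum_add_distrib]
    rw [← h1, two_mul]; rfl
  have h3 : ∀ i j, ((if y i ≤ y j then 1 else 0) + (if y j ≤ y i then 1 else 0) : ℝ) =
      1 + if y i = y j then 1 else 0 := fun i j => by
    rcases lt_trichotomy (y i) (y j) with h | h | h
    · rw [if_pos h.le, if_neg (not_le.2 h), if_neg h.ne]
    · simp [h]
    · rw [if_neg (not_le.2 h), if_pos h.le, if_neg h.ne', add_comm]
  rw [h2]
  simp only [h3, Finset.sum_add_distrib, tieCount]
  simp [sq]

theorem one_le_sum_min_ind (a b c : ℝ) :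
    (1 : ℝ) ≤ (if a ≤ b then 1 else 0) * (if a ≤ c then 1 else 0) +
      (if b ≤ a then 1 else 0) * (if b ≤ c then 1 else 0) +
      (if c ≤ b then 1 else 0) * (if c ≤ a then 1 else 0) := by
  rcases le_total a b with h1 | h1 <;> rcases le_total b c with h2 | h2 <;>
  rcases le_total a c with h3 | h3 <;> simp only [h1, h2, h3, if_true] <;>
  split_ifs <;> first | (exfalso; linarith) | norm_num

/-- A triple has exactly one minimal member unless it has ties. -/
theorem sum_min_ind_le (a b c : ℝ) :
    (if a ≤ b then 1 else 0 : ℝ) * (if a ≤ c then 1 else 0) +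
      (if b ≤ a then 1 else 0) * (if b ≤ c then 1 else 0) +
      (if c ≤ b then 1 else 0) * (if c ≤ a then 1 else 0) ≤
      1 + 2 * ((if a = b then 1 else 0) + (if b = c then 1 else 0) + (if a = c then 1 else 0)) := by
  rcases lt_trichotomy a b with h1 | rfl | h1
  · rcases lt_trichotomy b c with h2 | rfl | h2
    · simp [h1.le, h1.not_ge, h1.ne, h2.le, h2.not_ge, h2.ne, (h1.trans h2).le,
        (h1.trans h2).not_ge, (h1.trans h2).ne]
    · simp [h1.le, h1.not_ge, h1.ne]
    · rcases lt_trichotomy a c with h3 | rfl | h3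
      · simp [h1.le, h1.not_ge, h1.ne, h2.le, h2.not_ge, h2.ne', h3.le, h3.not_ge, h3.ne]
      · simp [h1.le, h1.not_ge, h1.ne, h1.ne']
      · simp [h1.le, h1.not_ge, h1.ne, h2.le, h2.not_ge, h2.ne', h3.le, h3.not_ge, h3.ne']
  · rcases lt_trichotomy a c with h2 | rfl | h2
    · simp [h2.le, h2.not_ge, h2.ne]
    · norm_num
    · simp [h2.le, h2.not_ge, h2.ne']
  · rcases lt_trichotomy b c with h2 | rfl | h2
    · rcases lt_trichotomy a c with h3 | rfl | h3
      · simp [h1.le, h1.not_ge, h1.ne', h2.le, h2.not_ge, h2.ne, h3.le, h3.not_ge, h3.ne]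
      · simp [h1.le, h1.not_ge, h1.ne, h1.ne']
      · simp [h1.le, h1.not_ge, h1.ne', h2.le, h2.not_ge, h2.ne, h3.le, h3.not_ge, h3.ne']
    · simp [h1.le, h1.not_ge, h1.ne']
    · simp [h1.le, h1.not_ge, h1.ne', h2.le, h2.not_ge, h2.ne', (h2.trans h1).le,
        (h2.trans h1).not_ge, (h2.trans h1).ne']

/-- Symmetrized over triples of indices, `3 ∑ Lᵢ ^ 2` counts each triple without ties once. -/
theorem sum_downRank_sq_mem (y : Fin n → ℝ) :
    3 * ∑ i, downRank y i ^ 2 ∈ Set.Icc ((n : ℝ) ^ 3) ((n : ℝ) ^ 3 + 6 * n * tieCount y) := by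
  let e : Fin n → Fin n → ℝ := fun i j => if y i ≤ y j then 1 else 0
  let q : Fin n → Fin n → ℝ := fun i j => if y i = y j then 1 else 0
  have hA : ∑ i, downRank y i ^ 2 = ∑ i, ∑ j, ∑ k, e i j * e i k :=
    Finset.sum_congr rfl fun i _ => by rw [sq, downRank, Finset.sum_mul_sum]
  have hB : ∑ i, downRank y i ^ 2 = ∑ i, ∑ j, ∑ k, e j i * e j k := by
    rw [hA, Finset.sum_comm]
  have hC : ∑ i, downRank y i ^ 2 = ∑ i, ∑ j, ∑ k, e k j * e k i := by
    rw [hB, Finset.sum_congr rfl fun i _ => Finset.sum_comm]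
    exact Finset.sum_congr rfl fun i _ => Finset.sum_congr rfl fun j _ =>
      Finset.sum_congr rfl fun k _ => mul_comm _ _
  have hsum : 3 * ∑ i, downRank y i ^ 2 =
      ∑ i, ∑ j, ∑ k, (e i j * e i k + e j i * e j k + e k j * e k i) := by
    simp only [Finset.sum_add_distrib]
    rw [← hA, ← hB, ← hC]; ring
  -- exactly one member of a triple without ties is its minimum
  have hpt : ∀ i j k, 1 ≤ e i j * e i k + e j i * e j k + e k j * e k i ∧
      e i j * e i k + e j i * e j k + e k j * e k i ≤ 1 + 2 * (q i j + q j k + q i k) := by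
    intro i j k
    exact ⟨one_le_sum_min_ind _ _ _, sum_min_ind_le _ _ _⟩
  have hcard : ∑ _i : Fin n, ∑ _j : Fin n, ∑ _k : Fin n, (1 : ℝ) = (n : ℝ) ^ 3 := by
    simp; ring
  rw [hsum]
  constructor
  · rw [← hcard]
    exact Finset.sum_le_sum fun i _ => Finset.sum_le_sum fun j _ => Finset.sum_le_sum
      fun k _ => (hpt i j k).1
  · have h1 : ∑ i, ∑ j, ∑ k, (e i j * e i k + e j i * e j k + e k j * e k i) ≤
        ∑ i, ∑ j, ∑ k, (1 + 2 * (q i j + q j k + q i k)) :=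
      Finset.sum_le_sum fun i _ => Finset.sum_le_sum fun j _ => Finset.sum_le_sum
        fun k _ => (hpt i j k).2
    refine h1.trans (le_of_eq ?_)
    have q1 : ∑ i, ∑ j, ∑ _k : Fin n, q i j = n * tieCount y := by
      simp only [Finset.sum_const, Finset.card_univ, Fintype.card_fin, nsmul_eq_mul,
        ← Finset.mul_sum]; rfl
    have q2 : ∑ _i : Fin n, ∑ j, ∑ k, q j k = n * tieCount y := by
      simp only [Finset.sum_const, Finset.card_univ, Fintype.card_fin, nsmul_eq_mul]; rfl
    have q3 : ∑ i, ∑ _j : Fin n, ∑ k, q i k = n * tieCount y := by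
      simp only [Finset.sum_const, Finset.card_univ, Fintype.card_fin, nsmul_eq_mul,
        ← Finset.mul_sum]; rfl
    have : ∀ i j k, (1 : ℝ) + 2 * (q i j + q j k + q i k) =
        1 + 2 * q i j + 2 * q j k + 2 * q i k := fun i j k => by ring
    simp only [this, Finset.sum_add_distrib, ← Finset.mul_sum]
    rw [q1, q2, q3, hcard]
    ring

/-- Up to ties, the denominator of the rank correlation is deterministic. -/
theorem abs_chatterjeeXi_sub_le (hn : 0 < n) (y : Fin n → ℝ) (π : Equiv.Perm (Fin n)) :
    |chatterjeeXi y π - (1 - 3 / (n : ℝ) ^ 2 * rankVariation y π)| ≤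
      18 * tieCount y / (n : ℝ) ^ 2 := by
  have hn' : (0 : ℝ) < n := by exact_mod_cast hn
  have hT := mul_rankVariation_le y π
  have hT0 := rankVariation_nonneg y π
  have h1 := sum_downRank y
  have h2 := sum_downRank_sq_mem y
  have hp : 0 ≤ tieCount y := Finset.sum_nonneg fun i _ => Finset.sum_nonneg fun j _ => by
    split_ifs <;> norm_num
  have hD : ∑ i, downRank y i * ((n : ℝ) - downRank y i) =
      n * ∑ i, downRank y i - ∑ i, downRank y i ^ 2 := by
    rw [Finset.mul_sum, ← Finset.sum_sub_distrib]
    exact Finset.sum_congr rfl fun i _ => by ring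
  rw [chatterjeeXi_eq]
  set D := ∑ i, downRank y i * ((n : ℝ) - downRank y i)
  set T := rankVariation y π
  set p := tieCount y
  rcases (show 0 ≤ D by nlinarith [mul_nonneg hn'.le hT0]).eq_or_lt with h0 | h0
  · have : T = 0 := by
      have : n * T ≤ 0 := by rw [← h0] at hT; linarith
      exact le_antisymm (by nlinarith) hT0
    rw [this]
    simp only [mul_zero, sub_zero, sub_self, abs_zero]
    positivity
  · have e : 1 - (n : ℝ) / (2 * D) * T - (1 - 3 / (n : ℝ) ^ 2 * T) =
        (n * T / (2 * D)) * ((6 * D - n ^ 3) / n ^ 3) := by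
      field_simp
      ring
    have h3 : n * T / (2 * D) ≤ 2 := by
      rw [div_le_iff₀ (by positivity)]; linarith
    have h4 : |(6 * D - (n : ℝ) ^ 3) / n ^ 3| ≤ 9 * p / n ^ 2 := by
      rw [abs_div, abs_of_pos (show (0 : ℝ) < (n : ℝ) ^ 3 by positivity),
        div_le_div_iff₀ (by positivity) (by positivity)]
      have h5 : |6 * D - (n : ℝ) ^ 3| ≤ 9 * p * n := by
        have hb := h2.1
        have hc := h2.2
        have : n * (2 * ∑ i, downRank y i) = n * ((n : ℝ) ^ 2 + p) := by rw [h1]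
        have hnp : 0 ≤ n * p := mul_nonneg hn'.le hp
        rw [abs_le]
        constructor <;> nlinarith
      calc |6 * D - (n : ℝ) ^ 3| * n ^ 2 ≤ 9 * p * n * n ^ 2 :=
            mul_le_mul_of_nonneg_right h5 (by positivity)
        _ = _ := by ring
    rw [e, abs_mul, abs_of_nonneg (by positivity)]
    calc n * T / (2 * D) * |(6 * D - (n : ℝ) ^ 3) / n ^ 3| ≤ 2 * (9 * p / n ^ 2) :=
          mul_le_mul h3 h4 (abs_nonneg _) (by norm_num)
      _ = _ := by ring

end Deterministic

/-! ### The path of a resample -/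

section ResamplePath

variable {n : ℕ}

/-- The successor of a position, the last position being its own successor. -/
def nextPos (i : Fin n) : Fin n := if h : (i : ℕ) + 1 < n then ⟨(i : ℕ) + 1, h⟩ else i

/-- The positions of a tuple at which the next entry is different. -/
def jumpPos {α : Type*} [DecidableEq α] (s : Fin n → α) : Finset (Fin n) :=
  Finset.univ.filter fun i => s (nextPos i) ≠ s i

/-- The number of draws that hit the index `k`. -/
def drawCount (J : Fin n → Fin n) (k : Fin n) : ℝ := ∑ m, if J m = k then 1 else 0

theorem le_nextPos (i : Fin n) : i ≤ nextPos i := by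
  unfold nextPos; split_ifs
  · exact Fin.le_def.2 (Nat.le_succ _)
  · exact le_rfl

theorem nextPos_le_of_lt {i j : Fin n} (h : i < j) : nextPos i ≤ j := by
  have h' : (i : ℕ) + 1 < n := lt_of_le_of_lt (Nat.succ_le_of_lt (Fin.lt_def.1 h)) j.2
  rw [nextPos, dif_pos h']
  exact Fin.le_def.2 (Nat.succ_le_of_lt (Fin.lt_def.1 h))

theorem mem_jumpPos {α : Type*} [DecidableEq α] {s : Fin n → α} {i : Fin n} :
    i ∈ jumpPos s ↔ s (nextPos i) ≠ s i := by simp [jumpPos]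

/-- In an order that makes `x` nondecreasing, the repeats of a member of the sample are adjacent, so
the changes of member trace a path through the distinct members. -/
theorem isPath_jumpPos (hn : 0 < n) {x : Fin n → ℝ} (hx : Function.Injective x)
    {s : Fin n → Fin n} (hs : Monotone fun i => x (s i)) :
    IsPath (jumpPos s) s (fun i => s (nextPos i)) (Finset.univ.image s) := by
  have hlt : ∀ i ∈ jumpPos s, x (s i) < x (s (nextPos i)) := fun i hi =>
    lt_of_le_of_ne (hs (le_nextPos i)) fun e => mem_jumpPos.1 hi (hx e).symm
  -- the left end of an earlier jump lies strictly below the left end of a later one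
  have hL : ∀ i ∈ jumpPos s, ∀ j, i < j → x (s i) < x (s j) := fun i hi j hij =>
    (hlt i hi).trans_le (hs (nextPos_le_of_lt hij))
  have hR : ∀ i, ∀ j ∈ jumpPos s, i < j → x (s (nextPos i)) < x (s (nextPos j)) :=
    fun i j hj hij => (hs (nextPos_le_of_lt hij)).trans_lt (hlt j hj)
  refine ⟨?_, ?_, ?_, ?_, ?_, ?_⟩
  · intro i hi j hj e
    rcases lt_trichotomy i j with h | h | h
    · exact absurd (congrArg x e) (hL i hi j h).ne
    · exact h
    · exact absurd (congrArg x e) (hL j hj i h).ne'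
  · intro i hi j hj e
    rcases lt_trichotomy i j with h | h | h
    · exact absurd (congrArg x e) (hR i j hj h).ne
    · exact h
    · exact absurd (congrArg x e) (hR j i hi h).ne'
  · intro i hi e
    exact mem_jumpPos.1 hi e.symm
  · intro i hi i' hi' e e'
    have h1 := hlt i hi
    have h2 := hlt i' hi'
    have e1 := congrArg x e
    have e2 := congrArg x e'
    beta_reduce at e1 e2
    linarith
  · let last : Fin n := ⟨n - 1, Nat.sub_lt hn one_pos⟩
    have hlast : ∀ i : Fin n, i ≤ last := fun i => Fin.le_def.2 (Nat.le_sub_one_of_lt i.2)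
    refine ⟨s last, Finset.mem_image_of_mem s (Finset.mem_univ _), ?_⟩
    ext k
    simp only [Finset.mem_image, Finset.mem_erase, Finset.mem_univ, true_and]
    constructor
    · rintro ⟨i, hi, rfl⟩
      refine ⟨fun e => ?_, i, rfl⟩
      have h1 := hlt i hi
      have h2 := hs (hlast (nextPos i))
      have e1 := congrArg x e
      simp only at h2
      linarith
    · rintro ⟨hk, i, hi⟩
      -- the last position with entry `k`
      have hne : (Finset.univ.filter fun i => s i = k).Nonempty := ⟨i, by simp [hi]⟩
      obtain ⟨m, hm, hmax⟩ := Finset.exists_max_image _ id hne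
      simp only [Finset.mem_filter, Finset.mem_univ, true_and, id] at hm hmax
      have hml : m < last := lt_of_le_of_ne (hlast m) fun e => hk (by rw [← e, hm])
      refine ⟨m, mem_jumpPos.2 fun e => ?_, hm⟩
      have h1 : nextPos m ≤ m := hmax _ (e.trans hm)
      have h2 : (m : ℕ) + 1 < n := lt_of_le_of_lt (Nat.succ_le_of_lt (Fin.lt_def.1 hml)) last.2
      rw [nextPos, dif_pos h2, Fin.le_def] at h1
      simp at h1
  · let first : Fin n := ⟨0, hn⟩
    have hfirst : ∀ i : Fin n, first ≤ i := fun i => Fin.le_def.2 (Nat.zero_le _)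
    refine ⟨s first, Finset.mem_image_of_mem s (Finset.mem_univ _), ?_⟩
    ext k
    simp only [Finset.mem_image, Finset.mem_erase, Finset.mem_univ, true_and]
    constructor
    · rintro ⟨i, hi, rfl⟩
      refine ⟨fun e => ?_, nextPos i, rfl⟩
      have h1 := hlt i hi
      have h2 := hs (hfirst i)
      have e1 := congrArg x e
      simp only at h2
      linarith
    · rintro ⟨hk, i, hi⟩
      -- the first position with entry `k`
      have hne : (Finset.univ.filter fun i => s i = k).Nonempty := ⟨i, by simp [hi]⟩
      obtain ⟨m, hm, hmin⟩ := Finset.exists_min_image _ id hne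
      simp only [Finset.mem_filter, Finset.mem_univ, true_and, id] at hm hmin
      have hm0 : (m : ℕ) ≠ 0 := fun e => hk (by rw [← hm]; congr 1; exact Fin.ext e)
      have hlt' : (m : ℕ) - 1 < n := lt_of_le_of_lt (Nat.sub_le _ _) m.2
      let p : Fin n := ⟨(m : ℕ) - 1, hlt'⟩
      have hp : nextPos p = m := by
        have : (p : ℕ) + 1 = m := Nat.succ_pred_eq_of_pos (Nat.pos_of_ne_zero hm0)
        rw [nextPos, dif_pos (by rw [this]; exact m.2)]
        exact Fin.ext this
      refine ⟨p, mem_jumpPos.2 fun e => ?_, by rw [hp, hm]⟩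
      rw [hp] at e
      have h1 : m ≤ p := hmin _ (e.symm.trans hm)
      rw [Fin.le_def] at h1
      change (m : ℕ) ≤ m - 1 at h1
      omega

theorem sum_comp_eq_sum_drawCount (J : Fin n → Fin n) (f : Fin n → ℝ) :
    ∑ m, f (J m) = ∑ k, drawCount J k * f k := by
  simp only [drawCount, Finset.sum_mul]
  rw [Finset.sum_comm]
  refine Finset.sum_congr rfl fun m _ => ?_
  simp

/-- Only the changes of member contribute to the sum of the rank increments of a resample. -/
theorem rankVariation_comp (J : Fin n → Fin n) (u : Fin n → ℝ) (τ : Equiv.Perm (Fin n)) :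
    rankVariation (fun m => u (J m)) τ = ∑ i ∈ jumpPos (fun i => J (τ i)),
      ∑ k, drawCount J k * crossInd (u (J (τ i))) (u (J (τ (nextPos i)))) (u k) := by
  have h : ∀ i : Fin n, (if h : (i : ℕ) + 1 < n then
      |upRank (fun m => u (J m)) (τ ⟨(i : ℕ) + 1, h⟩) -
      upRank (fun m => u (J m)) (τ i)| else 0) = ∑ k, drawCount J k *
        crossInd (u (J (τ i))) (u (J (τ (nextPos i)))) (u k) := fun i => by
    rw [← sum_comp_eq_sum_drawCount J
      fun k => crossInd (u (J (τ i))) (u (J (τ (nextPos i)))) (u k)]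
    unfold nextPos
    split_ifs with hi
    · exact abs_upRank_sub (fun m => u (J m)) _ _
    · simp [crossInd]
  rw [rankVariation, Finset.sum_congr rfl fun i _ => h i]
  refine (Finset.sum_subset (Finset.subset_univ _) fun i _ hi => ?_).symm
  have e : J (τ (nextPos i)) = J (τ i) := by
    by_contra hne
    exact hi (mem_jumpPos.2 hne)
  simp [crossInd, e]

theorem drawCount_nonneg (J : Fin n → Fin n) (k : Fin n) : 0 ≤ drawCount J k :=
  Finset.sum_nonneg fun m _ => by split_ifs <;> norm_num

theorem sum_drawCount (J : Fin n → Fin n) : ∑ k, drawCount J k = n := by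
  have := sum_comp_eq_sum_drawCount J fun _ => 1
  simp only [mul_one] at this
  rw [← this]; simp

theorem sum_drawCount_sq (J : Fin n → Fin n) : ∑ k, drawCount J k ^ 2 = tieCount J := by
  have := sum_comp_eq_sum_drawCount J fun k => drawCount J k
  simp only [sq, ← this]
  simp only [drawCount, tieCount]
  exact Finset.sum_comm

theorem drawCount_eq_zero {J : Fin n → Fin n} {k : Fin n} (h : k ∉ Finset.univ.image J) :
    drawCount J k = 0 :=
  Finset.sum_eq_zero fun m _ => if_neg fun e : J m = k =>
    h (e ▸ Finset.mem_image_of_mem J (Finset.mem_univ m))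

theorem tieCount_comp_of_injective {u : Fin n → ℝ} (hu : Function.Injective u)
    (J : Fin n → Fin n) : tieCount (fun m => u (J m)) = tieCount J := by
  simp [tieCount, hu.eq_iff]

theorem natCast_le_tieCount {α : Type*} [DecidableEq α] (J : Fin n → α) :
    (n : ℝ) ≤ tieCount J := by
  have : ∑ _i : Fin n, (1 : ℝ) ≤ tieCount J := Finset.sum_le_sum fun i _ => by
    have := Finset.single_le_sum (f := fun j => if J i = J j then (1 : ℝ) else 0)
      (fun j _ => by split_ifs <;> norm_num) (Finset.mem_univ i)
    simpa using this
  simpa using this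

/-- With distinct first coordinates, the rank correlation of a resample does not depend on the
way in which ties among the repeated members are ordered. -/
theorem chatterjeeXi_congr_arrangement {x : Fin n → ℝ} (hx : Function.Injective x)
    {J : Fin n → Fin n} {τ τ' : Equiv.Perm (Fin n)} (h : IsArrangement (fun j => x (J j)) τ)
    (h' : IsArrangement (fun j => x (J j)) τ') (u : Fin n → ℝ) :
    chatterjeeXi (fun j => u (J j)) τ = chatterjeeXi (fun j => u (J j)) τ' := by
  have e : (fun j => x (J j)) ∘ τ = (fun j => x (J j)) ∘ τ' :=
    Tuple.unique_monotone h h'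
  have e' : ∀ i, J (τ i) = J (τ' i) := fun i => hx (congrFun e i)
  have hr : ∀ i j, J i = J j → upRank (fun j => u (J j)) i = upRank (fun j => u (J j)) j :=
    fun i j hij => by simp [upRank, hij]
  have : rankVariation (fun j => u (J j)) τ = rankVariation (fun j => u (J j)) τ' :=
    Finset.sum_congr rfl fun i _ => by
      split_ifs
      · rw [hr _ _ (e' i), hr _ _ (e' _)]
      · rfl
  rw [chatterjeeXi_eq, chatterjeeXi_eq, this]

end ResamplePath

/-! ### The mean square of the rank correlation for a given resampling scheme -/

theorem sq_add_le_of_pos {δ : ℝ} (hδ : 0 < δ) (a b : ℝ) :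
    (a + b) ^ 2 ≤ (1 + δ) * a ^ 2 + (1 + 1 / δ) * b ^ 2 := by
  have h : (1 + δ) * a ^ 2 + (1 + 1 / δ) * b ^ 2 - (a + b) ^ 2 = (δ * a - b) ^ 2 / δ := by
    field_simp; ring
  have : 0 ≤ (δ * a - b) ^ 2 / δ := by positivity
  linarith

section MeanSquare

variable {n : ℕ}

/-- The number of distinct indices that are drawn. -/
def distinctCount (J : Fin n → Fin n) : ℝ := (Finset.univ.image J).card

/-- The leading term of `E (ξ - c) ^ 2`, for the rank correlation `ξ` of the resample with indices
`J` of a sample with independent coordinates. -/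
def mainError (J : Fin n → Fin n) (c : ℝ) : ℝ :=
  (distinctCount J / n - (1 - c)) ^ 2 +
    1 / 5 * (distinctCount J ^ 2 * tieCount J / n ^ 4 - distinctCount J / n ^ 2) +
    2 / 5 * (distinctCount J / n ^ 2)

theorem distinctCount_le (J : Fin n → Fin n) : distinctCount J ≤ n := by
  have := Finset.card_image_le (s := (Finset.univ : Finset (Fin n))) (f := J)
  rw [Finset.card_univ, Fintype.card_fin] at this
  unfold distinctCount
  exact_mod_cast this

/-- The squared coefficients of the first-order Hoeffding projections of the rank variation. -/
theorem sum_coefficient_sq (J : Fin n → Fin n) :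
    ∑ k, ((n : ℝ) * (if k ∈ Finset.univ.image J then 1 else 0) -
      distinctCount J * drawCount J k) ^ 2 =
      distinctCount J ^ 2 * tieCount J - n ^ 2 * distinctCount J := by
  have h : ∀ k, ((n : ℝ) * (if k ∈ Finset.univ.image J then 1 else 0) -
      distinctCount J * drawCount J k) ^ 2 =
      n ^ 2 * (if k ∈ Finset.univ.image J then 1 else 0) - 2 * n * distinctCount J * drawCount J k +
      distinctCount J ^ 2 * drawCount J k ^ 2 := fun k => by
    split_ifs with hk
    · ring
    · rw [drawCount_eq_zero hk]; ring
  simp only [h, Finset.sum_add_distrib, Finset.sum_sub_distrib, ← Finset.mul_sum,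
    sum_drawCount, sum_drawCount_sq]
  rw [Finset.sum_ite_mem, Finset.univ_inter, Finset.sum_const, nsmul_eq_mul, mul_one]
  rw [distinctCount]; ring

variable {ν : Measure ℝ} [IsProbabilityMeasure ν] [NullSingletonClass ν]

/-- The mean square of the rank correlation of a resample, for fixed first coordinates and fixed
indices of the draws. The main term is the second moment of the Hoeffding components; the `δ` splits
off the remainders and the effect of ties on the denominator, each of the order of
`tieCount J / n ^ 2`. -/
theorem integral_sq_chatterjeeXi_sub_le (hn : 0 < n) {x : Fin n → ℝ} (hx : Function.Injective x)
    (J : Fin n → Fin n) {τ : Equiv.Perm (Fin n)} (hτ : IsArrangement (fun j => x (J j)) τ)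
    (c : ℝ) {δ : ℝ} (hδ : 0 < δ) :
    ∫ u, (chatterjeeXi (fun j => u (J j)) τ - c) ^ 2 ∂(Measure.pi fun _ : Fin n => ν) ≤
      (1 + δ) * mainError J c + (1 + 1 / δ) * (3168 * tieCount J ^ 2 / n ^ 4) := by
  have hn' : (0 : ℝ) < n := by exact_mod_cast hn
  set s : Fin n → Fin n := fun i => J (τ i) with hs
  have himg : Finset.univ.image s = Finset.univ.image J := by
    ext k
    simp only [Finset.mem_image, Finset.mem_univ, true_and, hs]
    exact ⟨fun ⟨i, hi⟩ => ⟨τ i, hi⟩, fun ⟨i, hi⟩ => ⟨τ.symm i, by simpa using hi⟩⟩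
  have hpath : IsPath (jumpPos s) s (fun i => s (nextPos i)) (Finset.univ.image J) := by
    rw [← himg]; exact isPath_jumpPos hn hx hτ
  set S := Finset.univ.image J with hS
  set K := distinctCount J with hK
  have hKS : (S.card : ℝ) = K := rfl
  set p := tieCount J with hp
  have hKn : K ≤ n := distinctCount_le J
  have hnp : (n : ℝ) ≤ p := natCast_le_tieCount J
  have hI : ((jumpPos s).card : ℝ) = K - 1 := by
    rw [← hKS, ← hpath.card_add_one]; push_cast; ring
  set R : (Fin n → ℝ) → ℝ := fun u =>
    ∑ i ∈ jumpPos s, ∑ k, drawCount J k * stepRes ν (s i) (s (nextPos i)) k u with hR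
  set A : (Fin n → ℝ) → ℝ := fun u => ((1 - c) - K / n) + ∑ k, (-(6 / (n : ℝ) ^ 2) *
      (n * (if k ∈ S then 1 else 0) - K * drawCount J k)) * gapProj ν (u k) +
      (-(3 / (n : ℝ))) * ∑ i ∈ jumpPos s, gapRes ν (u (s i)) (u (s (nextPos i))) with hA
  have hA2 : ∫ u, A u ^ 2 ∂(Measure.pi fun _ : Fin n => ν) ≤ mainError J c := by
    rw [hA, integral_sq_hoeffding_main hpath]
    simp only [mul_pow, ← Finset.mul_sum]
    rw [sum_coefficient_sq, hI, mainError]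
    have : 0 ≤ 2 / 5 * (1 / (n : ℝ) ^ 2) := by positivity
    have e : (1 - c - K / n) ^ 2 + 1 / 180 * ((-(6 / (n : ℝ) ^ 2)) ^ 2 *
        (distinctCount J ^ 2 * tieCount J - n ^ 2 * distinctCount J)) +
        2 / 45 * (-(3 / (n : ℝ))) ^ 2 * (K - 1) =
        (distinctCount J / n - (1 - c)) ^ 2 +
        1 / 5 * (distinctCount J ^ 2 * tieCount J / n ^ 4 - distinctCount J / n ^ 2) +
        2 / 5 * (distinctCount J / n ^ 2) - 2 / 5 * (1 / (n : ℝ) ^ 2) := by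
      rw [← hK]; field_simp; ring
    linarith
  have hR2 : ∫ u, R u ^ 2 ∂(Measure.pi fun _ : Fin n => ν) ≤ 32 * p ^ 2 := by
    refine (integral_sq_sum_stepRes_le hpath (drawCount_nonneg J)).trans ?_
    rw [sum_drawCount_sq, sum_drawCount, hI, ← hp]
    have h1 : (K - 1) * p ≤ p * p := mul_le_mul_of_nonneg_right (by linarith) (by linarith)
    have h2 : (n : ℝ) ^ 2 ≤ p ^ 2 := pow_le_pow_left₀ hn'.le hnp 2
    nlinarith
  have hRm : Measurable R := Finset.measurable_fun_sum _ fun i _ =>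
    Finset.measurable_fun_sum _ fun k _ => (measurable_stepRes _ _ _).const_mul _
  have hRb : ∀ u, |R u| ≤ ∑ _i ∈ jumpPos s, ∑ k, drawCount J k * 2 := fun u => by
    refine (Finset.abs_sum_le_sum_abs _ _).trans (Finset.sum_le_sum fun i _ => ?_)
    refine (Finset.abs_sum_le_sum_abs _ _).trans (Finset.sum_le_sum fun k _ => ?_)
    rw [abs_mul, abs_of_nonneg (drawCount_nonneg J k)]
    exact mul_le_mul_of_nonneg_left (abs_stepRes_le _ _ _ _) (drawCount_nonneg J k)
  have hRi : Integrable (fun u => R u ^ 2) (Measure.pi fun _ : Fin n => ν) :=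
    integrable_of_abs_le (hRm.pow_const 2) _ fun u => by
      rw [abs_pow]; exact pow_le_pow_left₀ (abs_nonneg _) (hRb u) 2
  have hAm : Measurable A := by
    have h1 : ∀ k : Fin n, Measurable fun u : Fin n → ℝ => gapProj ν (u k) := fun k =>
      measurable_gapProj.comp (measurable_pi_apply k)
    have h2 : ∀ a b : Fin n, Measurable fun u : Fin n → ℝ => gapRes ν (u a) (u b) := fun a b =>
      measurable_gapRes (measurable_pi_apply a) (measurable_pi_apply b)
    exact (measurable_const.add (Finset.measurable_fun_sum _ fun k _ => (h1 k).const_mul _)).add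
      ((Finset.measurable_fun_sum _ fun i _ => h2 _ _).const_mul _)
  have hAb : ∀ u, |A u| ≤ |(1 - c) - K / n| + (∑ k, |-(6 / (n : ℝ) ^ 2) *
      (n * (if k ∈ S then 1 else 0) - K * drawCount J k)| * (1 / 6)) +
      |(-(3 / (n : ℝ)))| * ∑ _i ∈ jumpPos s, 1 := fun u => by
    refine (abs_add_le _ _).trans (add_le_add ((abs_add_le _ _).trans (add_le_add le_rfl ?_)) ?_)
    · refine (Finset.abs_sum_le_sum_abs _ _).trans (Finset.sum_le_sum fun k _ => ?_)
      rw [abs_mul]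
      exact mul_le_mul_of_nonneg_left (abs_gapProj_le _) (abs_nonneg _)
    · rw [abs_mul]
      refine mul_le_mul_of_nonneg_left ?_ (abs_nonneg _)
      exact (Finset.abs_sum_le_sum_abs _ _).trans (Finset.sum_le_sum fun i _ => abs_gapRes_le _ _)
  have hAi : Integrable (fun u => A u ^ 2) (Measure.pi fun _ : Fin n => ν) :=
    integrable_of_abs_le (hAm.pow_const 2) _ fun u => by
      rw [abs_pow]; exact pow_le_pow_left₀ (abs_nonneg _) (hAb u) 2
  have hpt : ∀ᵐ u ∂(Measure.pi fun _ : Fin n => ν), (chatterjeeXi (fun j => u (J j)) τ - c) ^ 2 ≤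
      (1 + δ) * A u ^ 2 + (1 + 1 / δ) * (2592 * p ^ 2 / n ^ 4 + 18 / n ^ 4 * R u ^ 2) := by
    filter_upwards [ae_pi_injective_of_atomless (ν := ν)] with u hu
    set ξ := chatterjeeXi (fun j => u (J j)) τ
    have h1 := abs_chatterjeeXi_sub_le hn (fun j => u (J j)) τ
    rw [tieCount_comp_of_injective hu, ← hp, rankVariation_comp] at h1
    have h2 := abs_sum_cross_sub_main_le (ν := ν) hpath (drawCount_nonneg J) u
    rw [sum_drawCount] at h2
    change |ξ - (1 - 3 / (n : ℝ) ^ 2 * ∑ i ∈ jumpPos s, ∑ k, drawCount J k *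
      crossInd (u (s i)) (u (s (nextPos i))) (u k))| ≤ _ at h1
    set T := ∑ i ∈ jumpPos s, ∑ k, drawCount J k * crossInd (u (s i)) (u (s (nextPos i))) (u k)
    change |T - _ - R u| ≤ _ at h2
    have hAu : A u = (1 - c) - 3 / (n : ℝ) ^ 2 * ((n : ℝ) * S.card / 3 +
        ∑ k, 2 * ((n : ℝ) * (if k ∈ S then 1 else 0) - S.card * drawCount J k) * gapProj ν (u k) +
        (n : ℝ) * ∑ i ∈ jumpPos s, gapRes ν (u (s i)) (u (s (nextPos i)))) := by
      have e : ∑ k, (-(6 / (n : ℝ) ^ 2) * (n * (if k ∈ S then 1 else 0) - K * drawCount J k)) *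
          gapProj ν (u k) = -(3 / (n : ℝ) ^ 2) * ∑ k, 2 * ((n : ℝ) * (if k ∈ S then 1 else 0) -
          S.card * drawCount J k) * gapProj ν (u k) := by
        rw [Finset.mul_sum, hKS]
        exact Finset.sum_congr rfl fun k _ => by ring
      simp only [hA]
      rw [e, hKS]
      field_simp
      ring
    set Q := (n : ℝ) * S.card / 3 +
        ∑ k, 2 * ((n : ℝ) * (if k ∈ S then 1 else 0) - S.card * drawCount J k) * gapProj ν (u k) +
        (n : ℝ) * ∑ i ∈ jumpPos s, gapRes ν (u (s i)) (u (s (nextPos i)))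
    -- `36 = 18 + 3 * 6` adds the errors of the denominator and of the Hoeffding decomposition
    have hB : |ξ - c - A u| ≤ 36 * p / n ^ 2 + 3 / n ^ 2 * |R u| := by
      have e : ξ - c - A u = (ξ - (1 - 3 / (n : ℝ) ^ 2 * T)) - 3 / (n : ℝ) ^ 2 * (T - Q - R u) -
          3 / (n : ℝ) ^ 2 * R u := by rw [hAu]; ring
      have hpos : (0 : ℝ) ≤ 3 / (n : ℝ) ^ 2 := by positivity
      rw [e]
      have a1 := abs_sub (ξ - (1 - 3 / (n : ℝ) ^ 2 * T) - 3 / (n : ℝ) ^ 2 * (T - Q - R u))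
        (3 / (n : ℝ) ^ 2 * R u)
      have a2 := abs_sub (ξ - (1 - 3 / (n : ℝ) ^ 2 * T)) (3 / (n : ℝ) ^ 2 * (T - Q - R u))
      rw [abs_mul, abs_of_nonneg hpos] at a1 a2
      have a3 : 3 / (n : ℝ) ^ 2 * |T - Q - R u| ≤ 18 * p / n ^ 2 := by
        calc 3 / (n : ℝ) ^ 2 * |T - Q - R u| ≤ 3 / (n : ℝ) ^ 2 * (6 * p) :=
              mul_le_mul_of_nonneg_left (by linarith) hpos
          _ = _ := by ring
      have a4 : 36 * p / (n : ℝ) ^ 2 = 18 * p / n ^ 2 + 18 * p / n ^ 2 := by ring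
      linarith
    have hB2 : (ξ - c - A u) ^ 2 ≤ 2592 * p ^ 2 / n ^ 4 + 18 / n ^ 4 * R u ^ 2 := by
      calc (ξ - c - A u) ^ 2 = |ξ - c - A u| ^ 2 := (sq_abs _).symm
        _ ≤ (36 * p / n ^ 2 + 3 / n ^ 2 * |R u|) ^ 2 := pow_le_pow_left₀ (abs_nonneg _) hB 2
        _ ≤ 2 * (36 * p / n ^ 2) ^ 2 + 2 * (3 / n ^ 2 * |R u|) ^ 2 := by
            nlinarith [sq_nonneg (36 * p / n ^ 2 - 3 / n ^ 2 * |R u|)]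
        _ = _ := by rw [mul_pow _ |R u|, sq_abs]; field_simp; ring
    have := sq_add_le_of_pos hδ (A u) (ξ - c - A u)
    rw [add_sub_cancel] at this
    refine this.trans (add_le_add le_rfl (mul_le_mul_of_nonneg_left hB2 (by positivity)))
  have i1 : Integrable (fun u => (1 + δ) * A u ^ 2) (Measure.pi fun _ : Fin n => ν) :=
    hAi.const_mul _
  have i2 : Integrable (fun u => 2592 * p ^ 2 / n ^ 4 + 18 / n ^ 4 * R u ^ 2)
      (Measure.pi fun _ : Fin n => ν) := (integrable_const _).add (hRi.const_mul _)
  have i3 : Integrable (fun u => (1 + 1 / δ) * (2592 * p ^ 2 / n ^ 4 + 18 / n ^ 4 * R u ^ 2))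
      (Measure.pi fun _ : Fin n => ν) := i2.const_mul _
  refine (integral_mono_of_nonneg (ae_of_all _ fun u => sq_nonneg _) (i1.add i3) hpt).trans ?_
  simp only [Pi.add_apply]
  rw [integral_add i1 i3, integral_const_mul, integral_const_mul,
    integral_add (integrable_const _) (hRi.const_mul _), integral_const_mul]
  simp only [integral_const, probReal_univ, one_smul]
  refine add_le_add (mul_le_mul_of_nonneg_left hA2 (by positivity))
    (mul_le_mul_of_nonneg_left ?_ (by positivity))
  calc 2592 * p ^ 2 / n ^ 4 + 18 / (n : ℝ) ^ 4 * ∫ u, R u ^ 2 ∂(Measure.pi fun _ : Fin n => ν) ≤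
        2592 * p ^ 2 / n ^ 4 + 18 / (n : ℝ) ^ 4 * (32 * p ^ 2) := by gcongr
    _ = _ := by ring

end MeanSquare

/-! ### Moments of the resampling scheme -/

section Resampling

variable {n : ℕ} {ρ : Measure (Fin n)} [IsProbabilityMeasure ρ]

theorem integral_uniform (hρ : ∀ k, ρ.real {k} = (n : ℝ)⁻¹) (f : Fin n → ℝ) :
    ∫ k, f k ∂ρ = (∑ k, f k) / n := by
  rw [integral_fintype .of_finite]
  simp only [hρ, smul_eq_mul, ← Finset.mul_sum]
  rw [mul_comm, div_eq_mul_inv]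

/-- The centred indicator of a coincidence of two draws. -/
def coincidence (a b : Fin n) : ℝ := (if a = b then 1 else 0) - (n : ℝ)⁻¹

theorem coincidence_comm (a b : Fin n) : coincidence a b = coincidence b a := by
  simp only [coincidence, eq_comm]

theorem integral_coincidence_right (hn : 0 < n) (hρ : ∀ k, ρ.real {k} = (n : ℝ)⁻¹) (a : Fin n) :
    ∫ b, coincidence a b ∂ρ = 0 := by
  have hn' : (n : ℝ) ≠ 0 := by exact_mod_cast hn.ne'
  rw [integral_uniform hρ]
  simp [coincidence, hn']

theorem integral_coincidence_sq_right (hn : 0 < n) (hρ : ∀ k, ρ.real {k} = (n : ℝ)⁻¹)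
    (a : Fin n) : ∫ b, coincidence a b ^ 2 ∂ρ ≤ (n : ℝ)⁻¹ := by
  have hn' : (n : ℝ) ≠ 0 := by exact_mod_cast hn.ne'
  rw [integral_uniform hρ]
  have : ∀ b, coincidence a b ^ 2 = (1 - 2 * (n : ℝ)⁻¹) * (if a = b then 1 else 0) +
      (n : ℝ)⁻¹ ^ 2 := fun b => by unfold coincidence; split_ifs <;> ring
  simp only [this, Finset.sum_add_distrib, ← Finset.mul_sum]
  simp only [Finset.sum_ite_eq, Finset.mem_univ, if_true, mul_one, Finset.sum_const,
    Finset.card_univ, Fintype.card_fin, nsmul_eq_mul]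
  have e : (1 - 2 * (n : ℝ)⁻¹ + n * (n : ℝ)⁻¹ ^ 2) / n = (n : ℝ)⁻¹ - ((n : ℝ)⁻¹) ^ 2 := by
    field_simp; ring
  rw [e]
  linarith [sq_nonneg ((n : ℝ)⁻¹)]

theorem integral_coincidence (hn : 0 < n) (hρ : ∀ k, ρ.real {k} = (n : ℝ)⁻¹) {i j : Fin n}
    (hij : i ≠ j) :
    ∫ J : Fin n → Fin n, coincidence (J i) (J j) ∂(Measure.pi fun _ : Fin n => ρ) = 0 := by
  refine integral_pi_eq_zero_of_update j .of_finite fun J => ?_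
  simp only [Function.update_self, Function.update_of_ne hij]
  exact integral_coincidence_right hn hρ _

theorem integral_coincidence_mul_eq_zero (hn : 0 < n) (hρ : ∀ k, ρ.real {k} = (n : ℝ)⁻¹)
    {i j i' j' : Fin n} (hij : i ≠ j) (hi : j ≠ i') (hj : j ≠ j') :
    ∫ J : Fin n → Fin n, coincidence (J i) (J j) * coincidence (J i') (J j')
      ∂(Measure.pi fun _ : Fin n => ρ) = 0 := by
  refine integral_pi_eq_zero_of_update j .of_finite fun J => ?_
  simp only [Function.update_self, Function.update_of_ne hij, Function.update_of_ne hi.symm,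
    Function.update_of_ne hj.symm]
  rw [integral_mul_const, integral_coincidence_right hn hρ, zero_mul]

theorem integral_coincidence_sq_le (hn : 0 < n) (hρ : ∀ k, ρ.real {k} = (n : ℝ)⁻¹) {i j : Fin n}
    (hij : i ≠ j) : ∫ J : Fin n → Fin n, coincidence (J i) (J j) ^ 2
      ∂(Measure.pi fun _ : Fin n => ρ) ≤ (n : ℝ)⁻¹ := by
  rw [integral_pi_update j .of_finite]
  simp only [Function.update_self, Function.update_of_ne hij]
  refine (integral_mono .of_finite .of_finite fun J : Fin n → Fin n =>
    integral_coincidence_sq_right hn hρ (J i)).trans ?_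
  simp

/-- The coincidences of two draws are pairwise uncorrelated, so that this sum has a variance of
order `n` only. -/
theorem tieCount_sub_eq (hn : 0 < n) (J : Fin n → Fin n) :
    tieCount J - (2 * n - 1) = ∑ q ∈ (Finset.univ : Finset (Fin n)).offDiag,
      coincidence (J q.1) (J q.2) := by
  have hn' : (n : ℝ) ≠ 0 := by exact_mod_cast hn.ne'
  have h1 : ∑ q : Fin n × Fin n, coincidence (J q.1) (J q.2) = tieCount J - n := by
    rw [Fintype.sum_prod_type]
    simp only [coincidence, Finset.sum_sub_distrib, tieCount]
    simp [hn']
  have h2 : ∑ q ∈ (Finset.univ : Finset (Fin n)).diag, coincidence (J q.1) (J q.2) = n - 1 := by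
    rw [Finset.sum_diag]
    simp [coincidence, hn']
  have h3 := Finset.sum_union (Finset.disjoint_diag_offDiag (Finset.univ : Finset (Fin n)))
    (f := fun q : Fin n × Fin n => coincidence (J q.1) (J q.2))
  rw [Finset.diag_union_offDiag, Finset.univ_product_univ, h1, h2] at h3
  linarith

theorem integral_sq_tieCount_sub_le (hn : 0 < n) (hρ : ∀ k, ρ.real {k} = (n : ℝ)⁻¹) :
    ∫ J : Fin n → Fin n, (tieCount J - (2 * (n : ℝ) - 1)) ^ 2
      ∂(Measure.pi fun _ : Fin n => ρ) ≤ 2 * (n : ℝ) := by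
  have hn' : (0 : ℝ) < n := by exact_mod_cast hn
  set O := (Finset.univ : Finset (Fin n)).offDiag with hO
  simp only [tieCount_sub_eq hn, sq, Finset.sum_mul_sum]
  rw [integral_finsetSum _ fun _ _ => .of_finite]
  have h1 : ∀ q ∈ O, ∀ q' ∈ O, ∫ J : Fin n → Fin n,
      coincidence (J q.1) (J q.2) * coincidence (J q'.1) (J q'.2)
      ∂(Measure.pi fun _ : Fin n => ρ) ≤
      (if q' = q then (n : ℝ)⁻¹ else 0) + (if q' = q.swap then (n : ℝ)⁻¹ else 0) := by
    rintro ⟨i, j⟩ hq ⟨i', j'⟩ hq'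
    have hij : i ≠ j := (Finset.mem_offDiag.1 hq).2.2
    have hij' : i' ≠ j' := (Finset.mem_offDiag.1 hq').2.2
    have hsq := integral_coincidence_sq_le hn hρ hij
    have hinv : (0 : ℝ) ≤ (n : ℝ)⁻¹ := by positivity
    simp only
    by_cases c1 : j ≠ i' ∧ j ≠ j'
    · rw [integral_coincidence_mul_eq_zero hn hρ hij c1.1 c1.2]
      split_ifs <;> linarith
    by_cases c2 : i ≠ i' ∧ i ≠ j'
    · have e : ∀ J : Fin n → Fin n, coincidence (J i) (J j) * coincidence (J i') (J j') =
          coincidence (J j) (J i) * coincidence (J i') (J j') := fun J => by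
        rw [coincidence_comm (J i)]
      simp only [e]
      rw [integral_coincidence_mul_eq_zero hn hρ hij.symm c2.1 c2.2]
      split_ifs <;> linarith
    rw [not_and_or, not_ne_iff, not_ne_iff] at c1 c2
    have h4 : (i' = i ∧ j' = j) ∨ (i' = j ∧ j' = i) := by
      rcases c1 with c1 | c1 <;> rcases c2 with c2 | c2
      · exact absurd (c2.trans c1.symm) hij
      · exact Or.inr ⟨c1.symm, c2.symm⟩
      · exact Or.inl ⟨c2.symm, c1.symm⟩
      · exact absurd (c2.trans c1.symm) hij
    rcases h4 with ⟨rfl, rfl⟩ | ⟨rfl, rfl⟩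
    · simp only [← sq]
      rw [if_pos trivial]
      have : (0 : ℝ) ≤ if ((i', j') : Fin n × Fin n) = Prod.swap (i', j') then (n : ℝ)⁻¹
          else 0 := by
        split_ifs <;> linarith
      linarith
    · have e : ∀ J : Fin n → Fin n, coincidence (J j') (J i') * coincidence (J i') (J j') =
          coincidence (J j') (J i') ^ 2 := fun J => by rw [coincidence_comm (J i'), sq]
      simp only [e]
      rw [if_pos (show ((i', j') : Fin n × Fin n) = Prod.swap (j', i') from rfl)]
      have : (0 : ℝ) ≤ if ((i', j') : Fin n × Fin n) = (j', i') then (n : ℝ)⁻¹ else 0 := by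
        split_ifs <;> linarith
      linarith
  have h2 : ∀ q ∈ O, ∫ J : Fin n → Fin n,
      ∑ q' ∈ O, coincidence (J q.1) (J q.2) * coincidence (J q'.1) (J q'.2)
      ∂(Measure.pi fun _ : Fin n => ρ) ≤ 2 * (n : ℝ)⁻¹ := fun q hq => by
    rw [integral_finsetSum _ fun _ _ => .of_finite]
    refine (Finset.sum_le_sum fun q' hq' => h1 q hq q' hq').trans ?_
    rw [Finset.sum_add_distrib, Finset.sum_ite_eq', Finset.sum_ite_eq', if_pos hq, two_mul]
    have : (0 : ℝ) ≤ (n : ℝ)⁻¹ := by positivity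
    split_ifs <;> linarith
  refine (Finset.sum_le_sum h2).trans ?_
  rw [Finset.sum_const, nsmul_eq_mul, hO, Finset.offDiag_card, Finset.card_univ, Fintype.card_fin,
    Nat.cast_sub (Nat.le_mul_self n)]
  push_cast
  have : ((n : ℝ) * n - n) * (2 * (n : ℝ)⁻¹) = 2 * n - 2 := by field_simp
  rw [this]; linarith

theorem integral_tieCount (hn : 0 < n) (hρ : ∀ k, ρ.real {k} = (n : ℝ)⁻¹) :
    ∫ J : Fin n → Fin n, tieCount J ∂(Measure.pi fun _ : Fin n => ρ) = 2 * n - 1 := by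
  have h : ∀ J : Fin n → Fin n, tieCount J = (2 * n - 1) +
      ∑ q ∈ (Finset.univ : Finset (Fin n)).offDiag, coincidence (J q.1) (J q.2) := fun J => by
    rw [← tieCount_sub_eq hn]; ring
  simp only [h]
  rw [integral_add .of_finite .of_finite, integral_finsetSum _ fun _ _ => .of_finite,
    Finset.sum_eq_zero fun q hq => integral_coincidence hn hρ (Finset.mem_offDiag.1 hq).2.2]
  simp

/-- The indicator that the index `k` is never drawn. -/
def missed (J : Fin n → Fin n) (k : Fin n) : ℝ := ∏ m, if J m = k then (0 : ℝ) else 1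

theorem missed_eq (J : Fin n → Fin n) (k : Fin n) :
    missed J k = 1 - if k ∈ Finset.univ.image J then 1 else 0 := by
  unfold missed
  split_ifs with h
  · obtain ⟨m, -, hm⟩ := Finset.mem_image.1 h
    have h0 : (if J m = k then (0 : ℝ) else 1) = 0 := if_pos hm
    rw [Finset.prod_eq_zero (Finset.mem_univ m) h0]; ring
  · have h1 : ∀ m ∈ Finset.univ, (if J m = k then (0 : ℝ) else 1) = 1 := fun m _ =>
      if_neg fun e => h (Finset.mem_image.2 ⟨m, Finset.mem_univ m, e⟩)
    rw [Finset.prod_eq_one h1]; ring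

theorem distinctCount_eq (J : Fin n → Fin n) : distinctCount J = n - ∑ k, missed J k := by
  simp only [missed_eq, Finset.sum_sub_distrib, distinctCount]
  rw [Finset.sum_ite_mem]
  simp

theorem integral_missed (hn : 0 < n) (hρ : ∀ k, ρ.real {k} = (n : ℝ)⁻¹) (k : Fin n) :
    ∫ J : Fin n → Fin n, missed J k ∂(Measure.pi fun _ : Fin n => ρ) = (1 - 1 / (n : ℝ)) ^ n := by
  have hn' : (n : ℝ) ≠ 0 := by exact_mod_cast hn.ne'
  have h := integral_fintype_prod_eq_prod (𝕜 := ℝ) (μ := fun _ : Fin n => ρ)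
    (f := fun (_ : Fin n) (a : Fin n) => if a = k then (0 : ℝ) else 1)
  unfold missed
  rw [h]
  have e : ∀ a : Fin n, (if a = k then 0 else 1 : ℝ) = 1 - if a = k then 1 else 0 := fun a => by
    split_ifs <;> ring
  simp only [integral_uniform hρ, e, Finset.sum_sub_distrib]
  simp [hn', sub_div]

theorem integral_missed_mul (hn : 0 < n) (hρ : ∀ k, ρ.real {k} = (n : ℝ)⁻¹) {k k' : Fin n}
    (hk : k ≠ k') : ∫ J : Fin n → Fin n, missed J k * missed J k' ∂(Measure.pi fun _ : Fin n => ρ) =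
      (1 - 2 / (n : ℝ)) ^ n := by
  have hn' : (n : ℝ) ≠ 0 := by exact_mod_cast hn.ne'
  have h := integral_fintype_prod_eq_prod (𝕜 := ℝ) (μ := fun _ : Fin n => ρ)
    (f := fun (_ : Fin n) (a : Fin n) =>
      (if a = k then 0 else 1 : ℝ) * (if a = k' then 0 else 1 : ℝ))
  simp only [missed, ← Finset.prod_mul_distrib]
  rw [h]
  have e : ∀ a : Fin n, (if a = k then 0 else 1 : ℝ) * (if a = k' then 0 else 1 : ℝ) =
      1 - (if a = k then 1 else 0) - (if a = k' then 1 else 0) := fun a => by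
    by_cases h1 : a = k
    · simp [h1, hk]
    · by_cases h2 : a = k' <;> simp [h1, h2, hk.symm]
  simp only [integral_uniform hρ, e, Finset.sum_sub_distrib]
  simp only [Finset.sum_const, Finset.card_univ, Fintype.card_fin, nsmul_eq_mul, mul_one,
    Finset.sum_ite_eq', Finset.mem_univ, if_true, Finset.prod_const]
  congr 1
  field_simp
  ring

theorem integral_distinctCount (hn : 0 < n) (hρ : ∀ k, ρ.real {k} = (n : ℝ)⁻¹) :
    ∫ J : Fin n → Fin n, distinctCount J ∂(Measure.pi fun _ : Fin n => ρ) =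
      n * (1 - (1 - 1 / (n : ℝ)) ^ n) := by
  simp only [distinctCount_eq]
  rw [integral_sub .of_finite .of_finite, integral_finsetSum _ fun _ _ => .of_finite]
  simp only [integral_missed hn hρ]
  simp
  ring

theorem integral_sq_distinctCount_sub (hn : 0 < n) (hρ : ∀ k, ρ.real {k} = (n : ℝ)⁻¹) :
    ∫ J : Fin n → Fin n, (distinctCount J - n * (1 - (1 - 1 / (n : ℝ)) ^ n)) ^ 2
      ∂(Measure.pi fun _ : Fin n => ρ) = n * ((1 - 1 / (n : ℝ)) ^ n +
        (n - 1) * (1 - 2 / (n : ℝ)) ^ n - n * ((1 - 1 / (n : ℝ)) ^ n) ^ 2) := by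
  set a := (1 - 1 / (n : ℝ)) ^ n with ha
  have h : ∀ J : Fin n → Fin n, (distinctCount J - n * (1 - a)) ^ 2 =
      (n * a) ^ 2 - 2 * n * a * (∑ k, missed J k) + ∑ k, ∑ k', missed J k * missed J k' :=
    fun J => by rw [distinctCount_eq, ← Finset.sum_mul_sum]; ring
  have hk : ∀ k : Fin n, ∑ k', ∫ J : Fin n → Fin n, missed J k * missed J k'
      ∂(Measure.pi fun _ : Fin n => ρ) = a + (n - 1) * (1 - 2 / (n : ℝ)) ^ n := fun k => by
    rw [← Finset.add_sum_erase _ _ (Finset.mem_univ k),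
      Finset.sum_congr rfl fun k' hk' =>
        integral_missed_mul hn hρ (Finset.ne_of_mem_erase hk').symm]
    have : ∀ J : Fin n → Fin n, missed J k * missed J k = missed J k := fun J => by
      rw [missed_eq]; split_ifs <;> ring
    simp only [this, integral_missed hn hρ]
    rw [Finset.sum_const, Finset.card_erase_of_mem (Finset.mem_univ k), Finset.card_univ,
      Fintype.card_fin, nsmul_eq_mul, Nat.cast_sub hn]
    simp [ha]
  simp only [h]
  rw [integral_add .of_finite .of_finite, integral_sub .of_finite .of_finite, integral_const_mul,
    integral_finsetSum _ fun _ _ => .of_finite, integral_finsetSum _ fun _ _ => .of_finite]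
  have hk2 : ∀ k : Fin n, ∫ J : Fin n → Fin n, ∑ k', missed J k * missed J k'
      ∂(Measure.pi fun _ : Fin n => ρ) = a + (n - 1) * (1 - 2 / (n : ℝ)) ^ n := fun k => by
    rw [integral_finsetSum _ fun _ _ => .of_finite, hk]
  simp only [hk2, integral_missed hn hρ, ← ha]
  simp only [integral_const, probReal_univ, one_smul, Finset.sum_const, Finset.card_univ,
    Fintype.card_fin, nsmul_eq_mul]
  ring

end Resampling

/-! ### The averaged mean square and its limit -/

/-- The probability that a given member of a sample of size `n` is not drawn. -/
def missProb (n : ℕ) : ℝ := (1 - 1 / (n : ℝ)) ^ n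

/-- The limit of `meanSquareBound`, thus an asymptotic upper bound for `n` times the variance of the
bootstrapped rank correlation. -/
def limitVariance : ℝ := 3 / 5 - 8 / (5 * Real.exp 1 ^ 2)

/-- An upper bound for `n` times the average over the resampling scheme of `mainError`. -/
def mainBound (n : ℕ) : ℝ :=
  (missProb n - 2 * (1 - 2 / (n : ℝ)) ^ n) + 1 / 5 * (3 / 2 / Real.sqrt n + 2 *
    ((missProb n - 2 * (1 - 2 / (n : ℝ)) ^ n) / n + (1 - missProb n) ^ 2) - (1 - missProb n)) +
    2 / 5 * (1 - missProb n)

/-- An upper bound for `n` times the mean square of the bootstrapped rank correlation about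
`missProb n`. -/
def meanSquareBound (n : ℕ) : ℝ :=
  (1 + 1 / Real.sqrt n) * mainBound n + (1 + Real.sqrt n) * (19008 / n)

/-- The left side is the variance of the number of missed indices divided by `n`; its terms of order
`n` cancel. -/
theorem variance_missed_le {n : ℕ} (hn : 2 ≤ n) :
    missProb n + (n - 1) * (1 - 2 / (n : ℝ)) ^ n - n * missProb n ^ 2 ≤
      missProb n - 2 * (1 - 2 / (n : ℝ)) ^ n := by
  have hn' : (2 : ℝ) ≤ n := by exact_mod_cast hn
  have hpos : (0 : ℝ) < n := by linarith
  set t : ℝ := 1 - 2 / n with ht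
  have ht1 : t ≤ 1 := by rw [ht]; linarith [show 0 ≤ 2 / (n : ℝ) by positivity]
  have ht0 : 0 ≤ t := by
    rw [ht, sub_nonneg, div_le_one hpos]; exact hn'
  have hd : (0 : ℝ) ≤ 1 / (n : ℝ) ^ 2 := by positivity
  have hsq : missProb n ^ 2 = (t + 1 / (n : ℝ) ^ 2) ^ n := by
    rw [missProb, ← pow_mul, mul_comm n 2, pow_mul]
    congr 1
    rw [ht]; ring
  -- Bernoulli's inequality
  have h1 : t ^ n * (1 + n * (1 / (n : ℝ) ^ 2)) ≤ missProb n ^ 2 := by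
    calc t ^ n * (1 + n * (1 / (n : ℝ) ^ 2)) ≤ t ^ n * (1 + 1 / (n : ℝ) ^ 2) ^ n :=
          mul_le_mul_of_nonneg_left (one_add_mul_le_pow (by linarith) n) (pow_nonneg ht0 n)
      _ = (t * (1 + 1 / (n : ℝ) ^ 2)) ^ n := (mul_pow _ _ _).symm
      _ ≤ (t + 1 / (n : ℝ) ^ 2) ^ n :=
          pow_le_pow_left₀ (mul_nonneg ht0 (by linarith)) (by nlinarith) n
      _ = missProb n ^ 2 := hsq.symm
  have h2 : n * (t ^ n * (1 + n * (1 / (n : ℝ) ^ 2))) = n * t ^ n + t ^ n := by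
    field_simp
  have h3 := mul_le_mul_of_nonneg_left h1 hpos.le
  rw [h2] at h3
  linarith

/-- Averaging `mainError` over the draws, with `tieCount` replaced by its mean `2 * n - 1` at a cost
that is controlled by its variance. -/
theorem mul_integral_mainError_le {n : ℕ} (hn : 2 ≤ n) {ρ : Measure (Fin n)}
    [IsProbabilityMeasure ρ] (hρ : ∀ k, ρ.real {k} = (n : ℝ)⁻¹) :
    n * ∫ J : Fin n → Fin n, mainError J (missProb n) ∂(Measure.pi fun _ : Fin n => ρ) ≤
      mainBound n := by
  have hn0 : 0 < n := by omega
  have hpos : (0 : ℝ) < n := by exact_mod_cast hn0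
  set q := 1 - missProb n with hq
  set v := missProb n - 2 * (1 - 2 / (n : ℝ)) ^ n with hv
  set π := Measure.pi fun _ : Fin n => ρ
  have hs : (0 : ℝ) < Real.sqrt n := Real.sqrt_pos.2 hpos
  have hss : Real.sqrt n * Real.sqrt n = n := Real.mul_self_sqrt hpos.le
  have hvar : ∫ J : Fin n → Fin n, (distinctCount J - n * q) ^ 2 ∂π ≤ n * v := by
    rw [hq, missProb, integral_sq_distinctCount_sub hn0 hρ]
    exact mul_le_mul_of_nonneg_left (variance_missed_le hn) hpos.le
  have hmean : ∫ J : Fin n → Fin n, distinctCount J ∂π = n * q :=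
    integral_distinctCount hn0 hρ
  have htie := integral_sq_tieCount_sub_le hn0 hρ
  have hpt : ∀ J : Fin n → Fin n, n * mainError J (missProb n) ≤
      1 / n * (distinctCount J - n * q) ^ 2 + 1 / 5 * ((1 / (2 * n) * ((tieCount J -
        (2 * (n : ℝ) - 1)) ^ 2 / Real.sqrt n + Real.sqrt n)) +
        2 / n ^ 2 * ((distinctCount J - n * q) ^ 2 + 2 * n * q * distinctCount J - n ^ 2 * q ^ 2)) +
        1 / 5 * (distinctCount J / n) := by
    intro J
    set K := distinctCount J
    set p := tieCount J
    have hK0 : 0 ≤ K := Nat.cast_nonneg _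
    have hKn : K ≤ n := distinctCount_le J
    have hK2 : K ^ 2 ≤ n ^ 2 := pow_le_pow_left₀ hK0 hKn 2
    have e : n * mainError J (missProb n) = 1 / n * (K - n * q) ^ 2 +
        1 / 5 * (K ^ 2 * p / n ^ 3) + 1 / 5 * (K / n) := by
      rw [mainError, ← hq]; field_simp; ring
    set w := p - (2 * (n : ℝ) - 1) with hw
    have hamgm : |w| ≤ 1 / 2 * (w ^ 2 / Real.sqrt n + Real.sqrt n) := by
      have h : w ^ 2 / Real.sqrt n + Real.sqrt n - 2 * |w| =
          (|w| - Real.sqrt n) ^ 2 / Real.sqrt n := by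
        rw [← sq_abs w]
        field_simp
        ring
      have : 0 ≤ (|w| - Real.sqrt n) ^ 2 / Real.sqrt n := by positivity
      linarith
    have h1 : K ^ 2 * p / n ^ 3 ≤ 1 / (2 * n) * (w ^ 2 / Real.sqrt n + Real.sqrt n) +
        2 / n ^ 2 * K ^ 2 := by
      have h2 : K ^ 2 * p ≤ n ^ 2 * |w| + 2 * n * K ^ 2 := by
        have h3 : K ^ 2 * w ≤ n ^ 2 * |w| :=
          (mul_le_mul_of_nonneg_left (le_abs_self w) (sq_nonneg K)).trans
            (mul_le_mul_of_nonneg_right hK2 (abs_nonneg w))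
        have h4 : K ^ 2 * p = K ^ 2 * w + 2 * n * K ^ 2 - K ^ 2 := by rw [hw]; ring
        nlinarith [sq_nonneg K]
      calc K ^ 2 * p / n ^ 3 ≤ (n ^ 2 * |w| + 2 * n * K ^ 2) / n ^ 3 := by gcongr
        _ = 1 / n * |w| + 2 / n ^ 2 * K ^ 2 := by field_simp
        _ ≤ 1 / n * (1 / 2 * (w ^ 2 / Real.sqrt n + Real.sqrt n)) + 2 / n ^ 2 * K ^ 2 := by gcongr
        _ = _ := by ring
    rw [e, show (K - n * q) ^ 2 + 2 * n * q * K - n ^ 2 * q ^ 2 = K ^ 2 by ring]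
    linarith
  rw [← integral_const_mul]
  refine (integral_mono .of_finite .of_finite hpt).trans ?_
  rw [integral_add .of_finite .of_finite, integral_add .of_finite .of_finite, integral_const_mul,
    integral_const_mul, integral_const_mul, integral_add .of_finite .of_finite,
    integral_const_mul, integral_const_mul, integral_add .of_finite .of_finite,
    integral_div, integral_sub .of_finite .of_finite, integral_add .of_finite .of_finite,
    integral_const_mul, integral_div, hmean]
  simp only [integral_const, probReal_univ, one_smul]
  set V := ∫ J : Fin n → Fin n, (distinctCount J - n * q) ^ 2 ∂π
  set W := ∫ J : Fin n → Fin n, (tieCount J - (2 * (n : ℝ) - 1)) ^ 2 ∂π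
  calc 1 / n * V + 1 / 5 * (1 / (2 * n) * (W / Real.sqrt n + Real.sqrt n) +
        2 / n ^ 2 * (V + 2 * n * q * (n * q) - n ^ 2 * q ^ 2)) + 1 / 5 * (n * q / n) ≤
      1 / n * (n * v) + 1 / 5 * (1 / (2 * n) * (2 * n / Real.sqrt n + Real.sqrt n) +
        2 / n ^ 2 * (n * v + 2 * n * q * (n * q) - n ^ 2 * q ^ 2)) + 1 / 5 * (n * q / n) := by
        gcongr
    _ = mainBound n := by
        rw [mainBound, ← hv, ← hq]
        have h1 : Real.sqrt n / n = 1 / Real.sqrt n := by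
          rw [div_eq_div_iff hpos.ne' hs.ne', one_mul, hss]
        have h2 : 1 / (2 * (n : ℝ)) * (2 * n / Real.sqrt n + Real.sqrt n) =
            1 / Real.sqrt n + 1 / 2 * (Real.sqrt n / n) := by field_simp
        rw [h2, h1]
        field_simp
        ring

theorem mul_integral_error_le {n : ℕ} (hn : 2 ≤ n) {ρ : Measure (Fin n)}
    [IsProbabilityMeasure ρ] (hρ : ∀ k, ρ.real {k} = (n : ℝ)⁻¹) :
    n * ∫ J : Fin n → Fin n, ((1 + 1 / Real.sqrt n) * mainError J (missProb n) +
      (1 + 1 / (1 / Real.sqrt n)) * (3168 * tieCount J ^ 2 / n ^ 4))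
        ∂(Measure.pi fun _ : Fin n => ρ) ≤ meanSquareBound n := by
  have hn0 : 0 < n := by omega
  have hpos : (0 : ℝ) < n := by exact_mod_cast hn0
  have hn1 : (1 : ℝ) ≤ n := by exact_mod_cast hn0
  rw [integral_add .of_finite .of_finite, integral_const_mul, integral_const_mul, one_div_one_div,
    integral_div, integral_const_mul]
  have h1 := mul_integral_mainError_le hn hρ
  have h2 : ∫ J : Fin n → Fin n, tieCount J ^ 2 ∂(Measure.pi fun _ : Fin n => ρ) ≤ 6 * n ^ 2 := by
    have e : ∀ J : Fin n → Fin n, tieCount J ^ 2 = (tieCount J - (2 * (n : ℝ) - 1)) ^ 2 +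
        2 * (2 * (n : ℝ) - 1) * tieCount J - (2 * (n : ℝ) - 1) ^ 2 := fun J => by ring
    simp only [e]
    rw [integral_sub .of_finite .of_finite, integral_add .of_finite .of_finite,
      integral_const_mul, integral_tieCount hn0 hρ]
    have := integral_sq_tieCount_sub_le hn0 hρ
    simp only [integral_const, probReal_univ, one_smul]
    nlinarith
  rw [meanSquareBound, mul_add]
  refine add_le_add ?_ ?_
  · calc n * ((1 + 1 / Real.sqrt n) * ∫ J : Fin n → Fin n, mainError J (missProb n)
          ∂(Measure.pi fun _ : Fin n => ρ)) = (1 + 1 / Real.sqrt n) *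
          (n * ∫ J : Fin n → Fin n, mainError J (missProb n)
            ∂(Measure.pi fun _ : Fin n => ρ)) := by ring
      _ ≤ _ := mul_le_mul_of_nonneg_left h1 (by positivity)
  · calc n * ((1 + Real.sqrt n) * (3168 * (∫ J : Fin n → Fin n, tieCount J ^ 2
          ∂(Measure.pi fun _ : Fin n => ρ)) / n ^ 4)) ≤
          n * ((1 + Real.sqrt n) * (3168 * (6 * n ^ 2) / n ^ 4)) := by gcongr
      _ = (1 + Real.sqrt n) * (19008 / n) := by field_simp; ring

theorem tendsto_missProb : Tendsto missProb atTop (𝓝 (Real.exp (-1))) := by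
  have := Real.tendsto_one_add_div_pow_exp (-1)
  refine this.congr fun n => ?_
  rw [missProb]; congr 1; ring

theorem tendsto_sqrt_natCast : Tendsto (fun n : ℕ => Real.sqrt n) atTop atTop :=
  Real.tendsto_sqrt_atTop.comp tendsto_natCast_atTop_atTop

theorem tendsto_meanSquareBound : Tendsto meanSquareBound atTop (𝓝 limitVariance) := by
  have hp := tendsto_missProb
  have hb : Tendsto (fun n : ℕ => (1 - 2 / (n : ℝ)) ^ n) atTop (𝓝 (Real.exp (-2))) := by
    refine (Real.tendsto_one_add_div_pow_exp (-2)).congr fun n => ?_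
    congr 1; ring
  have hs0 : ∀ c : ℝ, Tendsto (fun n : ℕ => c / Real.sqrt n) atTop (𝓝 0) := fun c =>
    tendsto_const_nhds.div_atTop tendsto_sqrt_natCast
  have hn0 : ∀ c : ℝ, Tendsto (fun n : ℕ => c / (n : ℝ)) atTop (𝓝 0) := fun c =>
    tendsto_const_nhds.div_atTop tendsto_natCast_atTop_atTop
  have hv := hp.sub (hb.const_mul 2)
  have hvn : Tendsto (fun n : ℕ => (missProb n - 2 * (1 - 2 / (n : ℝ)) ^ n) / n) atTop (𝓝 0) :=
    hv.div_atTop tendsto_natCast_atTop_atTop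
  have hq := hp.const_sub 1
  have hmain := ((hv.add ((((hs0 (3 / 2)).add ((hvn.add (hq.pow 2)).const_mul 2)).sub
    hq).const_mul (1 / 5))).add (hq.const_mul (2 / 5)))
  have hrem : Tendsto (fun n : ℕ => (1 + Real.sqrt n) * (19008 / (n : ℝ))) atTop (𝓝 0) := by
    have h1 := (hn0 19008).add (hs0 19008)
    rw [add_zero] at h1
    refine h1.congr' ?_
    filter_upwards [eventually_gt_atTop 0] with n hn
    have hpos : (0 : ℝ) < n := by exact_mod_cast hn
    have hs : (0 : ℝ) < Real.sqrt n := Real.sqrt_pos.2 hpos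
    have hss : Real.sqrt n * Real.sqrt n = n := Real.mul_self_sqrt hpos.le
    have : 19008 / Real.sqrt n = Real.sqrt n * (19008 / n) := by
      rw [mul_div_assoc', div_eq_div_iff hs.ne' hpos.ne']
      linear_combination (-19008) * hss
    rw [this]; ring
  have htot := (((hs0 1).const_add 1).mul hmain).add hrem
  have hval : (1 + 0 : ℝ) * (Real.exp (-1) - 2 * Real.exp (-2) + 1 / 5 *
      (0 + 2 * (0 + (1 - Real.exp (-1)) ^ 2) - (1 - Real.exp (-1))) +
      2 / 5 * (1 - Real.exp (-1))) + 0 = limitVariance := by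
    have e2 : Real.exp (-2) = Real.exp (-1) ^ 2 := by
      rw [← Real.exp_nat_mul]; norm_num
    have e1 : 8 / (5 * Real.exp 1 ^ 2) = 8 / 5 * Real.exp (-1) ^ 2 := by
      rw [Real.exp_neg]
      have := Real.exp_pos 1
      field_simp
    rw [limitVariance, e1, e2]; ring
  rw [hval] at htot
  exact htot

theorem limitVariance_lt : limitVariance < 2 / 5 := by
  have h := Real.exp_one_lt_d9
  have h0 := Real.exp_pos 1
  have h2 : Real.exp 1 ^ 2 < 8 := by nlinarith
  have h3 : 1 / 5 < 8 / (5 * Real.exp 1 ^ 2) := by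
    rw [div_lt_div_iff₀ (by norm_num) (by positivity)]; linarith
  rw [limitVariance]; linarith

/-! ### The law of the sample and of the resampling indices -/

theorem nullSingletonClass_of_continuous_cdf {μ : Measure ℝ} [IsProbabilityMeasure μ]
    (h : Continuous (cdf μ)) : NullSingletonClass μ := by
  refine ⟨fun x => ?_⟩
  have h1 := (cdf μ).measure_singleton x
  rw [measure_cdf] at h1
  have h2 := (monotone_cdf μ).continuousAt_iff_leftLim_eq_rightLim.1 (h.continuousAt (x := x))
  rw [StieltjesFunction.rightLim_eq] at h2
  rw [h1, h2, sub_self, ENNReal.ofReal_zero]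

/-- A measure on the plane is determined by its distribution function. -/
theorem eq_prod_of_Iic {κ : Measure (ℝ × ℝ)} {μ ν : Measure ℝ} [IsProbabilityMeasure μ]
    [IsProbabilityMeasure ν]
    (h : ∀ x y, κ (Set.Iic x ×ˢ Set.Iic y) = μ (Set.Iic x) * ν (Set.Iic y)) : μ.prod ν = κ := by
  have hspan : ∀ (m : Measure ℝ) [IsProbabilityMeasure m],
      Nonempty (m.FiniteSpanningSetsIn (Set.range Set.Iic)) := fun m _ =>
    ⟨{ set := fun k => Set.Iic (k : ℝ)
       set_mem := fun k => ⟨k, rfl⟩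
       finite := fun k => measure_lt_top _ _
       spanning := Set.iUnion_eq_univ_iff.2 fun x => exists_nat_ge x }⟩
  have hgen : MeasurableSpace.generateFrom (Set.range Set.Iic) = borel ℝ :=
    (borel_eq_generateFrom_Iic ℝ).symm
  refine Measure.prod_eq_generateFrom (by rw [hgen]; exact (BorelSpace.measurable_eq).symm)
    (by rw [hgen]; exact (BorelSpace.measurable_eq).symm) isPiSystem_Iic isPiSystem_Iic
    (hspan μ).some (hspan ν).some ?_
  rintro _ ⟨x, rfl⟩ _ ⟨y, rfl⟩
  exact h x y

/-- The rank correlation of the resample with indices `J` of the sample with coordinates `x` and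
`y`, the ties being broken by the order of the draws. -/
def resampledXi {n : ℕ} (x : Fin n → ℝ) (J : Fin n → Fin n) (y : Fin n → ℝ) : ℝ :=
  chatterjeeXi (fun j => y (J j)) (Tuple.sort fun j => x (J j))

theorem chatterjeeXi_eq_resampledXi {n : ℕ} {x : Fin n → ℝ} (hx : Function.Injective x)
    {J : Fin n → Fin n} {τ : Equiv.Perm (Fin n)} (h : IsArrangement (fun j => x (J j)) τ)
    (y : Fin n → ℝ) : chatterjeeXi (fun j => y (J j)) τ = resampledXi x J y :=
  chatterjeeXi_congr_arrangement hx h (Tuple.monotone_sort fun j => x (J j)) y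

theorem measurable_upRank {n : ℕ} (i : Fin n) : Measurable fun y : Fin n → ℝ => upRank y i :=
  Finset.measurable_fun_sum _ fun j _ =>
    measurable_levelInd (measurable_pi_apply j) (measurable_pi_apply i)

theorem measurable_downRank {n : ℕ} (i : Fin n) : Measurable fun y : Fin n → ℝ => downRank y i :=
  Finset.measurable_fun_sum _ fun j _ =>
    measurable_levelInd (measurable_pi_apply i) (measurable_pi_apply j)

theorem measurable_chatterjeeXi {n : ℕ} (π : Equiv.Perm (Fin n)) :
    Measurable fun y : Fin n → ℝ => chatterjeeXi y π := by
  have h1 : Measurable fun y : Fin n → ℝ => rankVariation y π := by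
    refine Finset.measurable_fun_sum _ fun i _ => ?_
    split_ifs
    · exact ((measurable_upRank _).sub (measurable_upRank _)).abs
    · exact measurable_const
  have h2 : Measurable fun y : Fin n → ℝ =>
      ∑ i : Fin n, downRank y i * ((n : ℝ) - downRank y i) :=
    Finset.measurable_fun_sum _ fun i _ =>
      (measurable_downRank i).mul (measurable_const.sub (measurable_downRank i))
  exact measurable_const.sub ((measurable_const.div (h2.const_mul 2)).mul h1)

theorem measurableSet_sort_eq {n : ℕ} (τ : Equiv.Perm (Fin n)) :
    MeasurableSet {x : Fin n → ℝ | Tuple.sort x = τ} := by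
  have : {x : Fin n → ℝ | Tuple.sort x = τ} = {x | (∀ i j, i ≤ j → x (τ i) ≤ x (τ j)) ∧
      ∀ i j, i < j → x (τ i) = x (τ j) → τ i < τ j} := by
    ext x
    simp only [Set.mem_ofPred_eq]
    rw [eq_comm, Tuple.eq_sort_iff]
    rfl
  rw [this, Set.ofPred_and]
  refine MeasurableSet.inter ?_ ?_
  · simp only [Set.ofPred_forall]
    exact MeasurableSet.iInter fun i => MeasurableSet.iInter fun j => MeasurableSet.iInter fun _ =>
      measurableSet_le (measurable_pi_apply _) (measurable_pi_apply _)
  · simp only [Set.ofPred_forall]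
    refine MeasurableSet.iInter fun i => MeasurableSet.iInter fun j => MeasurableSet.iInter
      fun _ => ?_
    by_cases hτ : τ i < τ j
    · simp [hτ]
    · simp only [hτ, imp_false]
      exact (measurableSet_eq_fun (f := fun x : Fin n → ℝ => x (τ i))
        (g := fun x : Fin n → ℝ => x (τ j)) (measurable_pi_apply _) (measurable_pi_apply _)).compl

theorem measurable_resampledXi {n : ℕ} (J : Fin n → Fin n) :
    Measurable fun p : (Fin n → ℝ) × (Fin n → ℝ) => resampledXi p.1 J p.2 := by
  have hcomp : Measurable fun x : Fin n → ℝ => fun j => x (J j) :=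
    measurable_pi_lambda _ fun j => measurable_pi_apply _
  have h : (fun p : (Fin n → ℝ) × (Fin n → ℝ) => resampledXi p.1 J p.2) = fun p =>
      ∑ τ : Equiv.Perm (Fin n), {x : Fin n → ℝ | Tuple.sort (fun j => x (J j)) = τ}.indicator
        (fun _ => chatterjeeXi (fun j => p.2 (J j)) τ) p.1 := by
    funext p
    rw [Finset.sum_eq_single (Tuple.sort fun j => p.1 (J j))]
    · rw [Set.indicator_of_mem (by rfl)]; rfl
    · intro τ _ hτ
      exact Set.indicator_of_notMem (fun h => hτ h.symm) _
    · exact fun h => absurd (Finset.mem_univ _) h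
  rw [h]
  refine Finset.measurable_fun_sum _ fun τ _ => ?_
  have hs : MeasurableSet {x : Fin n → ℝ | Tuple.sort (fun j => x (J j)) = τ} :=
    hcomp (measurableSet_sort_eq τ)
  exact Measurable.ite (measurable_fst hs)
    ((measurable_chatterjeeXi τ).comp (hcomp.comp measurable_snd)) measurable_const

theorem abs_resampledXi_le_one {n : ℕ} (x : Fin n → ℝ) (J : Fin n → Fin n) (y : Fin n → ℝ) :
    |resampledXi x J y| ≤ 1 := abs_chatterjeeXi_le_one _ _

theorem integrable_sq_resampledXi_sub {n : ℕ} (J : Fin n → Fin n) (c : ℝ)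
    {m : Measure ((Fin n → ℝ) × (Fin n → ℝ))} [IsFiniteMeasure m] :
    Integrable (fun p => (resampledXi p.1 J p.2 - c) ^ 2) m :=
  integrable_of_abs_le (((measurable_resampledXi J).sub_const c).pow_const 2) ((1 + |c|) ^ 2)
    fun p => by
      rw [abs_pow]
      refine pow_le_pow_left₀ (abs_nonneg _) ?_ 2
      exact (abs_sub _ _).trans (add_le_add (abs_resampledXi_le_one _ _ _) le_rfl)

theorem integral_sq_resampledXi_sub_le {μ ν : Measure ℝ} [IsProbabilityMeasure μ]
    [NullSingletonClass μ] [IsProbabilityMeasure ν] [NullSingletonClass ν] {n : ℕ} (hn : 0 < n)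
    (J : Fin n → Fin n) (c : ℝ) {δ : ℝ} (hδ : 0 < δ) :
    ∫ z : Fin n → ℝ × ℝ, (resampledXi (fun i => (z i).1) J (fun i => (z i).2) - c) ^ 2
        ∂(Measure.pi fun _ => μ.prod ν) ≤
      (1 + δ) * mainError J c + (1 + 1 / δ) * (3168 * tieCount J ^ 2 / n ^ 4) := by
  have hmp := measurePreserving_arrowProdEquivProdArrow ℝ ℝ (Fin n) (fun _ => μ) (fun _ => ν)
  have h1 := hmp.integral_comp' (fun p : (Fin n → ℝ) × (Fin n → ℝ) =>
    (resampledXi p.1 J p.2 - c) ^ 2)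
  have h2 : ∫ z : Fin n → ℝ × ℝ, (resampledXi (fun i => (z i).1) J (fun i => (z i).2) - c) ^ 2
      ∂(Measure.pi fun _ => μ.prod ν) = ∫ p, (resampledXi p.1 J p.2 - c) ^ 2
        ∂((Measure.pi fun _ : Fin n => μ).prod (Measure.pi fun _ : Fin n => ν)) := h1
  rw [h2, integral_prod _ (integrable_sq_resampledXi_sub J c)]
  have hae : ∀ᵐ x ∂(Measure.pi fun _ : Fin n => μ),
      ∫ y, (resampledXi x J y - c) ^ 2 ∂(Measure.pi fun _ : Fin n => ν) ≤
      (1 + δ) * mainError J c + (1 + 1 / δ) * (3168 * tieCount J ^ 2 / n ^ 4) := by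
    filter_upwards [ae_pi_injective_of_atomless (ν := μ)] with x hx
    exact integral_sq_chatterjeeXi_sub_le hn hx J (Tuple.monotone_sort fun j => x (J j)) c hδ
  refine (integral_mono_of_nonneg (ae_of_all _ fun x => integral_nonneg fun y => sq_nonneg _)
    (integrable_const _) hae).trans ?_
  simp

/-! ### Mean squares of the rank correlation of the sample and of its bootstrap version -/

theorem measurable_uncurry_resampledXi {n : ℕ} :
    Measurable fun p : ((Fin n → ℝ) × (Fin n → ℝ)) × (Fin n → Fin n) =>
      resampledXi p.1.1 p.2 p.1.2 :=
  measurable_from_prod_countable_left fun J => measurable_resampledXi J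

theorem measurable_resampledXi_comp {Ω : Type*} [MeasurableSpace Ω] {n : ℕ} {x y : Ω → Fin n → ℝ}
    {J : Ω → Fin n → Fin n} (hx : Measurable x) (hy : Measurable y) (hJ : Measurable J) :
    Measurable fun ω => resampledXi (x ω) (J ω) (y ω) := by
  have h : Measurable ((fun p : ((Fin n → ℝ) × (Fin n → ℝ)) × (Fin n → Fin n) =>
      resampledXi p.1.1 p.2 p.1.2) ∘ fun ω => ((x ω, y ω), J ω)) :=
    measurable_uncurry_resampledXi.comp ((hx.prodMk hy).prodMk hJ)
  rw [Function.comp_def] at h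
  exact h

section Sample

variable {Ω : Type*} [MeasurableSpace Ω] {P : Measure Ω} [IsProbabilityMeasure P]
  {X Y : ℕ → Ω → ℝ}

theorem measurable_sample (hX : ∀ i, Measurable (X i)) (hY : ∀ i, Measurable (Y i)) (n : ℕ) :
    Measurable (sample X Y n) :=
  measurable_pi_lambda _ fun i => (hX i).prodMk (hY i)

/-- The law of the sample is that of independent pairs with independent atomless coordinates. -/
theorem exists_map_sample_eq_pi (hX : ∀ i, Measurable (X i)) (hY : ∀ i, Measurable (Y i))
    (hindep : iIndepFun (fun i ω => (X i ω, Y i ω)) P)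
    (hident : ∀ i, IdentDistrib (fun ω => (X i ω, Y i ω)) (fun ω => (X 0 ω, Y 0 ω)) P P)
    (hcont : Continuous fun p : ℝ × ℝ => P.real {ω | X 0 ω ≤ p.1 ∧ Y 0 ω ≤ p.2})
    (hprod : ∀ x y : ℝ, P.real {ω | X 0 ω ≤ x ∧ Y 0 ω ≤ y} =
      P.real {ω | X 0 ω ≤ x} * P.real {ω | Y 0 ω ≤ y}) :
    ∃ μ ν : Measure ℝ, IsProbabilityMeasure μ ∧ IsProbabilityMeasure ν ∧ NullSingletonClass μ ∧
      NullSingletonClass ν ∧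
      ∀ n, P.map (sample X Y n) = Measure.pi fun _ : Fin n => μ.prod ν := by
  set μ := P.map (X 0) with hμ
  set ν := P.map (Y 0) with hν
  have pμ : IsProbabilityMeasure μ := Measure.isProbabilityMeasure_map (hX 0).aemeasurable
  have pν : IsProbabilityMeasure ν := Measure.isProbabilityMeasure_map (hY 0).aemeasurable
  have cμ : ∀ x, P.real {ω | X 0 ω ≤ x} = cdf μ x := fun x => by
    rw [cdf_eq_real, hμ, map_measureReal_apply (hX 0) measurableSet_Iic]; rfl
  have cν : ∀ x, P.real {ω | Y 0 ω ≤ x} = cdf ν x := fun x => by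
    rw [cdf_eq_real, hν, map_measureReal_apply (hY 0) measurableSet_Iic]; rfl
  have hc : Continuous fun p : ℝ × ℝ => cdf μ p.1 * cdf ν p.2 := by
    refine hcont.congr fun p => ?_
    rw [hprod, cμ, cν]
  have contμ : Continuous (cdf μ) := by
    obtain ⟨y, hy⟩ := ((tendsto_cdf_atTop ν).eventually (eventually_gt_nhds one_half_lt_one)).exists
    have h1 : Continuous fun x => cdf μ x * cdf ν y :=
      hc.comp (continuous_id.prodMk continuous_const)
    have h2 := h1.div_const (cdf ν y)
    refine h2.congr fun x => ?_
    exact mul_div_cancel_right₀ _ (by linarith)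
  have contν : Continuous (cdf ν) := by
    obtain ⟨x, hx⟩ := ((tendsto_cdf_atTop μ).eventually (eventually_gt_nhds one_half_lt_one)).exists
    have h1 : Continuous fun y => cdf μ x * cdf ν y :=
      hc.comp (continuous_const.prodMk continuous_id)
    have h2 := h1.div_const (cdf μ x)
    refine h2.congr fun y => ?_
    exact mul_div_cancel_left₀ _ (by linarith)
  refine ⟨μ, ν, pμ, pν, nullSingletonClass_of_continuous_cdf contμ,
    nullSingletonClass_of_continuous_cdf contν, fun n => ?_⟩
  have hpair : P.map (fun ω => (X 0 ω, Y 0 ω)) = μ.prod ν := by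
    refine (eq_prod_of_Iic fun x y => ?_).symm
    rw [Measure.map_apply ((hX 0).prodMk (hY 0)) (measurableSet_Iic.prod measurableSet_Iic),
      hμ, hν, Measure.map_apply (hX 0) measurableSet_Iic, Measure.map_apply (hY 0)
      measurableSet_Iic]
    have h := hprod x y
    rw [← ENNReal.toReal_eq_toReal_iff' (measure_ne_top _ _)
      (ENNReal.mul_ne_top (measure_ne_top _ _) (measure_ne_top _ _)), ENNReal.toReal_mul]
    exact h
  have hi : iIndepFun (fun (i : Fin n) ω => (X i ω, Y i ω)) P :=
    hindep.precomp Fin.val_injective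
  have h1 := (iIndepFun_iff_map_fun_eq_pi_map fun i : Fin n =>
    ((hX i).prodMk (hY i)).aemeasurable).1 hi
  have h2 : ∀ i : Fin n, P.map (fun ω => (X i ω, Y i ω)) = μ.prod ν := fun i => by
    rw [(hident i).map_eq, hpair]
  simp only [h2] at h1
  exact h1

variable {μ ν : Measure ℝ} [IsProbabilityMeasure μ] [IsProbabilityMeasure ν]
  [NullSingletonClass μ]

theorem ae_injective_fst {P : Measure Ω} (hX : ∀ i, Measurable (X i))
    (hY : ∀ i, Measurable (Y i)) {n : ℕ}
    (hS : P.map (sample X Y n) = Measure.pi fun _ : Fin n => μ.prod ν) :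
    ∀ᵐ ω ∂P, Function.Injective fun i : Fin n => X i ω := by
  have h1 : ∀ᵐ z ∂(Measure.pi fun _ : Fin n => μ.prod ν),
      Function.Injective fun i => (z i).1 := by
    have hmp := measurePreserving_arrowProdEquivProdArrow ℝ ℝ (Fin n) (fun _ => μ) (fun _ => ν)
    have h2 : MeasurePreserving (fun z : Fin n → ℝ × ℝ => fun i => (z i).1)
        (Measure.pi fun _ : Fin n => μ.prod ν) (Measure.pi fun _ : Fin n => μ) :=
      measurePreserving_fst.comp hmp
    exact h2.quasiMeasurePreserving.ae (ae_pi_injective_of_atomless (ν := μ))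
  rw [← hS] at h1
  exact ae_of_ae_map (measurable_sample hX hY n).aemeasurable h1

theorem sampleXi_ae_eq {P : Measure Ω} (hX : ∀ i, Measurable (X i))
    (hY : ∀ i, Measurable (Y i)) {n : ℕ}
    (hS : P.map (sample X Y n) = Measure.pi fun _ : Fin n => μ.prod ν)
    {π : (n : ℕ) → Ω → Equiv.Perm (Fin n)}
    (hπ : ∀ n ω, IsArrangement (fun i : Fin n => X i ω) (π n ω)) :
    sampleXi Y π n =ᵐ[P]
      fun ω => resampledXi (fun i : Fin n => X i ω) id (fun i : Fin n => Y i ω) := by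
  filter_upwards [ae_injective_fst hX hY hS] with ω hω
  have h := chatterjeeXi_eq_resampledXi hω (J := id) (hπ n ω) fun i : Fin n => Y i ω
  exact h

theorem bootXi_ae_eq {P : Measure Ω} (hX : ∀ i, Measurable (X i))
    (hY : ∀ i, Measurable (Y i)) {n : ℕ}
    (hS : P.map (sample X Y n) = Measure.pi fun _ : Fin n => μ.prod ν)
    {J : (n : ℕ) → Fin n → Ω → Fin n} {τ : (n : ℕ) → Ω → Equiv.Perm (Fin n)}
    (hτ : ∀ n ω, IsArrangement (fun j : Fin n => X (J n j ω) ω) (τ n ω)) :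
    bootXi Y J τ n =ᵐ[P] fun ω =>
      resampledXi (fun i : Fin n => X i ω) (fun j => J n j ω) (fun i : Fin n => Y i ω) := by
  filter_upwards [ae_injective_fst hX hY hS] with ω hω
  exact chatterjeeXi_eq_resampledXi hω (J := fun j => J n j ω) (x := fun i : Fin n => X i ω)
    (hτ n ω) fun i : Fin n => Y i ω

/-- The sample is its own resample with indices `id`, for which every index is drawn once. -/
theorem integral_sq_sampleXi_le {P : Measure Ω} [NullSingletonClass ν]
    (hX : ∀ i, Measurable (X i)) (hY : ∀ i, Measurable (Y i)) {n : ℕ}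
    (hn : 0 < n) (hS : P.map (sample X Y n) = Measure.pi fun _ : Fin n => μ.prod ν)
    {π : (n : ℕ) → Ω → Equiv.Perm (Fin n)}
    (hπ : ∀ n ω, IsArrangement (fun i : Fin n => X i ω) (π n ω)) :
    ∫ ω, sampleXi Y π n ω ^ 2 ∂P ≤ 7000 / n := by
  have hn' : (0 : ℝ) < n := by exact_mod_cast hn
  have hn1 : (1 : ℝ) ≤ n := by exact_mod_cast hn
  have h1 : ∫ ω, sampleXi Y π n ω ^ 2 ∂P = ∫ z : Fin n → ℝ × ℝ,
      (resampledXi (fun i => (z i).1) id (fun i => (z i).2) - 0) ^ 2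
        ∂(Measure.pi fun _ => μ.prod ν) := by
    rw [← hS, integral_map (measurable_sample hX hY n).aemeasurable]
    · refine integral_congr_ae ?_
      filter_upwards [sampleXi_ae_eq hX hY hS hπ] with ω hω
      rw [hω, sub_zero]; rfl
    · have : Measurable fun z : Fin n → ℝ × ℝ => ((fun i => (z i).1), fun i => (z i).2) := by
        fun_prop
      exact ((((measurable_resampledXi id).comp this).sub_const 0).pow_const 2).aestronglyMeasurable
  rw [h1]
  refine (integral_sq_resampledXi_sub_le hn id 0 one_pos).trans ?_
  have hK : distinctCount (id : Fin n → Fin n) = n := by simp [distinctCount]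
  have hp : tieCount (id : Fin n → Fin n) = n := by simp [tieCount]
  rw [mainError, hK, hp]
  have e : (1 + 1) * (((n : ℝ) / n - (1 - 0)) ^ 2 + 1 / 5 * (n ^ 2 * n / n ^ 4 - n / n ^ 2) +
      2 / 5 * (n / n ^ 2)) + (1 + 1 / 1) * (3168 * n ^ 2 / n ^ 4) =
      (4 / 5 + 6336 / n) / (n : ℝ) := by field_simp; ring
  rw [e]
  have : 6336 / (n : ℝ) ≤ 6336 := div_le_self (by norm_num) hn1
  gcongr
  linarith

/-- The indices of the draws are independent and uniform. -/
theorem map_indices_eq_pi {J : (n : ℕ) → Fin n → Ω → Fin n} (hJ : IsResampling P X Y J) {n : ℕ}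
    (hn : 0 < n) : ∃ ρ : Measure (Fin n), IsProbabilityMeasure ρ ∧
      (∀ k, ρ.real {k} = (n : ℝ)⁻¹) ∧
      P.map (fun ω j => J n j ω) = Measure.pi fun _ : Fin n => ρ := by
  let i0 : Fin n := ⟨0, hn⟩
  have hval : ∀ i k, P.map (J n i) {k} = (n : ℝ≥0∞)⁻¹ := fun i k => by
    rw [Measure.map_apply (hJ.measurable n i) (measurableSet_singleton k)]
    exact hJ.uniform n i k
  refine ⟨P.map (J n i0), Measure.isProbabilityMeasure_map (hJ.measurable n i0).aemeasurable,
    fun k => ?_, ?_⟩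
  · rw [Measure.real, hval, ENNReal.toReal_inv, ENNReal.toReal_natCast]
  · rw [(iIndepFun_iff_map_fun_eq_pi_map fun i => (hJ.measurable n i).aemeasurable).1 (hJ.indep n)]
    congr 1
    funext i
    exact Measure.ext_of_singleton fun k => by rw [hval, hval]

theorem mul_integral_sq_bootXi_sub_le [NullSingletonClass ν] (hX : ∀ i, Measurable (X i))
    (hY : ∀ i, Measurable (Y i)) {n : ℕ} (hn : 2 ≤ n)
    (hS : P.map (sample X Y n) = Measure.pi fun _ : Fin n => μ.prod ν)
    {J : (n : ℕ) → Fin n → Ω → Fin n} (hJ : IsResampling P X Y J)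
    {τ : (n : ℕ) → Ω → Equiv.Perm (Fin n)}
    (hτ : ∀ n ω, IsArrangement (fun j : Fin n => X (J n j ω) ω) (τ n ω)) :
    n * ∫ ω, (bootXi Y J τ n ω - missProb n) ^ 2 ∂P ≤ meanSquareBound n := by
  have hn0 : 0 < n := by omega
  have hn' : (0 : ℝ) < n := by exact_mod_cast hn0
  obtain ⟨ρ, pρ, hρ, hmapJ⟩ := map_indices_eq_pi hJ hn0
  have hsm := measurable_sample hX hY n
  have hJm : Measurable fun ω j => J n j ω := measurable_pi_lambda _ fun j => hJ.measurable n j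
  have hlaw := (indepFun_iff_map_prod_eq_prod_map_map hsm.aemeasurable hJm.aemeasurable).1
    (hJ.indep_sample n)
  rw [hS, hmapJ] at hlaw
  let G : (Fin n → ℝ × ℝ) × (Fin n → Fin n) → ℝ := fun q =>
    (resampledXi (fun i => (q.1 i).1) q.2 (fun i => (q.1 i).2) - missProb n) ^ 2
  have hGm : Measurable G := by
    refine measurable_from_prod_countable_left fun J => ?_
    have : Measurable fun z : Fin n → ℝ × ℝ => ((fun i => (z i).1), fun i => (z i).2) := by
      fun_prop
    exact (((measurable_resampledXi J).comp this).sub_const _).pow_const 2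
  have hGi : Integrable G ((Measure.pi fun _ : Fin n => μ.prod ν).prod
      (Measure.pi fun _ : Fin n => ρ)) :=
    integrable_of_abs_le hGm ((1 + |missProb n|) ^ 2) fun q => by
      rw [abs_pow]
      refine pow_le_pow_left₀ (abs_nonneg _) ?_ 2
      exact (abs_sub _ _).trans (add_le_add (abs_resampledXi_le_one _ _ _) le_rfl)
  have h1 : ∫ ω, (bootXi Y J τ n ω - missProb n) ^ 2 ∂P =
      ∫ J, ∫ z, G (z, J) ∂(Measure.pi fun _ : Fin n => μ.prod ν)
        ∂(Measure.pi fun _ : Fin n => ρ) := by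
    rw [← integral_prod_symm _ hGi, ← hlaw,
      integral_map (hsm.prodMk hJm).aemeasurable hGm.aestronglyMeasurable]
    refine integral_congr_ae ?_
    filter_upwards [bootXi_ae_eq hX hY hS hτ] with ω hω
    rw [hω]; rfl
  rw [h1]
  refine le_trans (mul_le_mul_of_nonneg_left ?_ hn'.le) (mul_integral_error_le hn hρ)
  refine integral_mono .of_finite .of_finite fun J => ?_
  -- `δ = 1 / √n` makes both the loss in the main term and the remainders negligible
  exact integral_sq_resampledXi_sub_le hn0 J (missProb n)
    (one_div_pos.2 (Real.sqrt_pos.2 hn'))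

end Sample

/-! ### Criteria against weak convergence -/

/-- An upper bound on the integrals of `φ` that is smaller than the integral, under the candidate
limit, of a bounded continuous function below `φ` rules out weak convergence. -/
theorem not_weaklyConverges_of_lintegral_le {κ : ℕ → Measure ℝ} {ν : Measure ℝ} {φ : ℝ → ℝ≥0∞}
    (f : ℝ →ᵇ ℝ) (hf : ∀ x, 0 ≤ f x) (hfφ : ∀ x, ENNReal.ofReal (f x) ≤ φ x) {c : ℝ}
    (hc0 : 0 ≤ c) (hc : c < ∫ x, f x ∂ν)
    (h : ∀ᶠ n in atTop, ∫⁻ x, φ x ∂(κ n) ≤ ENNReal.ofReal c) : ¬ WeaklyConverges κ ν := by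
  intro hw
  refine hc.not_ge (le_of_tendsto (hw f) ?_)
  filter_upwards [h] with n hn
  rw [integral_eq_lintegral_of_nonneg_ae (ae_of_all _ hf)
    f.continuous.measurable.aestronglyMeasurable]
  exact ENNReal.toReal_le_of_le_ofReal hc0 ((lintegral_mono hfφ).trans hn)

/-- Truncating `x ^ 2` loses arbitrarily little of the second moment of a centered Gaussian. -/
theorem exists_bounded_le_sq_lt_integral_gaussianReal {v : ℝ≥0} {c : ℝ} (hc : c < v) :
    ∃ f : ℝ →ᵇ ℝ, (∀ x, 0 ≤ f x) ∧ (∀ x, ENNReal.ofReal (f x) ≤ ENNReal.ofReal (x ^ 2)) ∧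
      c < ∫ x, f x ∂(gaussianReal 0 v) := by
  have hsq : ∫ x, x ^ 2 ∂(gaussianReal 0 v) = v := by
    have h := variance_fun_id_gaussianReal (μ := 0) (v := v)
    rwa [variance_of_integral_eq_zero aemeasurable_id' integral_id_gaussianReal] at h
  have hint : Integrable (fun x : ℝ => x ^ 2) (gaussianReal 0 v) :=
    (memLp_id_gaussianReal 2).integrable_sq
  have hlim : Tendsto (fun L : ℕ => ∫ x, min (x ^ 2) (L : ℝ) ∂(gaussianReal 0 v)) atTop
      (𝓝 (∫ x, x ^ 2 ∂(gaussianReal 0 v))) := by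
    refine tendsto_integral_of_dominated_convergence (fun x => x ^ 2)
      (fun L => (Measurable.min (by fun_prop) measurable_const).aestronglyMeasurable) hint
      (fun L => ae_of_all _ fun x => ?_) (ae_of_all _ fun x => ?_)
    · rw [Real.norm_eq_abs, abs_of_nonneg (le_min (sq_nonneg x) (Nat.cast_nonneg L))]
      exact min_le_left _ _
    · refine tendsto_const_nhds.congr' ?_
      filter_upwards [eventually_ge_atTop ⌈x ^ 2⌉₊] with L hL
      exact (min_eq_left ((Nat.le_ceil _).trans (by exact_mod_cast hL))).symm
  rw [hsq] at hlim
  obtain ⟨L, hL⟩ := (hlim.eventually (eventually_gt_nhds hc)).exists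
  refine ⟨BoundedContinuousFunction.ofNormedAddCommGroup (fun x : ℝ => min (x ^ 2) (L : ℝ))
    (by fun_prop) L fun x => ?_, fun x => le_min (sq_nonneg x) (Nat.cast_nonneg L),
    fun x => ENNReal.ofReal_le_ofReal (min_le_left _ _), hL⟩
  rw [Real.norm_eq_abs, abs_of_nonneg (le_min (sq_nonneg x) (Nat.cast_nonneg L))]
  exact min_le_right _ _

theorem half_le_gaussianReal_Iic (v : ℝ≥0) : 1 / 2 ≤ (gaussianReal 0 v).real (Set.Iic 0) := by
  have h1 : (gaussianReal 0 v).real (Set.Ici 0) = (gaussianReal 0 v).real (Set.Iic 0) := by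
    have h := gaussianReal_map_neg (μ := 0) (v := v)
    rw [neg_zero] at h
    conv_lhs => rw [← h]
    rw [map_measureReal_apply measurable_neg measurableSet_Ici]
    congr 1
    ext x
    simp
  have h2 : (1 : ℝ) ≤
      (gaussianReal 0 v).real (Set.Iic 0) + (gaussianReal 0 v).real (Set.Ici 0) := by
    have h := measureReal_union_le (μ := gaussianReal 0 v) (Set.Iic (0 : ℝ)) (Set.Ici 0)
    rwa [Set.Iic_union_Ici, probReal_univ] at h
  linarith

theorem exists_bounded_le_indicator_lt_integral_gaussianReal (v : ℝ≥0) :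
    ∃ f : ℝ →ᵇ ℝ, (∀ x, 0 ≤ f x) ∧
      (∀ x, ENNReal.ofReal (f x) ≤ (Set.Iic (1 : ℝ)).indicator 1 x) ∧
      1 / 4 < ∫ x, f x ∂(gaussianReal 0 v) := by
  have hb : ∀ x : ℝ, 0 ≤ max 0 (min 1 (1 - x)) ∧ max 0 (min 1 (1 - x)) ≤ 1 := fun x =>
    ⟨le_max_left _ _, max_le zero_le_one (min_le_left _ _)⟩
  let f : ℝ →ᵇ ℝ := BoundedContinuousFunction.ofNormedAddCommGroup
    (fun x : ℝ => max 0 (min 1 (1 - x))) (by fun_prop) 1 fun x => by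
      rw [Real.norm_eq_abs, abs_of_nonneg (hb x).1]; exact (hb x).2
  refine ⟨f, fun x => (hb x).1, fun x => ?_, ?_⟩
  · change ENNReal.ofReal (max 0 (min 1 (1 - x))) ≤ _
    by_cases hx : x ≤ 1
    · rw [Set.indicator_of_mem (Set.mem_Iic.2 hx)]
      exact ENNReal.ofReal_le_one.2 (hb x).2
    · rw [max_eq_left ((min_le_right _ _).trans (by linarith)), ENNReal.ofReal_zero]
      exact zero_le
  · have h1 : ∫ x, (Set.Iic (0 : ℝ)).indicator (fun _ => (1 : ℝ)) x ∂(gaussianReal 0 v) ≤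
        ∫ x, f x ∂(gaussianReal 0 v) := by
      refine integral_mono ((integrable_const _).indicator measurableSet_Iic) (f.integrable _)
        fun x => ?_
      change _ ≤ max 0 (min 1 (1 - x))
      by_cases hx : x ≤ 0
      · rw [Set.indicator_of_mem (Set.mem_Iic.2 hx)]
        exact le_max_of_le_right (le_min le_rfl (by linarith))
      · rw [Set.indicator_of_notMem (by simpa using hx)]
        exact (hb x).1
    rw [integral_indicator_const _ measurableSet_Iic, smul_eq_mul, mul_one] at h1
    linarith [half_le_gaussianReal_Iic v]

/-! ### Conditional laws given the sample -/

section CondDistrib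

variable {Ω β : Type*} [MeasurableSpace Ω] [MeasurableSpace β] {P : Measure Ω}
  {Z : Ω → β} {T : Ω → ℝ} {φ : ℝ → ℝ≥0∞}

theorem setLIntegral_comp_eq_setLIntegral_condDistrib [IsFiniteMeasure P] (hZ : Measurable Z)
    (hT : AEMeasurable T P) (hφ : Measurable φ) {E : Set β} (hE : MeasurableSet E) :
    ∫⁻ ω in Z ⁻¹' E, φ (T ω) ∂P = ∫⁻ z in E, ∫⁻ x, φ x ∂(condDistrib T Z P z) ∂(P.map Z) := by
  have h := Measure.setLIntegral_compProd (μ := P.map Z) (κ := condDistrib T Z P)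
    (f := fun p => φ p.2) (hφ.comp measurable_snd) hE MeasurableSet.univ
  have hZT : AEMeasurable (fun ω => (Z ω, T ω)) P := hZ.aemeasurable.prodMk hT
  rw [compProd_map_condDistrib hT,
    Measure.restrict_map_of_aemeasurable hZT (hE.prod MeasurableSet.univ),
    lintegral_map' (f := fun p : β × ℝ => φ p.2) (hφ.comp measurable_snd).aemeasurable
      hZT.restrict] at h
  simpa [Set.prod_univ, ← Set.preimage_comp, Function.comp_def] using h

/-- A bound, uniform over the values of `Z` in `E`, on a conditional mean given the value of `Z`
is a bound on the conditional mean given the event `Z ∈ E`. -/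
theorem lintegral_map_cond_le [IsFiniteMeasure P] (hZ : Measurable Z)
    (hT : AEMeasurable T P) (hφ : Measurable φ) {E : Set β} (hE : MeasurableSet E) {C : ℝ≥0∞}
    (hC : ∀ z ∈ E, ∫⁻ x, φ x ∂(condDistrib T Z P z) ≤ C) :
    ∫⁻ x, φ x ∂((ProbabilityTheory.cond P (Z ⁻¹' E)).map T) ≤ C := by
  rw [lintegral_map' hφ.aemeasurable (hT.mono_ac cond_absolutelyContinuous),
    ProbabilityTheory.cond, lintegral_smul_measure,
    setLIntegral_comp_eq_setLIntegral_condDistrib hZ hT hφ hE, smul_eq_mul]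
  have h1 : ∫⁻ z in E, ∫⁻ x, φ x ∂(condDistrib T Z P z) ∂(P.map Z) ≤ C * P (Z ⁻¹' E) := by
    refine (setLIntegral_mono measurable_const hC).trans_eq ?_
    rw [setLIntegral_const, Measure.map_apply hZ hE]
  by_cases h0 : P (Z ⁻¹' E) = 0
  · rw [h0, mul_zero, nonpos_iff_eq_zero] at h1
    rw [h1, mul_zero]
    exact zero_le
  · calc _ ≤ (P (Z ⁻¹' E))⁻¹ * (C * P (Z ⁻¹' E)) := by gcongr
      _ = C := by rw [mul_comm C, ← mul_assoc, ENNReal.inv_mul_cancel h0 (measure_ne_top _ _),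
          one_mul]

theorem measurableSet_lintegral_condDistrib_le [IsFiniteMeasure P] (hφ : Measurable φ)
    (C : ℝ≥0∞) : MeasurableSet {z | ∫⁻ x, φ x ∂(condDistrib T Z P z) ≤ C} :=
  measurableSet_le hφ.lintegral_kernel measurable_const

/-- Markov's inequality for the conditional mean of `φ (T)` as a function of the value of `Z`. -/
theorem measure_lt_lintegral_condDistrib_le [IsFiniteMeasure P] (hZ : Measurable Z)
    (hT : AEMeasurable T P) (hφ : Measurable φ) {c : ℝ} (hc : 0 < c) :
    P {ω | ¬ ∫⁻ x, φ x ∂(condDistrib T Z P (Z ω)) ≤ ENNReal.ofReal c} ≤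
      (∫⁻ ω, φ (T ω) ∂P) / ENNReal.ofReal c := by
  have h := setLIntegral_comp_eq_setLIntegral_condDistrib hZ hT hφ MeasurableSet.univ
  rw [Set.preimage_univ, Measure.restrict_univ, Measure.restrict_univ,
    lintegral_map hφ.lintegral_kernel hZ] at h
  rw [h]
  refine le_trans (measure_mono fun ω hω => ?_) (meas_ge_le_lintegral_div
    (hφ.lintegral_kernel.comp hZ).aemeasurable (ENNReal.ofReal_pos.2 hc).ne'
    ENNReal.ofReal_ne_top)
  exact (not_le.1 hω).le

end CondDistrib

theorem conditionallyNotConverging_of_lintegral_le {Ω : Type*} [MeasurableSpace Ω] {P : Measure Ω}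
    [IsFiniteMeasure P] {X Y : ℕ → Ω → ℝ} (hXY : ∀ n, Measurable (sample X Y n))
    {E : (n : ℕ) → Set (Fin n → ℝ × ℝ)} (hE : ∀ n, MeasurableSet (E n)) {T : ℕ → Ω → ℝ}
    (hT : ∀ n, AEMeasurable (T n) P) {ν : Measure ℝ} {φ : ℝ → ℝ≥0∞} (hφ : Measurable φ)
    (f : ℝ →ᵇ ℝ) (hf : ∀ x, 0 ≤ f x) (hfφ : ∀ x, ENNReal.ofReal (f x) ≤ φ x) {c : ℝ}
    (hc0 : 0 ≤ c) (hc : c < ∫ x, f x ∂ν)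
    (h : ∀ n, ∀ z ∈ E n, ∫⁻ x, φ x ∂(condDistrib (T n) (sample X Y n) P z) ≤ ENNReal.ofReal c) :
    ConditionallyNotConverging P X Y E T ν := by
  refine ⟨not_weaklyConverges_of_lintegral_le f hf hfφ hc0 hc (.of_forall fun n => ?_),
    fun z hz => not_weaklyConverges_of_lintegral_le f hf hfφ hc0 hc ?_⟩
  · exact lintegral_map_cond_le (hXY n) (hT n) hφ (hE n) (h n)
  · filter_upwards [hz] with n hn using h n _ hn

/-! ### Mean squares and convergence in measure -/

section MeanSquare

variable {Ω : Type*} {m mΩ : MeasurableSpace Ω} {P : Measure Ω}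

theorem not_tendstoInMeasure_const_of_integral_le [IsProbabilityMeasure P] {V : ℕ → Ω → ℝ}
    {β : ℕ → ℝ} {l v : ℝ} (hV0 : ∀ n, 0 ≤ᵐ[P] V n) (hVi : ∀ n, Integrable (V n) P)
    (hβ : ∀ᶠ n in atTop, ∫ ω, V n ω ∂P ≤ β n) (hl : Tendsto β atTop (𝓝 l)) (hlv : l < v) :
    ¬ TendstoInMeasure P V atTop (fun _ => v) := by
  intro h
  have hl0 : 0 ≤ l := ge_of_tendsto hl (by
    filter_upwards [hβ] with n hn using (integral_nonneg_of_ae (hV0 n)).trans hn)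
  obtain ⟨w, hlw, hwv⟩ := exists_between hlv
  have h1 := h (ENNReal.ofReal (v - w)) (ENNReal.ofReal_pos.2 (by linarith))
  have h2 : Tendsto (fun n => P.real {ω | ENNReal.ofReal (v - w) ≤ edist (V n ω) v}) atTop
      (𝓝 0) := (ENNReal.tendsto_toReal ENNReal.zero_ne_top).comp h1
  -- outside a set of vanishing probability `V n` exceeds `w`, so Markov's inequality applies
  have h3 : ∀ᶠ n in atTop, w * (1 - P.real {ω | ENNReal.ofReal (v - w) ≤ edist (V n ω) v}) ≤
      β n := by
    filter_upwards [hβ] with n hn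
    refine le_trans ?_ ((mul_meas_ge_le_integral_of_nonneg (hV0 n) (hVi n) w).trans hn)
    refine mul_le_mul_of_nonneg_left ?_ (by linarith)
    have hu := measureReal_union_le (μ := P) {ω | ENNReal.ofReal (v - w) ≤ edist (V n ω) v}
      {ω | w ≤ V n ω}
    have hun : {ω | ENNReal.ofReal (v - w) ≤ edist (V n ω) v} ∪ {ω | w ≤ V n ω} = Set.univ := by
      refine Set.eq_univ_of_forall fun ω => ?_
      by_cases hw : w ≤ V n ω
      · exact Or.inr hw
      · refine Or.inl ?_
        change _ ≤ edist (V n ω) v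
        rw [edist_dist]
        refine ENNReal.ofReal_le_ofReal ?_
        rw [Real.dist_eq, abs_sub_comm]
        exact (by linarith : v - w ≤ v - V n ω).trans (le_abs_self _)
    rw [hun, probReal_univ] at hu
    linarith
  have h4 := le_of_tendsto_of_tendsto ((h2.const_sub 1).const_mul w) hl h3
  linarith

theorem sq_integral_le_integral_sq [IsProbabilityMeasure P] {f : Ω → ℝ} (hf : MemLp f 2 P) :
    (∫ ω, f ω ∂P) ^ 2 ≤ ∫ ω, f ω ^ 2 ∂P := by
  have h := variance_nonneg f P
  rw [variance_eq_sub hf] at h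
  simp only [Pi.pow_apply] at h
  linarith

theorem integral_condVar_le_integral_sq_sub [IsProbabilityMeasure P] (hm : m ≤ mΩ) {f : Ω → ℝ}
    (hf : MemLp f 2 P) (c : ℝ) :
    ∫ ω, (Var[f; P | m]) ω ∂P ≤ ∫ ω, (f ω - c) ^ 2 ∂P := by
  have h1 := integral_condVar_add_variance_condExp hm hf
  have h2 := variance_nonneg (P[f | m]) P
  have h3 : Var[fun ω => f ω - c; P] = Var[f; P] := variance_sub_const hf.aestronglyMeasurable c
  have h4 : Var[fun ω => f ω - c; P] ≤ ∫ ω, (f ω - c) ^ 2 ∂P :=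
    variance_le_expectation_sq (hf.aestronglyMeasurable.sub aestronglyMeasurable_const)
  linarith

theorem condVar_nonneg (f : Ω → ℝ) : 0 ≤ᵐ[P] Var[f; P | m] :=
  condExp_nonneg (ae_of_all _ fun _ => sq_nonneg _)

theorem integral_condVar_eq [IsProbabilityMeasure P] (hm : m ≤ mΩ) {f : Ω → ℝ} :
    ∫ ω, (Var[f; P | m]) ω ∂P = ∫ ω, (f ω - (P[f | m]) ω) ^ 2 ∂P :=
  integral_condExp hm

end MeanSquare

/-! ### Consequences of mean square bounds at rate `1 / n` -/

section BoundedStatistics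

variable {Ω : Type*} {mΩ : MeasurableSpace Ω} {P : Measure Ω} [IsProbabilityMeasure P]
  {b s d : ℕ → Ω → ℝ} {c M : ℕ → ℝ} {l V : ℝ}

theorem memLp_two_of_abs_le {f : Ω → ℝ} (hf : AEStronglyMeasurable f P) {C : ℝ}
    (h : ∀ ω, |f ω| ≤ C) : MemLp f 2 P :=
  MemLp.of_bound hf C (ae_of_all _ h)

theorem integrable_sq_sub_const {f : Ω → ℝ} (hf : MemLp f 2 P) (a : ℝ) :
    Integrable (fun ω => (f ω - a) ^ 2) P :=
  (hf.sub (memLp_const a)).integrable_sq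

theorem tendsto_integral_sq_sub_of_mul_le (hb : ∀ n, MemLp (b n) 2 P)
    (hc : Tendsto c atTop (𝓝 l)) (hM : Tendsto M atTop (𝓝 V))
    (h : ∀ᶠ n : ℕ in atTop, n * ∫ ω, (b n ω - c n) ^ 2 ∂P ≤ M n) :
    Tendsto (fun n => ∫ ω, (b n ω - l) ^ 2 ∂P) atTop (𝓝 0) := by
  have h0 : Tendsto (fun n : ℕ => 2 * (M n / n) + 2 * (c n - l) ^ 2) atTop (𝓝 0) := by
    have h1 := (hM.div_atTop tendsto_natCast_atTop_atTop).const_mul 2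
    have h2 := (((hc.sub_const l).pow 2).const_mul 2)
    simpa using h1.add h2
  refine squeeze_zero' (.of_forall fun n => integral_nonneg fun ω => sq_nonneg _) ?_ h0
  filter_upwards [h, eventually_gt_atTop 0] with n hn hn0
  have hn' : (0 : ℝ) < n := by exact_mod_cast hn0
  have h1 : ∫ ω, (b n ω - l) ^ 2 ∂P ≤ ∫ ω, (2 * (b n ω - c n) ^ 2 + 2 * (c n - l) ^ 2) ∂P := by
    refine integral_mono (integrable_sq_sub_const (hb n) l)
      (((integrable_sq_sub_const (hb n) _).const_mul 2).add (integrable_const _)) fun ω => ?_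
    change (b n ω - l) ^ 2 ≤ 2 * (b n ω - c n) ^ 2 + 2 * (c n - l) ^ 2
    nlinarith [sq_nonneg ((b n ω - c n) - (c n - l))]
  rw [integral_add ((integrable_sq_sub_const (hb n) _).const_mul 2) (integrable_const _),
    integral_const_mul, integral_const, probReal_univ, one_smul] at h1
  have h2 : ∫ ω, (b n ω - c n) ^ 2 ∂P ≤ M n / n := by
    rw [le_div_iff₀ hn']; linarith
  linarith

theorem tendsto_integral_of_tendsto_integral_sq_sub (hb : ∀ n, MemLp (b n) 2 P)
    (h : Tendsto (fun n => ∫ ω, (b n ω - l) ^ 2 ∂P) atTop (𝓝 0)) :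
    Tendsto (fun n => ∫ ω, b n ω ∂P) atTop (𝓝 l) := by
  rw [tendsto_iff_norm_sub_tendsto_zero]
  have h1 : Tendsto (fun n => √(∫ ω, (b n ω - l) ^ 2 ∂P)) atTop (𝓝 0) := by
    simpa using h.sqrt
  refine squeeze_zero (fun n => norm_nonneg _) (fun n => ?_) h1
  rw [Real.norm_eq_abs]
  refine Real.abs_le_sqrt ?_
  have h2 := sq_integral_le_integral_sq ((hb n).sub (memLp_const l))
  simp only [Pi.sub_apply] at h2
  rwa [integral_sub ((hb n).integrable (by norm_num)) (integrable_const _), integral_const,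
    probReal_univ, one_smul] at h2

theorem tendsto_integral_sq_sub_sub (hb : ∀ n, MemLp (b n) 2 P) (hs : ∀ n, MemLp (s n) 2 P)
    (hbl : Tendsto (fun n => ∫ ω, (b n ω - l) ^ 2 ∂P) atTop (𝓝 0))
    (hs0 : Tendsto (fun n => ∫ ω, s n ω ^ 2 ∂P) atTop (𝓝 0)) :
    Tendsto (fun n => ∫ ω, (b n ω - s n ω - l) ^ 2 ∂P) atTop (𝓝 0) := by
  have h0 := (hbl.const_mul 2).add (hs0.const_mul 2)
  simp only [mul_zero, add_zero] at h0
  refine squeeze_zero (fun n => integral_nonneg fun ω => sq_nonneg _) (fun n => ?_) h0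
  rw [← integral_const_mul, ← integral_const_mul,
    ← integral_add ((integrable_sq_sub_const (hb n) l).const_mul 2)
      ((hs n).integrable_sq.const_mul 2)]
  refine integral_mono (integrable_sq_sub_const ((hb n).sub (hs n)) l)
    (((integrable_sq_sub_const (hb n) l).const_mul 2).add ((hs n).integrable_sq.const_mul 2))
    fun ω => ?_
  change (b n ω - s n ω - l) ^ 2 ≤ 2 * (b n ω - l) ^ 2 + 2 * s n ω ^ 2
  nlinarith [sq_nonneg ((b n ω - l) + s n ω)]

/-- If the bounded variables `d n` tend in mean square to a positive constant, then `n` times their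
conditional second moments cannot converge in measure to a finite constant. -/
theorem not_tendstoInMeasure_mul_condExp_sq {m : ℕ → MeasurableSpace Ω} (hm : ∀ n, m n ≤ mΩ)
    (hd : ∀ n, MemLp (d n) 2 P) {C : ℝ} (hdC : ∀ n ω, |d n ω| ≤ C) (hl : 0 < l)
    (h : Tendsto (fun n => ∫ ω, (d n ω - l) ^ 2 ∂P) atTop (𝓝 0)) (v : ℝ) :
    ¬ TendstoInMeasure P (fun (n : ℕ) ω => (n : ℝ) * (P[d n ^ 2 | m n]) ω) atTop
      (fun _ => v) := by
  intro hv
  have h1 := hv (ENNReal.ofReal 1) (by simp)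
  set A : ℕ → Set Ω := fun n =>
    {ω | ENNReal.ofReal 1 ≤ edist ((n : ℝ) * (P[d n ^ 2 | m n]) ω) v} with hA
  have h2 : Tendsto (fun n => P.real (A n)) atTop (𝓝 0) :=
    (ENNReal.tendsto_toReal ENNReal.zero_ne_top).comp h1
  have hAm : ∀ n, MeasurableSet (A n) := fun n => by
    refine measurableSet_le measurable_const ?_
    refine Measurable.edist ?_ measurable_const
    exact ((stronglyMeasurable_condExp.mono (hm n)).measurable).const_mul _
  -- off `A n`, the conditional second moment is at most `(|v| + 1) / n`
  have hbound : ∀ᶠ n : ℕ in atTop, ∫ ω, d n ω ^ 2 ∂P ≤ (|v| + 1) / n + C ^ 2 * P.real (A n) := by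
    filter_upwards [eventually_gt_atTop 0] with n hn0
    have hn' : (0 : ℝ) < n := by exact_mod_cast hn0
    have e1 : ∫ ω, d n ω ^ 2 ∂P = ∫ ω, (P[d n ^ 2 | m n]) ω ∂P := (integral_condExp (hm n)).symm
    have hC : ∀ᵐ ω ∂P, (P[d n ^ 2 | m n]) ω ≤ C ^ 2 := by
      have hmono := condExp_mono (m := m n) (hd n).integrable_sq (integrable_const (C ^ 2))
        (μ := P) (ae_of_all _ fun ω => sq_le_sq' (neg_le_of_abs_le (hdC n ω))
          (le_of_abs_le (hdC n ω)))
      rw [condExp_const (hm n)] at hmono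
      exact hmono
    rw [e1]
    calc ∫ ω, (P[d n ^ 2 | m n]) ω ∂P
        ≤ ∫ ω, ((|v| + 1) / n + (A n).indicator (fun _ => C ^ 2) ω) ∂P := by
          refine integral_mono_ae integrable_condExp
            ((integrable_const _).add ((integrable_const _).indicator (hAm n))) ?_
          filter_upwards [hC] with ω hω
          change _ ≤ (|v| + 1) / n + (A n).indicator (fun _ => C ^ 2) ω
          by_cases hωA : ω ∈ A n
          · rw [Set.indicator_of_mem hωA]
            have : 0 ≤ (|v| + 1) / (n : ℝ) := by positivity
            linarith
          · rw [Set.indicator_of_notMem hωA, add_zero, le_div_iff₀ hn', mul_comm]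
            have h3 : edist ((n : ℝ) * (P[d n ^ 2 | m n]) ω) v < ENNReal.ofReal 1 := not_le.1 hωA
            rw [edist_dist, ENNReal.ofReal_lt_ofReal_iff one_pos, Real.dist_eq] at h3
            linarith [(abs_lt.1 h3).2, le_abs_self v]
      _ = (|v| + 1) / n + C ^ 2 * P.real (A n) := by
          rw [integral_add (integrable_const _) ((integrable_const _).indicator (hAm n)),
            integral_const, probReal_univ, one_smul, integral_indicator_const _ (hAm n),
            smul_eq_mul, mul_comm (C ^ 2)]
  have hlow : ∀ n, l ^ 2 / 2 - ∫ ω, (d n ω - l) ^ 2 ∂P ≤ ∫ ω, d n ω ^ 2 ∂P := fun n => by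
    have h3 : ∫ ω, (l ^ 2 / 2 - (d n ω - l) ^ 2) ∂P ≤ ∫ ω, d n ω ^ 2 ∂P := by
      refine integral_mono ((integrable_const _).sub (integrable_sq_sub_const (hd n) l))
        (hd n).integrable_sq fun ω => ?_
      change l ^ 2 / 2 - (d n ω - l) ^ 2 ≤ d n ω ^ 2
      nlinarith [sq_nonneg (2 * d n ω - l)]
    rwa [integral_sub (integrable_const _) (integrable_sq_sub_const (hd n) l), integral_const,
      probReal_univ, one_smul] at h3
  have hlim : Tendsto (fun n : ℕ => (|v| + 1) / n + C ^ 2 * P.real (A n)) atTop (𝓝 0) := by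
    simpa using (tendsto_const_div_atTop_nhds_zero_nat (|v| + 1)).add (h2.const_mul (C ^ 2))
  have h4 := le_of_tendsto_of_tendsto (h.const_sub (l ^ 2 / 2)) hlim
    (hbound.mono fun n hn => (hlow n).trans hn)
  have : 0 < l ^ 2 := by positivity
  linarith

theorem tendsto_measure_sqrt_mul_le_one (hd : ∀ n, MemLp (d n) 2 P) (hl : 0 < l)
    (h : Tendsto (fun n => ∫ ω, (d n ω - l) ^ 2 ∂P) atTop (𝓝 0)) :
    Tendsto (fun n : ℕ => P {ω | √n * d n ω ≤ 1}) atTop (𝓝 0) := by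
  have h0 : Tendsto (fun n => ENNReal.ofReal ((∫ ω, (d n ω - l) ^ 2 ∂P) / (l ^ 2 / 4))) atTop
      (𝓝 0) := by
    simpa using ENNReal.tendsto_ofReal (h.div_const (l ^ 2 / 4))
  refine tendsto_of_tendsto_of_tendsto_of_le_of_le' tendsto_const_nhds h0
    (.of_forall fun n => zero_le) ?_
  filter_upwards [tendsto_sqrt_natCast.eventually_ge_atTop (2 / l)] with n hn
  have hl2 : 0 < l ^ 2 / 4 := by positivity
  have h1 := mul_meas_ge_le_integral_of_nonneg (ae_of_all P fun ω => sq_nonneg (d n ω - l))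
    (integrable_sq_sub_const (hd n) l) (l ^ 2 / 4)
  rw [mul_comm, ← le_div_iff₀ hl2] at h1
  rw [← ofReal_measureReal]
  refine ENNReal.ofReal_le_ofReal (le_trans (measureReal_mono fun ω hω => ?_) h1)
  change √n * d n ω ≤ 1 at hω
  change l ^ 2 / 4 ≤ (d n ω - l) ^ 2
  have h2 : d n ω ≤ l / 2 := by
    by_contra! hlt
    have : 1 < √n * d n ω := by
      calc (1 : ℝ) = 2 / l * (l / 2) := by field_simp
        _ ≤ √n * (l / 2) := by gcongr
        _ < √n * d n ω := by
          have : 0 < √(n : ℝ) := lt_of_lt_of_le (by positivity) hn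
          gcongr
    linarith
  nlinarith

end BoundedStatistics

theorem lintegral_ofReal_sq_sqrt_mul_sub_condExp {Ω : Type*} {m mΩ : MeasurableSpace Ω}
    {P : Measure Ω} [IsProbabilityMeasure P] (hm : m ≤ mΩ) {f : Ω → ℝ} (hf : MemLp f 2 P) (n : ℕ) :
    ∫⁻ ω, ENNReal.ofReal ((√n * (f ω - (P[f | m]) ω)) ^ 2) ∂P =
      ENNReal.ofReal (n * ∫ ω, (Var[f; P | m]) ω ∂P) := by
  have hi : Integrable (fun ω => (f ω - (P[f | m]) ω) ^ 2) P :=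
    (hf.sub (hf.condExp one_le_two)).integrable_sq
  rw [integral_condVar_eq hm, ← integral_const_mul,
    ofReal_integral_eq_lintegral_ofReal (hi.const_mul _)
      (ae_of_all _ fun ω => mul_nonneg (Nat.cast_nonneg n) (sq_nonneg _))]
  refine lintegral_congr fun ω => ?_
  rw [mul_pow, Real.sq_sqrt (Nat.cast_nonneg n)]

/-! ### Events on which neither rescaled error is asymptotically normal -/

/-- On samples for which the uncentered error has small conditional probability of being at most
`1`, and the centered one has conditional second moment at most some `c < v`, no Gaussian limit of
variance `v` is possible; by Markov's inequality such samples have probability bounded below. -/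
theorem exists_events_conditionallyNotConverging {Ω : Type*} [MeasurableSpace Ω] {P : Measure Ω}
    [IsProbabilityMeasure P] {X Y : ℕ → Ω → ℝ} (hXY : ∀ n, Measurable (sample X Y n))
    {b s : ℕ → Ω → ℝ} (hb : ∀ n, MemLp (b n) 2 P) (hs : ∀ n, MemLp (s n) 2 P) {l V : ℝ}
    {v : ℝ≥0} (hl : 0 < l)
    (hd : Tendsto (fun n => ∫ ω, (b n ω - s n ω - l) ^ 2 ∂P) atTop (𝓝 0)) {M : ℕ → ℝ}
    (hM : Tendsto M atTop (𝓝 V)) (hV : 0 ≤ V) (hVv : V < v)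
    (hvar : ∀ᶠ n : ℕ in atTop, n * ∫ ω, (Var[b n; P | sampleSigma X Y n]) ω ∂P ≤ M n) :
    ∃ E : (n : ℕ) → Set (Fin n → ℝ × ℝ), (∀ n, MeasurableSet (E n)) ∧
      0 < liminf (fun n => P {ω | sample X Y n ω ∈ E n}) atTop ∧
      ConditionallyNotConverging P X Y E (fun n ω => √n * (b n ω - s n ω)) (gaussianReal 0 v) ∧
      ConditionallyNotConverging P X Y E
        (fun n ω => √n * (b n ω - (P[b n | sampleSigma X Y n]) ω)) (gaussianReal 0 v) := by
  obtain ⟨c, hVc, hcv⟩ := exists_between hVv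
  have hc0 : 0 < c := hV.trans_lt hVc
  obtain ⟨f, hf0, hf, hfc⟩ := exists_bounded_le_indicator_lt_integral_gaussianReal v
  obtain ⟨g, hg0, hg, hgc⟩ := exists_bounded_le_sq_lt_integral_gaussianReal hcv
  set T₁ : ℕ → Ω → ℝ := fun n ω => √n * (b n ω - s n ω) with hT₁
  set T₂ : ℕ → Ω → ℝ := fun n ω => √n * (b n ω - (P[b n | sampleSigma X Y n]) ω) with hT₂
  have hσ : ∀ n, sampleSigma X Y n ≤ ‹MeasurableSpace Ω› := fun n => (hXY n).comap_le
  have mT₁ : ∀ n, AEMeasurable (T₁ n) P := fun n =>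
    ((hb n).aestronglyMeasurable.aemeasurable.sub
      (hs n).aestronglyMeasurable.aemeasurable).const_mul _
  have mT₂ : ∀ n, AEMeasurable (T₂ n) P := fun n =>
    ((hb n).aestronglyMeasurable.aemeasurable.sub
      integrable_condExp.aestronglyMeasurable.aemeasurable).const_mul _
  have mφ₁ : Measurable ((Set.Iic (1 : ℝ)).indicator (1 : ℝ → ℝ≥0∞)) :=
    measurable_one.indicator measurableSet_Iic
  have mφ₂ : Measurable fun x : ℝ => ENNReal.ofReal (x ^ 2) := by fun_prop
  let E₁ : (n : ℕ) → Set (Fin n → ℝ × ℝ) := fun n =>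
    {z | ∫⁻ x, (Set.Iic (1 : ℝ)).indicator (1 : ℝ → ℝ≥0∞) x
      ∂(condDistrib (T₁ n) (sample X Y n) P z) ≤ ENNReal.ofReal (1 / 4)}
  let E₂ : (n : ℕ) → Set (Fin n → ℝ × ℝ) := fun n =>
    {z | ∫⁻ x, ENNReal.ofReal (x ^ 2)
      ∂(condDistrib (T₂ n) (sample X Y n) P z) ≤ ENNReal.ofReal c}
  have hE : ∀ n, MeasurableSet (E₁ n ∩ E₂ n) := fun n =>
    (measurableSet_lintegral_condDistrib_le mφ₁ _).inter
      (measurableSet_lintegral_condDistrib_le mφ₂ _)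
  refine ⟨fun n => E₁ n ∩ E₂ n, hE, ?_,
    conditionallyNotConverging_of_lintegral_le hXY hE mT₁ mφ₁ f hf0 hf (by norm_num) hfc
      fun n z hz => hz.1,
    conditionallyNotConverging_of_lintegral_le hXY hE mT₂ mφ₂ g hg0 hg hc0.le hgc
      fun n z hz => hz.2⟩
  have hp₁ : ∀ n, P {ω | ¬ sample X Y n ω ∈ E₁ n} ≤
      P {ω | √n * (b n ω - s n ω) ≤ 1} / ENNReal.ofReal (1 / 4) := fun n => by
    refine (measure_lt_lintegral_condDistrib_le (hXY n) (mT₁ n) mφ₁ (by norm_num)).trans_eq ?_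
    congr 1
    have hms : NullMeasurableSet (T₁ n ⁻¹' Set.Iic 1) P :=
      (mT₁ n).nullMeasurableSet_preimage measurableSet_Iic
    exact lintegral_indicator_one₀ hms
  have hp₂ : ∀ᶠ n : ℕ in atTop, P {ω | ¬ sample X Y n ω ∈ E₂ n} ≤ ENNReal.ofReal (M n / c) := by
    filter_upwards [hvar] with n hn
    refine (measure_lt_lintegral_condDistrib_le (hXY n) (mT₂ n) mφ₂ hc0).trans ?_
    rw [lintegral_ofReal_sq_sqrt_mul_sub_condExp (hσ n) (hb n), ← ENNReal.ofReal_div_of_pos hc0]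
    exact ENNReal.ofReal_le_ofReal (div_le_div_of_nonneg_right hn hc0.le)
  have hlim : Tendsto (fun n : ℕ => P {ω | √n * (b n ω - s n ω) ≤ 1} / ENNReal.ofReal (1 / 4) +
      ENNReal.ofReal (M n / c)) atTop (𝓝 (ENNReal.ofReal (V / c))) := by
    have h1 := ENNReal.Tendsto.div_const
      (tendsto_measure_sqrt_mul_le_one (fun n => (hb n).sub (hs n)) hl hd)
      (b := ENNReal.ofReal (1 / 4)) (Or.inr (by simp))
    simpa using h1.add (ENNReal.tendsto_ofReal (hM.div_const c))
  have hlt : ENNReal.ofReal (V / c) < 1 := by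
    rw [ENNReal.ofReal_lt_one, div_lt_one hc0]
    exact hVc
  obtain ⟨r, hr, hr1⟩ := exists_between hlt
  refine lt_of_lt_of_le (tsub_pos_of_lt hr1) (le_liminf_of_le (by isBoundedDefault) ?_)
  filter_upwards [hp₂, hlim.eventually (eventually_lt_nhds hr)] with n hn hnr
  rw [tsub_le_iff_right]
  calc (1 : ℝ≥0∞) = P ({ω | sample X Y n ω ∈ E₁ n ∩ E₂ n} ∪
        ({ω | ¬ sample X Y n ω ∈ E₁ n} ∪ {ω | ¬ sample X Y n ω ∈ E₂ n})) := by
        rw [← measure_univ (μ := P)]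
        congr 1
        ext ω
        simp only [Set.mem_univ, Set.mem_union, Set.mem_ofPred_eq, Set.mem_inter_iff]
        tauto
    _ ≤ P {ω | sample X Y n ω ∈ E₁ n ∩ E₂ n} +
        (P {ω | ¬ sample X Y n ω ∈ E₁ n} + P {ω | ¬ sample X Y n ω ∈ E₂ n}) :=
        (measure_union_le _ _).trans (add_le_add le_rfl (measure_union_le _ _))
    _ ≤ _ := add_le_add le_rfl ((add_le_add (hp₁ n) hn).trans hnr.le)

end

theorem theorem1 {Ω : Type*} [MeasurableSpace Ω] (P : Measure Ω) [IsProbabilityMeasure P]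
    (X Y : ℕ → Ω → ℝ) (hX : ∀ i, Measurable (X i)) (hY : ∀ i, Measurable (Y i))
    -- the pairs are independent and identically distributed
    (hindep : iIndepFun (fun i ω => (X i ω, Y i ω)) P)
    (hident : ∀ i, IdentDistrib (fun ω => (X i ω, Y i ω)) (fun ω => (X 0 ω, Y 0 ω)) P P)
    -- the joint distribution function is continuous
    (hcont : Continuous fun p : ℝ × ℝ => P.real {ω | X 0 ω ≤ p.1 ∧ Y 0 ω ≤ p.2})
    -- the joint distribution function is the product of the marginal ones
    (hprod : ∀ x y : ℝ, P.real {ω | X 0 ω ≤ x ∧ Y 0 ω ≤ y} =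
      P.real {ω | X 0 ω ≤ x} * P.real {ω | Y 0 ω ≤ y})
    -- bootstrap indices
    (J : (n : ℕ) → Fin n → Ω → Fin n) (hJ : IsResampling P X Y J)
    -- orderings of the original and of the bootstrap sample, with ties broken arbitrarily
    (π τ : (n : ℕ) → Ω → Equiv.Perm (Fin n))
    (hπ : ∀ n ω, IsArrangement (fun i : Fin n => X i ω) (π n ω))
    (hτ : ∀ n ω, IsArrangement (fun j : Fin n => X (J n j ω) ω) (τ n ω)) :
    -- the statistics are square integrable
    (∀ n, MemLp (sampleXi Y π n) 2 P ∧ MemLp (bootXi Y J τ n) 2 P) ∧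
    -- variance inconsistency
    (¬ TendstoInMeasure P
        (fun (n : ℕ) ω =>
          (n : ℝ) * (P[(bootXi Y J τ n - sampleXi Y π n) ^ 2 | sampleSigma X Y n]) ω)
        atTop (fun _ => (2 / 5 : ℝ)) ∧
      ¬ TendstoInMeasure P
        (fun (n : ℕ) ω => (n : ℝ) * (Var[bootXi Y J τ n; P | sampleSigma X Y n]) ω)
        atTop (fun _ => (2 / 5 : ℝ))) ∧
    -- distribution inconsistency
    (∃ E : (n : ℕ) → Set (Fin n → ℝ × ℝ),
      (∀ n, MeasurableSet (E n)) ∧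
      0 < liminf (fun n => P {ω | sample X Y n ω ∈ E n}) atTop ∧
      ConditionallyNotConverging P X Y E
        (fun n ω => Real.sqrt n * (bootXi Y J τ n ω - sampleXi Y π n ω))
        (gaussianReal 0 (2 / 5)) ∧
      ConditionallyNotConverging P X Y E
        (fun n ω => Real.sqrt n *
          (bootXi Y J τ n ω - (P[bootXi Y J τ n | sampleSigma X Y n]) ω))
        (gaussianReal 0 (2 / 5))) ∧
    -- limit of the mean, and bound on the mean of the conditional variance
    Tendsto (fun n => ∫ ω, bootXi Y J τ n ω ∂P) atTop (𝓝 (1 / Real.exp 1)) ∧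
    limsup (fun n : ℕ =>
        (((n : ℝ) * ∫ ω, (Var[bootXi Y J τ n; P | sampleSigma X Y n]) ω ∂P : ℝ) : EReal)) atTop
      ≤ ((3 / 5 - 8 / (5 * Real.exp 1 ^ 2) : ℝ) : EReal) ∧
    (3 / 5 - 8 / (5 * Real.exp 1 ^ 2) : ℝ) < 2 / 5 := by
  obtain ⟨μ, ν, pμ, pν, aμ, aν, hS⟩ := exists_map_sample_eq_pi hX hY hindep hident hcont hprod
  have hXY := measurable_sample hX hY
  have hσ : ∀ n, sampleSigma X Y n ≤ ‹MeasurableSpace Ω› := fun n => (hXY n).comap_le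
  have mx : ∀ n, Measurable fun ω => fun i : Fin n => X i ω := fun n =>
    measurable_pi_lambda _ fun i => hX i
  have my : ∀ n, Measurable fun ω => fun i : Fin n => Y i ω := fun n =>
    measurable_pi_lambda _ fun i => hY i
  have hs1 : ∀ n ω, |sampleXi Y π n ω| ≤ 1 := fun n ω => abs_chatterjeeXi_le_one _ _
  have hb1 : ∀ n ω, |bootXi Y J τ n ω| ≤ 1 := fun n ω => abs_chatterjeeXi_le_one _ _
  have hs : ∀ n, MemLp (sampleXi Y π n) 2 P := fun n =>
    memLp_two_of_abs_le ((measurable_resampledXi_comp (mx n) (my n)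
      measurable_const).aestronglyMeasurable.congr (sampleXi_ae_eq hX hY (hS n) hπ).symm) (hs1 n)
  have hb : ∀ n, MemLp (bootXi Y J τ n) 2 P := fun n =>
    memLp_two_of_abs_le ((measurable_resampledXi_comp (mx n) (my n)
      (measurable_pi_lambda _ (hJ.measurable n))).aestronglyMeasurable.congr
        (bootXi_ae_eq hX hY (hS n) hτ).symm) (hb1 n)
  have hMS : ∀ᶠ n : ℕ in atTop,
      n * ∫ ω, (bootXi Y J τ n ω - missProb n) ^ 2 ∂P ≤ meanSquareBound n := by
    filter_upwards [eventually_ge_atTop 2] with n hn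
    exact mul_integral_sq_bootXi_sub_le hX hY hn (hS n) hJ hτ
  have hvar : ∀ᶠ n : ℕ in atTop, n * ∫ ω, (Var[bootXi Y J τ n; P | sampleSigma X Y n]) ω ∂P ≤
      meanSquareBound n := by
    filter_upwards [hMS] with n hn
    exact (mul_le_mul_of_nonneg_left (integral_condVar_le_integral_sq_sub (hσ n) (hb n) _)
      (Nat.cast_nonneg n)).trans hn
  have hl : 0 < Real.exp (-1) := Real.exp_pos _
  have hbl := tendsto_integral_sq_sub_of_mul_le hb tendsto_missProb tendsto_meanSquareBound hMS
  have hs0 : Tendsto (fun n => ∫ ω, sampleXi Y π n ω ^ 2 ∂P) atTop (𝓝 0) := by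
    refine squeeze_zero' (.of_forall fun n => integral_nonneg fun ω => sq_nonneg _) ?_
      (tendsto_const_div_atTop_nhds_zero_nat 7000)
    filter_upwards [eventually_gt_atTop 0] with n hn
    exact integral_sq_sampleXi_le hX hY hn (hS n) hπ
  have hd := tendsto_integral_sq_sub_sub hb hs hbl hs0
  have hV0 : 0 ≤ limitVariance := ge_of_tendsto tendsto_meanSquareBound (by
    filter_upwards [hMS] with n hn
    exact (mul_nonneg (Nat.cast_nonneg n) (integral_nonneg fun ω => sq_nonneg _)).trans hn)
  refine ⟨fun n => ⟨hs n, hb n⟩, ⟨?_, ?_⟩, ?_, ?_, ?_, limitVariance_lt⟩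
  · exact not_tendstoInMeasure_mul_condExp_sq hσ (fun n => (hb n).sub (hs n)) (C := 2)
      (fun n ω => (abs_sub _ _).trans (by linarith [hs1 n ω, hb1 n ω])) hl hd _
  · refine not_tendstoInMeasure_const_of_integral_le (β := meanSquareBound)
      (fun n => ?_) (fun n => integrable_condVar.const_mul _) ?_ tendsto_meanSquareBound
      limitVariance_lt
    · filter_upwards [condVar_nonneg (P := P) (m := sampleSigma X Y n) (bootXi Y J τ n)] with ω hω
      exact mul_nonneg (Nat.cast_nonneg n) hω
    · simpa only [integral_const_mul] using hvar
  · exact exists_events_conditionallyNotConverging hXY hb hs hl hd tendsto_meanSquareBound hV0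
      (by simpa using limitVariance_lt) hvar
  · rw [one_div, ← Real.exp_neg]
    exact tendsto_integral_of_tendsto_integral_sq_sub hb hbl
  · have hE : Tendsto (fun n : ℕ => (meanSquareBound n : EReal)) atTop
        (𝓝 (limitVariance : EReal)) :=
      (continuous_coe_real_ereal.tendsto _).comp tendsto_meanSquareBound
    refine le_trans (limsup_le_limsup ?_) hE.limsup_eq.le
    filter_upwards [hvar] with n hn
    exact EReal.coe_le_coe_iff.2 hn
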